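/- Let $\Bbbk$ be a field and let $\mathcal D$ be a $\Bbbk$-linear category with finite-dimensional hom spaces and a Serre functor $S$, i.e. a $\Bbbk$-linear autoequivalence with isomorphisms $\kappa_{x,y}:\mathcal D(x,y)\cong\mathcal D(y,Sx)^*$ satisfying $\kappa(hg)(u)=\kappa(g)(uh)$ and $\kappa(gf)(u)=\kappa(g)(S(f)u)$. Let $F$ be a $\Bbbk$-linear autoequivalence of $\mathcal D$ and let $T=S^-F$, where $S^-$ is a quasi-inverse of $S$. Let $p\mapsto T^p$ be a (coherent) $\Bbbk$-linear action of $\mathbb Z$ on $\mathcal D$ generated by $T$, let $\chi:\mathbb Z\to\Bbbk^\times$ be a character, let $0\le N\le m$ be integers, and let $k=m-N$. *Equivariant side.* An equivariant endofunctor of $(\mathcal D,T)$ is a pair $(\Phi,\phi)$ of a $\Bbbk$-linear functor $\Phi:\mathcal D\to\mathcal D$ and natural isomorphisms $\phi^p:\Phi T^p\cong T^p\Phi$ $(p\in\mathbb Z)$ compatible with addition in $\mathbb Z$; isomorphisms of such pairs are natural isomorphisms commuting with the $\phi^p$. For an autoequivalence $E$ of $\mathcal D$ let $\zeta_E:SE\cong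 ES$ be the natural isomorphism which corresponds under the Yoneda lemma to $\mathcal D(x,SEy)\cong\mathcal D(Ey,x)^*\cong\mathcal D(y,E^-x)^*\cong\mathcal D(E^-x,Sy)\cong\mathcal D(x,ESy)$. A $\chi$-equivariant Serre functor of $(\mathcal D,T)$ is an equivariant endofunctor $(S,s)$ with $S$ a Serre functor (with some $\kappa$) and $s^p=\chi(p)\,\zeta_{T^p}$ for all $p\in\mathbb Z$. The functor $(T,\mathrm{id})$ is $T$ with the isomorphisms $TT^p\cong T^pT$ given by the action; for $p=1$ this is the identity of $T^2$. *Hom-graded side.* The orbit category $\mathcal C=\mathcal D/\mathbb Z$ has the objects of $\mathcal D$ and $\mathcal C(x,y)=\bigoplus_{p}\mathcal C^p(x,y)$ with $\mathcal C^p(x,y)=\mathcal D(x,T^py)$. A degree-preserving endofunctor $(H,\gamma)$ of $\mathcal C$ is a $\Bbbk$-linear functor $H$ with a function $\gamma:\operatorname{ob}\mathcal C\to\mathbb Z$ such that $f\in\mathcal C^p(x,y)$ implies $H(f)\in\mathcal C^{p+\gamma(y)-\gamma(x)}(Hx,Hy)$; composition adds the functions: $(H',\gamma')(H,\gamma)=(H'H,\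 \gamma+\gamma'\circ H)$. An isomorphism $(H,\gamma)\cong(H',\gamma')$ is a natural isomorphism $H\cong H'$ whose component at $x$ is homogeneous of degree $\gamma'(x)-\gamma(x)$. Let $(\mathrm{id}_{\mathcal C},\underline N)$ be the identity functor with constant function $N$. A $\chi$-hom-graded Serre functor on $\mathcal C$, which requires all $\mathcal C^p(x,y)$ to be finite-dimensional, is a degree-preserving autoequivalence $(S^{\mathcal C},\ell)$ with linear maps $\kappa:\mathcal C(x,y)\to\mathcal C(y,S^{\mathcal C}x)^*$ that restrict to isomorphisms of $\mathcal C^p(x,y)$ with the dual of $\mathcal C^{\ell(x)-p}(y,S^{\mathcal C}x)$ (extended by zero to the other degrees) and satisfy $\kappa(gf)(u)=\kappa(g)(S^{\mathcal C}(f)u)$, and $\kappa(hg)(u)=\chi(r)\,\kappa(g)(uh)$ for $h$ of degree $r$. **Theorem.** The following are equivalent: (a) $(\mathcal D,T)$ has a $\chi$-equivariant Serre functor $(S,s')$ with $(S,s')^k\cong(T,\mathrm{id})^N$; (b) $\mathcal C$ has a $\chi$-hom-graded Serre functor $(S^{\mathcal C},\ell)$ with $(S^{\mathcal C},\ell)^k\cong(\mathrm{id}_{\mathcal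 C},\underline N)$. Suppose moreover that all spaces $\mathcal C(x,y)$ are finite-dimensional and that $\mathcal C$ has finitely many isomorphism classes of indecomposable objects. Let $x_1,\dots,x_n$ be representatives of the isomorphism classes of indecomposable objects of the idempotent completion of $\mathcal C$, each given by an idempotent of degree $0$, and let $A=\bigoplus_{i,j}\operatorname{Hom}(x_i,x_j)$ be the $\mathbb Z$-graded base algebra of $\mathcal C$, where $hf$ is the composite "first $f$, then $h$", with idempotents $e_i=\mathrm{id}_{x_i}$. Then (b) is equivalent to: (c) $A$ is a $\chi$-graded Frobenius algebra with a Nakayama automorphism $(\alpha,\ell)$ satisfying $(\alpha,\ell)^k\cong(\mathrm{id}_A,\underline N)$. Here a degree-adjusted automorphism $(\alpha,\ell)$ of $A$ is an algebra automorphism $\alpha$ permuting the $e_i$ with a function $\ell$ from $\{e_1,\dots,e_n\}$ to $\mathbb Z$ such that $a\in A^p$ implies $\alpha(e_da\,e_c)\in A^{p+\ell(e_d)-\ell(e_c)}$; composition is $(\alpha',\ell')(\alpha,\ell)=(\alpha'\alpha,\ \ell+\ell'\circ\alpha)$. An isomorphism $(\alpha,\ell)\cong(\alpha',\ell')$ is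 a unit $b\in A$ with $\alpha'(a)b=b\alpha(a)$ for all $a\in A$ and $\alpha'(e_i)\,b\,\alpha(e_i)\in A^{\ell'(e_i)-\ell(e_i)}$ for all $i$. The pair $(\alpha,\ell)$ is a Nakayama automorphism of the $\chi$-graded Frobenius algebra $A$ if there is a linear isomorphism $\varphi:A\to A^*$ with $\varphi(ca)(x)=\chi(p)\,\varphi(a)(xc)$ for $c\in A^p$, with $\varphi(ac)(x)=\varphi(a)(\alpha(c)x)$, and such that, for $a\in A^pe_i$, $\varphi(a)$ vanishes on $A^q$ for all $q\ne\ell(e_i)-p$. -/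

import Mathlib

open CategoryTheory CategoryTheory.Idempotents

universe u v w t

namespace FCY

noncomputable section

/-! ### Serre structures on `k`-linear categories -/

/-- A Serre structure on a `k`-linear (hom-finite) category `D`: a `k`-linear autoequivalence `S`
and isomorphisms `κ : D(x, y) ≃ D(y, S x)^*` natural in both variables. -/
structure SerreStructure (k : Type w) [Field k] (D : Type u) [Category.{v} D] [Preadditive D]
    [Linear k D] where
  S : D ⥤ D
  [additive : S.Additive]
  [linear : S.Linear k]
  [isEquivalence : S.IsEquivalence]
  homFinite : ∀ x y : D, Module.Finite k (x ⟶ y)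
  κ : ∀ x y : D, (x ⟶ y) ≃ₗ[k] Module.Dual k (y ⟶ S.obj x)
  κ_left : ∀ {x y z : D} (g : x ⟶ y) (h : y ⟶ z) (u : z ⟶ S.obj x),
    κ x z (g ≫ h) u = κ x y g (h ≫ u)
  κ_right : ∀ {a x y : D} (f : a ⟶ x) (g : x ⟶ y) (u : y ⟶ S.obj a),
    κ a y (f ≫ g) u = κ x y g (u ≫ S.map f)

attribute [instance] SerreStructure.additive SerreStructure.linear SerreStructure.isEquivalence

section Commutation

variable {k : Type w} [Field k] {D : Type u} [Category.{v} D] [Preadditive D] [Linear k D]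

/-- The transpose `D(y, S x) ≃ D(x, y)^*` of `κ`, sending `u` to `g ↦ κ(g)(u)`. -/
def SerreStructure.transpose (σ : SerreStructure k D) (x y : D) :
    (y ⟶ σ.S.obj x) ≃ₗ[k] Module.Dual k (x ⟶ y) :=
  haveI := σ.homFinite y (σ.S.obj x)
  (Module.evalEquiv k (y ⟶ σ.S.obj x)).trans (σ.κ x y).dualMap

/-- For an autoequivalence `E` with quasi-inverse `E⁻`, the composite
`D(x, S E y) ≃ D(E y, x)^* ≃ D(y, E⁻ x)^* ≃ D(E⁻ x, S y) ≃ D(x, E S y)`. -/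
def SerreStructure.commMap (σ : SerreStructure k D) (E : D ≌ D) [E.functor.Additive]
    [E.functor.Linear k] (x y : D) (v : x ⟶ σ.S.obj (E.functor.obj y)) :
    x ⟶ E.functor.obj (σ.S.obj y) :=
  (E.symm.toAdjunction.homEquiv x (σ.S.obj y))
    ((σ.transpose y (E.inverse.obj x)).symm
      ((σ.transpose (E.functor.obj y) x v).comp
        ((Linear.rightComp k (E.functor.obj y) (E.counit.app x)).comp
          (E.functor.mapLinearMap k : (y ⟶ E.inverse.obj x) →ₗ[k] _))))

/-- The canonical commutation map `ζ_E : S E ⟶ E S` of a Serre functor with an autoequivalence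
(its component at `y`), which corresponds to `commMap` under the Yoneda lemma. -/
def SerreStructure.zeta (σ : SerreStructure k D) (E : D ≌ D) [E.functor.Additive]
    [E.functor.Linear k] (y : D) : σ.S.obj (E.functor.obj y) ⟶ E.functor.obj (σ.S.obj y) :=
  σ.commMap E _ y (𝟙 _)

end Commutation

/-! ### `ℤ`-equivariant categories

A (coherent) `ℤ`-action on `D` is Mathlib's `HasShift D ℤ`; `p : ℤ` acts by `shiftFunctor D p`. -/

section Equivariant

variable (k : Type w) [Field k] (D : Type u) [Category.{v} D] [Preadditive D] [Linear k D]
  [HasShift D ℤ]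

/-- An equivariant `k`-linear endofunctor `(Φ, φ)` of `D`: `φ` is a family of natural
isomorphisms `φ^p : Φ T^p ≅ T^p Φ` for `p : ℤ`, compatible with addition in `ℤ`. -/
structure EquivariantEndo where
  Φ : D ⥤ D
  [additive : Φ.Additive]
  [linear : Φ.Linear k]
  [φ : Φ.CommShift ℤ]

attribute [instance] EquivariantEndo.additive EquivariantEndo.linear EquivariantEndo.φ

variable {k D}

namespace EquivariantEndo

/-- The identity equivariant functor. -/
def one : EquivariantEndo k D where
  Φ := 𝟭 D

/-- The composite `G ∘ F` of equivariant functors. -/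
def comp (G F : EquivariantEndo k D) : EquivariantEndo k D where
  Φ := F.Φ ⋙ G.Φ

/-- Powers of an equivariant functor. -/
def pow (F : EquivariantEndo k D) : ℕ → EquivariantEndo k D
  | 0 => one
  | n + 1 => comp F (pow F n)

/-- `F ≅ G` in the category of equivariant endofunctors. -/
def IsIso (F G : EquivariantEndo k D) : Prop :=
  ∃ e : F.Φ ≅ G.Φ, NatTrans.CommShift e.hom ℤ

end EquivariantEndo

/-- The commutation of `T = shiftFunctor D 1` with the action generated by `T`. -/
instance commShiftGenerator : (shiftFunctor D (1 : ℤ)).CommShift ℤ where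
  commShiftIso p := shiftFunctorComm D p 1
  commShiftIso_zero := by
    ext X
    have h : (shiftFunctorComm D (0 : ℤ) 1).hom.app X = (shiftFunctorComm D (1 : ℤ) 0).inv.app X := by
      rw [← shiftFunctorComm_symm]; rfl
    rw [h, ← cancel_epi ((shiftFunctorComm D (1 : ℤ) 0).hom.app X), Iso.hom_inv_id_app,
      shiftFunctorComm_zero_hom_app]
    simp [← Functor.map_comp_assoc]
  commShiftIso_add a b := by
    ext X
    rw [Functor.CommShift.isoAdd_hom_app]
    have key := shiftFunctorComm_hom_app_comp_shift_shiftFunctorAdd_hom_app (1 : ℤ) a b X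
    have hs : ∀ (c : ℤ) (Y : D), (shiftFunctorComm D c 1).hom.app Y =
        (shiftFunctorComm D (1 : ℤ) c).inv.app Y := by
      intro c Y; rw [← shiftFunctorComm_symm]; rfl
    rw [hs, hs, hs, ← cancel_epi ((shiftFunctorComm D (1 : ℤ) (a + b)).hom.app X),
      Iso.hom_inv_id_app, reassoc_of% key]
    simp [← Functor.map_comp_assoc]

/-- The equivariant functor `(T, id)` for `T = shiftFunctor D 1`. -/
def generator [∀ n : ℤ, (shiftFunctor D n).Additive] [∀ n : ℤ, (shiftFunctor D n).Linear k] :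
    EquivariantEndo k D where
  Φ := shiftFunctor D (1 : ℤ)

/-- The commutation map `T T ⟶ T T` of `(T, id)` is indeed the identity. -/
theorem generator_comm_one (X : D) :
    ((shiftFunctor D (1 : ℤ)).commShiftIso (1 : ℤ)).hom.app X = 𝟙 _ := by
  change (shiftFunctorComm D (1 : ℤ) 1).hom.app X = 𝟙 _
  rw [shiftFunctorComm_eq_refl]; rfl

/-- The equivariant endofunctor `(S, s)` attached to a Serre structure and commutation maps. -/
def SerreStructure.equivariant (σ : SerreStructure k D) (s : σ.S.CommShift ℤ) :
    EquivariantEndo k D where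
  Φ := σ.S

instance [∀ n : ℤ, (shiftFunctor D n).Additive] (p : ℤ) :
    (shiftEquiv D p).functor.Additive := inferInstanceAs (shiftFunctor D p).Additive

instance [∀ n : ℤ, (shiftFunctor D n).Additive] [∀ n : ℤ, (shiftFunctor D n).Linear k] (p : ℤ) :
    (shiftEquiv D p).functor.Linear k := inferInstanceAs ((shiftFunctor D p).Linear k)

/-- `(S, s, κ)` is a `χ`-equivariant Serre structure: `s^p = χ(p) ζ_{T^p}` for all `p`. -/
def SerreStructure.IsEquivariant [∀ n : ℤ, (shiftFunctor D n).Additive]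
    [∀ n : ℤ, (shiftFunctor D n).Linear k] (χ : AddChar ℤ kˣ) (σ : SerreStructure k D)
    (s : σ.S.CommShift ℤ) : Prop :=
  ∀ (p : ℤ) (y : D), (s.commShiftIso p).hom.app y = (χ p : k) • σ.zeta (shiftEquiv D p) y

end Equivariant

/-! ### `ℤ`-hom-graded categories -/

/-- A `ℤ`-hom-graded `k`-linear category; `homDeg x y p` is the space of maps of degree `p`. -/
class HomGraded (k : Type w) [Field k] (C : Type u) [Category.{v} C] [Preadditive C]
    [Linear k C] where
  homDeg : ∀ x y : C, ℤ → Submodule k (x ⟶ y)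
  isInternal : ∀ x y : C, DirectSum.IsInternal (homDeg x y)
  id_mem : ∀ x : C, 𝟙 x ∈ homDeg x x 0
  comp_mem : ∀ {x y z : C} {p q : ℤ} {f : x ⟶ y} {g : y ⟶ z},
    f ∈ homDeg x y p → g ∈ homDeg y z q → f ≫ g ∈ homDeg x z (p + q)

/-- The space of maps of degree `p` from `x` to `y`. -/
abbrev deg (k : Type w) [Field k] {C : Type u} [Category.{v} C] [Preadditive C] [Linear k C]
    [HomGraded k C] (x y : C) (p : ℤ) : Submodule k (x ⟶ y) := HomGraded.homDeg x y p

section HomGraded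

variable (k : Type w) [Field k] (C : Type u) [Category.{v} C] [Preadditive C] [Linear k C]
  [HomGraded k C]

/-- A degree-preserving endofunctor `(H, γ)` with degree adjuster `γ`. -/
structure GradedEndo where
  H : C ⥤ C
  [additive : H.Additive]
  [linear : H.Linear k]
  γ : C → ℤ
  map_mem : ∀ {x y : C} {p : ℤ} {f : x ⟶ y}, f ∈ deg k x y p →
    H.map f ∈ deg k (H.obj x) (H.obj y) (p + γ y - γ x)

attribute [instance] GradedEndo.additive GradedEndo.linear

variable {k C}

namespace GradedEndo

/-- The endofunctor `(id, N)` with constant degree adjuster. -/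
def idShift (N : ℤ) : GradedEndo k C where
  H := 𝟭 C
  γ _ := N
  map_mem h := by simpa using h

/-- The composite `G ∘ F` of degree-preserving functors. -/
def comp (G F : GradedEndo k C) : GradedEndo k C where
  H := F.H ⋙ G.H
  γ x := F.γ x + G.γ (F.H.obj x)
  map_mem {x y p f} h := by
    have := G.map_mem (F.map_mem h)
    simp only [Functor.comp_obj, Functor.comp_map]
    convert this using 2
    ring

/-- Powers of a degree-preserving functor. -/
def pow (F : GradedEndo k C) : ℕ → GradedEndo k C
  | 0 => idShift 0
  | n + 1 => comp F (pow F n)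

/-- `F ≅ G`: a natural isomorphism with components homogeneous of degree `δ(x) - γ(x)`. -/
def IsIso (F G : GradedEndo k C) : Prop :=
  ∃ e : F.H ≅ G.H, ∀ x : C,
    e.hom.app x ∈ deg k (F.H.obj x) (G.H.obj x) (G.γ x - F.γ x) ∧
    e.inv.app x ∈ deg k (G.H.obj x) (F.H.obj x) (F.γ x - G.γ x)

/-- `F` is an autoequivalence of the hom-graded category `C`. -/
def IsEquiv (F : GradedEndo k C) : Prop :=
  ∃ G : GradedEndo k C, IsIso (comp G F) (idShift 0) ∧ IsIso (comp F G) (idShift 0)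

end GradedEndo

variable (C)

/-- A `χ`-hom-graded Serre structure `(S, ℓ, κ)` on a locally hom-finite hom-graded category:
`κ` identifies `C^p(x, y)` with the dual of `C^{ℓ(x) - p}(y, S x)`, i.e. with the part of degree
`p - ℓ(x)` of the graded dual of `C(y, S x)`, and is natural with respect to the pivotal structure
sending a vector `v` of degree `r` to `χ(r)` times evaluation at `v`. -/
structure GradedSerreStructure (χ : AddChar ℤ kˣ) where
  /-- the degree-preserving functor `(S, ℓ)` -/
  S : GradedEndo k C
  isEquiv : S.IsEquiv
  locallyFinite : ∀ (x y : C) (p : ℤ), Module.Finite k (deg k x y p)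
  κ : ∀ x y : C, (x ⟶ y) →ₗ[k] Module.Dual k (y ⟶ S.H.obj x)
  κ_deg : ∀ {x y : C} {p q : ℤ} {f : x ⟶ y} {u : y ⟶ S.H.obj x}, f ∈ deg k x y p →
    u ∈ deg k y (S.H.obj x) q → q ≠ S.γ x - p → κ x y f u = 0
  κ_bijective : ∀ (x y : C) (p : ℤ), Function.Bijective
    (fun f : deg k x y p => (κ x y f).domRestrict (deg k y (S.H.obj x) (S.γ x - p)))
  κ_left : ∀ {x y z : C} {r : ℤ} (g : x ⟶ y) (h : y ⟶ z) (u : z ⟶ S.H.obj x),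
    h ∈ deg k y z r → κ x z (g ≫ h) u = (χ r : k) * κ x y g (h ≫ u)
  κ_right : ∀ {a x y : C} (f : a ⟶ x) (g : x ⟶ y) (u : y ⟶ S.H.obj a),
    κ a y (f ≫ g) u = κ x y g (u ≫ S.H.map f)

end HomGraded

/-! ### Orbit categories -/

/-- The orbit category `D / ℤ`: same objects as `D`, and
`(D / ℤ)(x, y) = ⨁ p, D(x, T^p y)`. -/
structure Orbit (D : Type u) where
  obj : D

namespace Orbit

section

variable {D : Type u} [Category.{v} D] [Preadditive D] [HasShift D ℤ]
  [∀ n : ℤ, (shiftFunctor D n).Additive]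

/-- Composition of `f : x ⟶ T^p y` and `g : y ⟶ T^q z` is `T^p(g) ∘ f : x ⟶ T^{q + p} z`. -/
def homogComp (x y z : D) (p q : ℤ) :
    ShiftedHom x y p →+ ShiftedHom y z q →+ DirectSum ℤ fun r => ShiftedHom x z r :=
  AddMonoidHom.mk'
    (fun f => AddMonoidHom.mk'
      (fun g => DirectSum.of (fun r => ShiftedHom x z r) (q + p) (f.comp g rfl))
      (fun g g' => by rw [ShiftedHom.comp_add, map_add]))
    (fun f f' => by ext g; simp [ShiftedHom.add_comp])

/-- Composition in the orbit category, extended biadditively. -/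
def compHom (x y z : D) :
    (DirectSum ℤ fun p => ShiftedHom x y p) →+ (DirectSum ℤ fun q => ShiftedHom y z q) →+
      DirectSum ℤ fun r => ShiftedHom x z r :=
  DirectSum.toAddMonoid fun p =>
    (DirectSum.toAddMonoid fun q => (homogComp x y z p q).flip).flip

theorem compHom_of (x y z : D) (p q : ℤ) (f : ShiftedHom x y p) (g : ShiftedHom y z q) :
    compHom x y z (DirectSum.of _ p f) (DirectSum.of _ q g) =
      DirectSum.of (fun r => ShiftedHom x z r) (q + p) (f.comp g rfl) := by
  simp [compHom, homogComp]

theorem comp_of_eq {x y z : D} {p q r : ℤ} (f : ShiftedHom x y p) (g : ShiftedHom y z q)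
    (h : q + p = r) : DirectSum.of (fun r => ShiftedHom x z r) (q + p) (f.comp g rfl) =
      DirectSum.of _ r (f.comp g h) := by
  subst h; rfl

/-- The category structure on the orbit category. -/
instance : Category (Orbit D) where
  Hom x y := DirectSum ℤ fun p => ShiftedHom x.obj y.obj p
  id x := DirectSum.of (fun p => ShiftedHom x.obj x.obj p) 0 (ShiftedHom.mk₀ 0 rfl (𝟙 x.obj))
  comp {x y z} f g := compHom x.obj y.obj z.obj f g
  id_comp {x y} f := by
    induction f using DirectSum.induction_on with
    | zero => simp
    | of p f =>
      rw [compHom_of, comp_of_eq _ _ (add_zero p), ShiftedHom.mk₀_id_comp]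
    | add f g hf hg => rw [map_add, hf, hg]
  comp_id {x y} f := by
    induction f using DirectSum.induction_on with
    | zero => simp
    | of p f =>
      rw [compHom_of, comp_of_eq _ _ (zero_add p), ShiftedHom.comp_mk₀_id]
    | add f g hf hg => rw [map_add, AddMonoidHom.add_apply, hf, hg]
  assoc {x y z t} f g h := by
    induction f using DirectSum.induction_on with
    | zero => simp
    | add f f' hf hf' => simp only [map_add, AddMonoidHom.add_apply, hf, hf']
    | of p f =>
      induction g using DirectSum.induction_on with
      | zero => simp
      | add g g' hg hg' => simp only [map_add, AddMonoidHom.add_apply, hg, hg']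
      | of q g =>
        induction h using DirectSum.induction_on with
        | zero => simp
        | add h h' hh hh' => simp only [map_add, hh, hh']
        | of r h =>
          simp only [compHom_of]
          rw [comp_of_eq _ _ (show r + (q + p) = r + q + p by ring)]
          congr 1
          exact ShiftedHom.comp_assoc f g h rfl rfl rfl

instance : Preadditive (Orbit D) where
  homGroup x y := inferInstanceAs (AddCommGroup (DirectSum ℤ fun p => ShiftedHom x.obj y.obj p))
  add_comp x y z f f' g := by
    exact DFunLike.congr_fun ((compHom x.obj y.obj z.obj).map_add f f') g
  comp_add x y z f g g' := by
    exact (compHom x.obj y.obj z.obj f).map_add g g'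

end

section

variable {k : Type w} [Field k] {D : Type u} [Category.{v} D] [Preadditive D] [Linear k D]
  [HasShift D ℤ] [∀ n : ℤ, (shiftFunctor D n).Additive] [∀ n : ℤ, (shiftFunctor D n).Linear k]

theorem smul_of (x y : D) (c : k) (p : ℤ) (f : ShiftedHom x y p) :
    c • DirectSum.of (fun p => ShiftedHom x y p) p f = DirectSum.of _ p (c • f) :=
  (DirectSum.of_smul k p c f).symm

theorem compHom_smul_left (x y z : D) (c : k) (f : DirectSum ℤ fun p => ShiftedHom x y p)
    (g : DirectSum ℤ fun q => ShiftedHom y z q) :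
    compHom x y z (c • f) g = c • compHom x y z f g := by
  induction f using DirectSum.induction_on with
  | zero => simp
  | add f f' hf hf' => simp only [smul_add, map_add, AddMonoidHom.add_apply, hf, hf']
  | of p f =>
    induction g using DirectSum.induction_on with
    | zero => simp
    | add g g' hg hg' => simp only [map_add, smul_add, hg, hg']
    | of q g => rw [smul_of, compHom_of, compHom_of, smul_of, ShiftedHom.smul_comp]

theorem compHom_smul_right (x y z : D) (c : k) (f : DirectSum ℤ fun p => ShiftedHom x y p)
    (g : DirectSum ℤ fun q => ShiftedHom y z q) :
    compHom x y z f (c • g) = c • compHom x y z f g := by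
  induction f using DirectSum.induction_on with
  | zero => simp
  | add f f' hf hf' => simp only [smul_add, map_add, AddMonoidHom.add_apply, hf, hf']
  | of p f =>
    induction g using DirectSum.induction_on with
    | zero => simp
    | add g g' hg hg' => simp only [map_add, smul_add, hg, hg']
    | of q g => rw [smul_of, compHom_of, compHom_of, smul_of, ShiftedHom.comp_smul]

instance : Linear k (Orbit D) where
  homModule x y := inferInstanceAs (Module k (DirectSum ℤ fun p => ShiftedHom x.obj y.obj p))
  smul_comp x y z c f g := compHom_smul_left x.obj y.obj z.obj c f g
  comp_smul x y z f c g := compHom_smul_right x.obj y.obj z.obj c f g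

/-- The grading: maps of degree `p` from `x` to `y` in the orbit category are `D(x, T^p y)`. -/
instance : HomGraded k (Orbit D) where
  homDeg x y p := LinearMap.range (DirectSum.lof k ℤ (fun p => ShiftedHom x.obj y.obj p) p)
  isInternal x y := by
    apply DirectSum.isInternal_submodule_of_iSupIndep_of_iSup_eq_top
    · intro p
      refine Disjoint.mono_right (iSup₂_le (a := LinearMap.ker (DirectSum.component k ℤ
        (fun p => ShiftedHom x.obj y.obj p) p)) ?_) ?_
      · rintro q hq _ ⟨f, rfl⟩
        exact DirectSum.of_eq_of_ne q p f hq.symm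
      · rw [Submodule.disjoint_def]
        rintro _ ⟨f, rfl⟩ h
        have h' : f = 0 := by
          rw [LinearMap.mem_ker, DirectSum.component.lof_self] at h; exact h
        rw [h', map_zero]
    · exact DFinsupp.iSup_range_lsingle
  id_mem x := ⟨_, rfl⟩
  comp_mem := by
    rintro x y z p q _ _ ⟨f, rfl⟩ ⟨g, rfl⟩
    rw [add_comm]
    exact ⟨f.comp g rfl, (compHom_of x.obj y.obj z.obj p q f g).symm⟩

end

end Orbit

/-! ### Indecomposable objects -/

/-- `x` is nonzero and not isomorphic to a direct sum of two nonzero objects. -/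
def IsIndecomposable {C : Type u} [Category.{v} C] [Preadditive C] (x : C) : Prop :=
  ¬ Limits.IsZero x ∧ ∀ (y z : C) (b : Limits.BinaryBicone y z), Nonempty b.IsBilimit →
    Nonempty (x ≅ b.pt) → Limits.IsZero y ∨ Limits.IsZero z

/-- `C` has finitely many isomorphism classes of indecomposable objects. -/
def FinitelyManyIndecomposables (C : Type u) [Category.{v} C] [Preadditive C] : Prop :=
  ∃ (n : ℕ) (X : Fin n → C), ∀ y : C, IsIndecomposable y → ∃ i, Nonempty (y ≅ X i)

/-! ### The graded base algebra -/

section Karoubi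

variable {k : Type w} [Field k] {C : Type u} [Category.{v} C] [Preadditive C] [Linear k C]

/-- The idempotent completion of a `k`-linear category is `k`-linear. -/
instance : Linear k (Karoubi C) where
  homModule P Q :=
    { smul := fun c f => ⟨c • f.f, by simp⟩
      one_smul := fun f => by ext; exact one_smul k f.f
      mul_smul := fun a b f => by ext; exact mul_smul a b f.f
      smul_zero := fun a => by ext; exact smul_zero a
      smul_add := fun a f g => by ext; exact smul_add a f.f g.f
      add_smul := fun a b f => by ext; exact add_smul a b f.f
      zero_smul := fun f => by ext; exact zero_smul k f.f }
  smul_comp P Q R c f g := by ext; exact Linear.smul_comp _ _ _ c f.f g.f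
  comp_smul P Q R f c g := by ext; exact Linear.comp_smul _ _ _ f.f c g.f

variable (k) in
/-- Maps of degree `p` between objects of the idempotent completion of a hom-graded category. -/
def karoubiDeg [HomGraded k C] (P Q : Karoubi C) (p : ℤ) : Submodule k (P ⟶ Q) where
  carrier := {f | f.f ∈ deg k P.X Q.X p}
  add_mem' hf hg := (deg k P.X Q.X p).add_mem hf hg
  zero_mem' := (deg k P.X Q.X p).zero_mem
  smul_mem' c _ hf := (deg k P.X Q.X p).smul_mem c hf

end Karoubi

/-- The algebra `A = ⨁ i j, C(x_i, x_j)` of a finite family of objects, an element `a` having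
components `a i j : x_i ⟶ x_j`; the product `h * f` is "first `f`, then `h`". -/
def HomAlg {C : Type u} [Category.{v} C] {ι : Type t} (X : ι → C) : Type (max t v) :=
  ∀ i j : ι, X i ⟶ X j

namespace HomAlg

section

variable {C : Type u} [Category.{v} C] [Preadditive C] {ι : Type t} (X : ι → C)

instance : AddCommGroup (HomAlg X) := inferInstanceAs (AddCommGroup (∀ i j : ι, X i ⟶ X j))

variable {X} in
@[ext] theorem ext {a b : HomAlg X} (h : ∀ i j, a i j = b i j) : a = b :=
  funext fun i => funext fun j => h i j

@[simp] theorem add_apply (a b : HomAlg X) (i j : ι) : (a + b) i j = a i j + b i j := rfl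
@[simp] theorem zero_apply (i j : ι) : (0 : HomAlg X) i j = 0 := rfl

open Classical in
/-- The idempotent `e_i`: the identity of `x_i`, extended by zero. -/
def idem (i : ι) : HomAlg X := Pi.single i (Pi.single i (𝟙 (X i)))

open Classical in
instance : One (HomAlg X) := ⟨fun i => Pi.single i (𝟙 (X i))⟩

open Classical in
theorem one_apply (i : ι) : (1 : HomAlg X) i = Pi.single i (𝟙 (X i)) := rfl

variable [Fintype ι]

instance : Mul (HomAlg X) := ⟨fun h f i j => ∑ l, f i l ≫ h l j⟩

theorem mul_apply (h f : HomAlg X) (i j : ι) : (h * f) i j = ∑ l, f i l ≫ h l j := rfl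

instance : Ring (HomAlg X) :=
  { (inferInstance : AddCommGroup (HomAlg X)) with
    mul_assoc := fun a b c => by
      ext i j
      simp only [mul_apply, Preadditive.comp_sum, Preadditive.sum_comp, Category.assoc]
      rw [Finset.sum_comm]
    one_mul := fun a => by
      classical
      ext i j
      rw [mul_apply, Finset.sum_eq_single j]
      · simp [one_apply]
      · intro l _ hl
        rw [one_apply, Pi.single_eq_of_ne hl.symm, Limits.comp_zero]
      · simp
    mul_one := fun a => by
      classical
      ext i j
      rw [mul_apply, Finset.sum_eq_single i]
      · simp [one_apply]
      · intro l _ hl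
        rw [one_apply, Pi.single_eq_of_ne hl, Limits.zero_comp]
      · simp
    left_distrib := fun a b c => by
      ext i j; simp [mul_apply, Preadditive.add_comp, Finset.sum_add_distrib]
    right_distrib := fun a b c => by
      ext i j; simp [mul_apply, Preadditive.comp_add, Finset.sum_add_distrib]
    zero_mul := fun a => by ext i j; simp [mul_apply]
    mul_zero := fun a => by ext i j; simp [mul_apply] }

end

section

variable {k : Type w} [Field k] {C : Type u} [Category.{v} C] [Preadditive C] [Linear k C]
  {ι : Type t} (X : ι → C)

instance : Module k (HomAlg X) := inferInstanceAs (Module k (∀ i j : ι, X i ⟶ X j))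

@[simp] theorem smul_apply (c : k) (a : HomAlg X) (i j : ι) : (c • a) i j = c • a i j := rfl

instance [Fintype ι] : Algebra k (HomAlg X) :=
  Algebra.ofModule
    (fun c a b => by ext i j; simp [mul_apply, Finset.smul_sum])
    (fun c a b => by ext i j; simp [mul_apply, Finset.smul_sum])

end

end HomAlg

section BaseAlgebra

variable (k : Type w) [Field k] {C : Type u} [Category.{v} C] [Preadditive C] [Linear k C]
  [HomGraded k C] {ι : Type t}

/-- `P` is a complete irredundant list of representatives of the isomorphism classes of
indecomposable objects of the idempotent completion of `C`, each given by an idempotent of degree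
`0`. So `P` is a skeleton of the base category of `C` and `HomAlg P` is the graded base algebra. -/
structure IsBaseSkeleton (P : ι → Karoubi C) : Prop where
  idem_mem : ∀ i, (P i).p ∈ deg k (P i).X (P i).X 0
  indecomposable : ∀ i, IsIndecomposable (P i)
  irredundant : ∀ i j, Nonempty (P i ≅ P j) → i = j
  complete : ∀ Q : Karoubi C, IsIndecomposable Q → ∃ i, Nonempty (Q ≅ P i)

/-- The grading on the base algebra. -/
def algDeg (P : ι → Karoubi C) (p : ℤ) : Submodule k (HomAlg P) where
  carrier := {a | ∀ i j, a i j ∈ karoubiDeg k (P i) (P j) p}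
  add_mem' ha hb i j := (karoubiDeg k (P i) (P j) p).add_mem (ha i j) (hb i j)
  zero_mem' i j := (karoubiDeg k (P i) (P j) p).zero_mem
  smul_mem' c _ ha i j := (karoubiDeg k (P i) (P j) p).smul_mem c (ha i j)

variable [Fintype ι]

/-- A degree-adjusted automorphism `(α, ℓ)` of the graded algebra `A = HomAlg P` with its primitive
idempotents `e_i`: `α` is an algebra automorphism permuting the `e_i`, and `a ∈ A^p` implies
`α(e_d a e_c) ∈ A^{p + ℓ(d) - ℓ(c)}`. -/
structure DegAdjAut (P : ι → Karoubi C) where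
  α : HomAlg P ≃ₐ[k] HomAlg P
  perm : Equiv.Perm ι
  map_idem : ∀ i, α (HomAlg.idem P i) = HomAlg.idem P (perm i)
  ℓ : ι → ℤ
  map_mem : ∀ {p : ℤ} {a : HomAlg P}, a ∈ algDeg k P p → ∀ d c : ι,
    α (HomAlg.idem P d * a * HomAlg.idem P c) ∈ algDeg k P (p + ℓ d - ℓ c)

variable {k}

namespace HomAlg

open Classical in
theorem idem_mul_mul_idem_apply (P : ι → Karoubi C) (a : HomAlg P) (d c i j : ι) :
    (idem P d * a * idem P c) i j =
      if i = c ∧ j = d then a i j else 0 := by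
  classical
  rw [mul_apply, Finset.sum_eq_single c]
  · by_cases hi : i = c
    · subst hi
      rw [mul_apply, Finset.sum_eq_single d]
      · by_cases hj : j = d
        · subst hj; simp [idem]
        · simp [idem, hj]
      · intro l _ hl; simp [idem, Pi.single_eq_of_ne hl]
      · simp
    · simp [idem, Pi.single_eq_of_ne hi, hi]
  · intro l _ hl
    by_cases hi : i = c
    · subst hi; simp [idem, Pi.single_eq_of_ne hl]
    · simp [idem, Pi.single_eq_of_ne hi]
  · simp

theorem idem_mul_self (P : ι → Karoubi C) (c : ι) : idem P c * idem P c = idem P c := by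
  classical
  ext1 i j
  rw [mul_apply, Finset.sum_eq_single c]
  · by_cases hi : i = c
    · subst hi; simp [idem]
    · simp [idem, Pi.single_eq_of_ne hi]
  · intro l _ hl; simp [idem, Pi.single_eq_of_ne hl]
  · simp

theorem idem_mul_mul_idem_mem (P : ι → Karoubi C) {a : HomAlg P} {p : ℤ}
    (h : a ∈ algDeg k P p) (d c : ι) : idem P d * a * idem P c ∈ algDeg k P p := by
  intro i j
  rw [idem_mul_mul_idem_apply]
  split_ifs
  · exact h i j
  · exact (karoubiDeg k (P i) (P j) p).zero_mem

end HomAlg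

namespace DegAdjAut

variable {P : ι → Karoubi C}

/-- `(id, N)` with constant degree adjuster. -/
def idShift (N : ℤ) : DegAdjAut k P where
  α := AlgEquiv.refl
  perm := Equiv.refl ι
  map_idem _ := rfl
  ℓ _ := N
  map_mem {p a} h d c := by
    simpa using HomAlg.idem_mul_mul_idem_mem P h d c

/-- Composition `g ∘ f`; the degree adjuster is `i ↦ ℓ_f(i) + ℓ_g(f(i))`. -/
def comp (g f : DegAdjAut k P) : DegAdjAut k P where
  α := f.α.trans g.α
  perm := f.perm.trans g.perm
  map_idem i := by simp [f.map_idem, g.map_idem]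
  ℓ i := f.ℓ i + g.ℓ (f.perm i)
  map_mem {p a} h d c := by
    have h1 := g.map_mem (f.map_mem h d c) (f.perm d) (f.perm c)
    have h2 : HomAlg.idem P (f.perm d) * f.α (HomAlg.idem P d * a * HomAlg.idem P c) *
        HomAlg.idem P (f.perm c) = f.α (HomAlg.idem P d * a * HomAlg.idem P c) := by
      rw [← f.map_idem, ← f.map_idem, ← map_mul, ← map_mul]
      congr 1
      simp only [mul_assoc, HomAlg.idem_mul_self]
      simp only [← mul_assoc, HomAlg.idem_mul_self]
    rw [h2] at h1
    have h3 : p + (f.ℓ d + g.ℓ (f.perm d)) - (f.ℓ c + g.ℓ (f.perm c)) =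
        p + f.ℓ d - f.ℓ c + g.ℓ (f.perm d) - g.ℓ (f.perm c) := by ring
    rw [h3]
    exact h1

/-- Powers of a degree-adjusted automorphism. -/
def pow (f : DegAdjAut k P) : ℕ → DegAdjAut k P
  | 0 => idShift 0
  | n + 1 => comp f (pow f n)

/-- `f ≅ g`: there is a unit `b` of `A` with `g(a) b = b f(a)` for all `a`, whose component
`g(e_i) b f(e_i)` is homogeneous of degree `ℓ_g(i) - ℓ_f(i)` for each `i`. -/
def IsIso (f g : DegAdjAut k P) : Prop :=
  ∃ b : (HomAlg P)ˣ, (∀ a : HomAlg P, g.α a * b = b * f.α a) ∧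
    ∀ i : ι, g.α (HomAlg.idem P i) * b * f.α (HomAlg.idem P i) ∈ algDeg k P (g.ℓ i - f.ℓ i)

/-- `(φ, α, ℓ)` is a `χ`-graded Frobenius structure on `A = HomAlg P`: `φ` is an isomorphism of
graded bimodules from `A` to the `χ`-dual of `A` twisted on the right by `(α, ℓ)`, that is
`φ(c a) = χ(p) φ(a)(- c)` for `c ∈ A^p`, `φ(a c) = φ(a)(α(c) -)`, and `φ` sends `A^p e_i` to
functionals supported in degree `ℓ(i) - p`. -/
structure IsFrobenius (χ : AddChar ℤ kˣ) (f : DegAdjAut k P)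
    (φ : HomAlg P ≃ₗ[k] Module.Dual k (HomAlg P)) : Prop where
  map_mul_left : ∀ {p : ℤ} {c : HomAlg P}, c ∈ algDeg k P p → ∀ a m : HomAlg P,
    φ (c * a) m = (χ p : k) * φ a (m * c)
  map_mul_right : ∀ a c m : HomAlg P, φ (a * c) m = φ a (f.α c * m)
  map_deg : ∀ {p q : ℤ} {a m : HomAlg P} (i : ι), a ∈ algDeg k P p → m ∈ algDeg k P q →
    q ≠ f.ℓ i - p → φ (a * HomAlg.idem P i) m = 0

/-- `(α, ℓ)` is a `χ`-graded Nakayama automorphism of `A = HomAlg P`. -/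
def IsNakayama (χ : AddChar ℤ kˣ) (f : DegAdjAut k P) : Prop :=
  ∃ φ : HomAlg P ≃ₗ[k] Module.Dual k (HomAlg P), f.IsFrobenius χ φ

end DegAdjAut

end BaseAlgebra

end

end FCY

/-! # Fractional Calabi-Yau orbit categories and graded Frobenius algebras

Serre duality on `D` is governed by the traces `tr : D(x, S x) → k`, `tr(u) = κ(id)(u)`: they
satisfy `κ(g)(u) = tr(u g)` and the pairing is nondegenerate, so a map into `S x` is determined by
the traces of its composites. For an autoequivalence `E`, the map `ζ_E : S E ⟶ E S` is the unique
one with `tr(ζ_E⁻¹ E(w)) = tr(w)` for `w : y ⟶ S y` (`SerreStructure.IsComm`), and uniqueness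
yields naturality in the object and compatibility with composition. Hence `s^p = χ(p) ζ_{T^p}` is
compatible with the action, and every Serre functor of `D` is `χ`-equivariant in exactly one way
(`twistedCommShift_isEquivariant`).

*Passing to the orbit category.* An equivariant functor `(Φ, φ)` induces a functor of degree
adjuster `0` on `C = D / ℤ` (`EquivariantEndo.toGraded`), and `(T, id)` becomes isomorphic to `(id,
1)`, since the identity of `T x`, read in `D(T x, T x)`, is an isomorphism `T x ≅ x` of degree `1`
in `C`. The trace of `D`, extended by zero to the degrees other than `0`, makes the functor induced
by an equivariant Serre functor a graded Serre functor (`SerreStructure.orbitSerre`); the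
equivariance `s^p = χ(p) ζ_{T^p}` is what naturality with respect to precomposition amounts to.
Conversely, graded Serre functors are unique up to isomorphism (`GradedSerreStructure.isIso`), so
that any of them may be replaced by the one coming from `D`, and isomorphisms of degree `0` between
induced functors come from equivariant isomorphisms. This gives the equivalence of (a) and (b),
`equivariant_iff_orbit`.

*Passing to the base algebra.* If the `C(x, y)` are finite-dimensional, then the identity of every
object given by an idempotent of degree `0` is a finite sum of homogeneous maps factoring through
the representatives `P i` (`exists_sum_homogeneousFactor`), because the `P i` have local
endomorphism rings, so that one homogeneous component of the inclusion of a summand `P i` already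
splits. An autoequivalence of `C` therefore induces a degree-adjusted automorphism of the base
algebra (`Realizes`, `GradedEndo.IsEquiv.exists_realizes`), composites inducing composites, and two
functors are isomorphic if and only if their automorphisms are (`Realizes.isIso_automorphism`,
`Realizes.isIso_functor`). A graded Serre functor induces a Nakayama automorphism
(`GradedSerreStructure.isNakayama`), and Nakayama automorphisms are unique up to isomorphism
(`DegAdjAut.IsNakayama.isIso`). As `C` has a graded Serre functor, namely the one induced by a
Serre functor of `D`, this gives the equivalence of (b) and (c).
-/

namespace FCY

noncomputable section

/-! ### The trace form of a Serre structure and its commutation maps -/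

namespace SerreStructure

variable {k : Type w} [Field k] {D : Type u} [Category.{v} D] [Preadditive D] [Linear k D]
  (σ : SerreStructure k D)

/-- The trace `D(x, S x) → k` of a Serre structure, `u ↦ κ(id)(u)`. -/
def tr (x : D) : (x ⟶ σ.S.obj x) →ₗ[k] k := σ.κ x x (𝟙 x)

theorem κ_eq_tr {x y : D} (g : x ⟶ y) (u : y ⟶ σ.S.obj x) : σ.κ x y g u = σ.tr x (g ≫ u) := by
  simpa [tr] using σ.κ_left (𝟙 x) g u

theorem tr_comp {a x : D} (f : a ⟶ x) (w : x ⟶ σ.S.obj a) :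
    σ.tr a (f ≫ w) = σ.tr x (w ≫ σ.S.map f) := by
  rw [← κ_eq_tr]
  simpa [tr] using σ.κ_right f (𝟙 x) w

/-- Every functional on `D(x, a)` is the trace pairing with some `a ⟶ S x`. -/
theorem exists_tr_eq {x a : D} (Λ : Module.Dual k (x ⟶ a)) :
    ∃ u : a ⟶ σ.S.obj x, ∀ g : x ⟶ a, σ.tr x (g ≫ u) = Λ g := by
  refine ⟨(σ.transpose x a).symm Λ, fun g => ?_⟩
  rw [← κ_eq_tr]
  exact DFunLike.congr_fun ((σ.transpose x a).apply_symm_apply Λ) g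

theorem ext_of_tr {x a : D} {u u' : a ⟶ σ.S.obj x}
    (h : ∀ g : x ⟶ a, σ.tr x (g ≫ u) = σ.tr x (g ≫ u')) : u = u' := by
  apply (σ.transpose x a).injective
  ext g
  change σ.κ x a g u = σ.κ x a g u'
  rw [κ_eq_tr, κ_eq_tr, h]

/-- The property characterising the commutation map `ζ_E : S E y ⟶ E S y`: postcomposition with
it, followed by `E⁻¹` on morphisms, preserves traces. -/
def IsComm (E : D ⥤ D) (y : D) (z : σ.S.obj (E.obj y) ⟶ E.obj (σ.S.obj y)) : Prop :=
  ∀ (g : E.obj y ⟶ σ.S.obj (E.obj y)) (h : y ⟶ σ.S.obj y), E.map h = g ≫ z →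
    σ.tr y h = σ.tr (E.obj y) g

variable {σ}

/-- A map into `E S y` is determined by the traces of its composites with maps out of `E y`. -/
theorem hom_ext_of_tr {E : D ⥤ D} [E.Full] [E.EssSurj] {y x : D}
    {a b : x ⟶ E.obj (σ.S.obj y)}
    (H : ∀ (g : E.obj y ⟶ x) (h h' : y ⟶ σ.S.obj y),
      E.map h = g ≫ a → E.map h' = g ≫ b → σ.tr y h = σ.tr y h') : a = b := by
  rw [← cancel_epi (E.objObjPreimageIso x).hom]
  obtain ⟨h, hh⟩ := E.map_surjective ((E.objObjPreimageIso x).hom ≫ a)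
  obtain ⟨h', hh'⟩ := E.map_surjective ((E.objObjPreimageIso x).hom ≫ b)
  rw [← hh, ← hh']
  congr 1
  apply σ.ext_of_tr
  intro c
  exact H (E.map c ≫ (E.objObjPreimageIso x).hom) _ _ (by simp [hh]) (by simp [hh'])

namespace IsComm

theorem unique {E : D ⥤ D} [E.Full] [E.EssSurj] {y : D}
    {z z' : σ.S.obj (E.obj y) ⟶ E.obj (σ.S.obj y)} (hz : σ.IsComm E y z)
    (hz' : σ.IsComm E y z') : z = z' :=
  hom_ext_of_tr fun g h h' e e' => (hz g h e).trans (hz' g h' e').symm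

theorem naturality {E : D ⥤ D} [E.Full] [E.Faithful] [E.EssSurj] {y y' : D} (f : y ⟶ y')
    {z : σ.S.obj (E.obj y) ⟶ E.obj (σ.S.obj y)} {z' : σ.S.obj (E.obj y') ⟶ E.obj (σ.S.obj y')}
    (hz : σ.IsComm E y z) (hz' : σ.IsComm E y' z') :
    σ.S.map (E.map f) ≫ z' = z ≫ E.map (σ.S.map f) := by
  apply hom_ext_of_tr (σ := σ)
  intro g h h' e e'
  obtain ⟨c, hc⟩ := E.map_surjective (g ≫ z)
  obtain rfl : h' = c ≫ σ.S.map f := E.map_injective (by simp [hc, e'])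
  rw [hz' (g ≫ σ.S.map (E.map f)) h (by simp [e]), ← tr_comp, ← tr_comp,
    hz (E.map f ≫ g) (f ≫ c) (by simp [hc])]

theorem isIso {E : D ⥤ D} [E.Full] [E.Faithful] [E.Additive] [E.Linear k] {y : D}
    {z : σ.S.obj (E.obj y) ⟶ E.obj (σ.S.obj y)} (hz : σ.IsComm E y z) : IsIso z := by
  -- the inverse represents the functional `E c ↦ tr c`
  obtain ⟨z', hz'⟩ := σ.exists_tr_eq (x := E.obj y) (a := E.obj (σ.S.obj y))
    ((σ.tr y).comp (LinearEquiv.ofBijective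
      (E.mapLinearMap k : (y ⟶ σ.S.obj y) →ₗ[k] _)
      ⟨E.map_injective, E.map_surjective⟩).symm.toLinearMap)
  have hz'' : ∀ c : y ⟶ σ.S.obj y, σ.tr (E.obj y) (E.map c ≫ z') = σ.tr y c := by
    intro c
    rw [hz', LinearMap.comp_apply]
    congr 1
    rw [LinearEquiv.coe_coe, LinearEquiv.symm_apply_eq]
    rfl
  refine ⟨z', ?_, ?_⟩
  · apply σ.ext_of_tr
    intro g
    obtain ⟨c, hc⟩ := E.map_surjective (g ≫ z)
    rw [← Category.assoc, ← hc, hz'', hz g c hc, Category.comp_id]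
  · obtain ⟨w, hw⟩ := E.map_surjective (z' ≫ z)
    rw [← hw, ← E.map_id]
    congr 1
    apply σ.ext_of_tr
    intro c
    rw [hz (E.map c ≫ z') (c ≫ w) (by simp [hw]), hz'', Category.comp_id]

theorem id (y : D) : σ.IsComm (𝟭 D) y (𝟙 _) := by
  intro g h e
  simp at e
  subst e
  rfl

theorem comp {E E' : D ⥤ D} [E'.Full] [E'.Faithful] {y : D}
    {z : σ.S.obj (E.obj y) ⟶ E.obj (σ.S.obj y)}
    {z' : σ.S.obj (E'.obj (E.obj y)) ⟶ E'.obj (σ.S.obj (E.obj y))}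
    (hz : σ.IsComm E y z) (hz' : σ.IsComm E' (E.obj y) z') :
    σ.IsComm (E ⋙ E') y (z' ≫ E'.map z) := by
  intro g h e
  obtain ⟨c, hc⟩ := E'.map_surjective (g ≫ z')
  rw [hz c h, hz' g c hc]
  · rfl
  · apply E'.map_injective
    rw [E'.map_comp, hc]
    simpa using e

theorem of_iso {E E' : D ⥤ D} (i : E ≅ E') {y : D}
    {z : σ.S.obj (E.obj y) ⟶ E.obj (σ.S.obj y)} (hz : σ.IsComm E y z) :
    σ.IsComm E' y (σ.S.map (i.inv.app y) ≫ z ≫ i.hom.app (σ.S.obj y)) := by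
  intro g h e
  rw [hz (i.hom.app y ≫ g ≫ σ.S.map (i.inv.app y)) h, tr_comp, Category.assoc, ← Functor.map_comp]
  · simp
  · rw [← cancel_mono (i.hom.app (σ.S.obj y))]
    simp [e]

end IsComm

theorem zeta_isComm (E : D ≌ D) [E.functor.Additive] [E.functor.Linear k] (y : D) :
    σ.IsComm E.functor y (σ.zeta E y) := by
  intro g h e
  let x := σ.S.obj (E.functor.obj y)
  let Λ : Module.Dual k (y ⟶ E.inverse.obj x) :=
    (σ.transpose (E.functor.obj y) x (𝟙 x)).comp
      ((Linear.rightComp k (E.functor.obj y) (E.counit.app x)).comp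
        (E.functor.mapLinearMap k : (y ⟶ E.inverse.obj x) →ₗ[k] _))
  let w : E.inverse.obj x ⟶ σ.S.obj y := (σ.transpose y (E.inverse.obj x)).symm Λ
  have hκ : ∀ f : y ⟶ E.inverse.obj x, σ.tr y (f ≫ w) =
      σ.tr (E.functor.obj y) (E.functor.map f ≫ E.counit.app x) := by
    intro f
    rw [← κ_eq_tr]
    have h1 : σ.κ y _ f w = Λ f :=
      DFunLike.congr_fun ((σ.transpose y (E.inverse.obj x)).apply_symm_apply Λ) f
    rw [h1]
    change σ.κ _ _ (E.functor.map f ≫ E.counit.app x) (𝟙 x) = _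
    rw [κ_eq_tr]
    exact congrArg _ (Category.comp_id _)
  have hz : σ.zeta E y = E.counitInv.app x ≫ E.functor.map w := by
    change (E.symm.toAdjunction.homEquiv x (σ.S.obj y)) w = _
    rw [Adjunction.homEquiv_unit]
    rfl
  obtain ⟨f, hf⟩ := E.functor.map_surjective (g ≫ E.counitInv.app x)
  have : h = f ≫ w := by
    apply E.functor.map_injective
    rw [e, hz, E.functor.map_comp, hf, Category.assoc]
  rw [this, hκ, hf]
  simp [x]

section Shift

variable [HasShift D ℤ] [∀ n : ℤ, (shiftFunctor D n).Additive]
  [∀ n : ℤ, (shiftFunctor D n).Linear k]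

variable (σ) in
/-- The commutation map `ζ_{T^p} : S T^p y ⟶ T^p S y`. -/
def shiftZeta (p : ℤ) (y : D) : σ.S.obj (y⟦p⟧) ⟶ (σ.S.obj y)⟦p⟧ :=
  σ.zeta (shiftEquiv D p) y

theorem shiftZeta_isComm (p : ℤ) (y : D) :
    σ.IsComm (shiftFunctor D p) y (σ.shiftZeta p y) :=
  zeta_isComm (shiftEquiv D p) y

instance (p : ℤ) (y : D) : IsIso (σ.shiftZeta p y) :=
  (shiftZeta_isComm p y).isIso

variable (σ) in
/-- The isomorphisms `χ(p) ζ_{T^p} : S T^p ≅ T^p S`. -/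
def twistedCommIso (χ : AddChar ℤ kˣ) (p : ℤ) :
    shiftFunctor D p ⋙ σ.S ≅ σ.S ⋙ shiftFunctor D p :=
  NatIso.ofComponents (fun y =>
      { hom := (χ p : k) • σ.shiftZeta p y
        inv := ((χ p)⁻¹ : kˣ).val • inv (σ.shiftZeta p y)
        hom_inv_id := by
          dsimp
          rw [Linear.smul_comp, Linear.comp_smul, IsIso.hom_inv_id, smul_smul, Units.mul_inv,
            one_smul]
        inv_hom_id := by
          dsimp
          rw [Linear.smul_comp, Linear.comp_smul, IsIso.inv_hom_id, smul_smul, Units.inv_mul,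
            one_smul] })
    (fun {y y'} f => by
      have := (shiftZeta_isComm (σ := σ) p y).naturality f (shiftZeta_isComm p y')
      dsimp
      rw [Linear.smul_comp, Linear.comp_smul, this])

theorem twistedCommIso_hom_app (χ : AddChar ℤ kˣ) (p : ℤ) (y : D) :
    (σ.twistedCommIso χ p).hom.app y = (χ p : k) • σ.shiftZeta p y := rfl

variable (σ) in
/-- The maps `χ(p) ζ_{T^p}` are compatible with addition in `ℤ`, by uniqueness of the maps
`ζ_E`. -/
@[reducible]
def twistedCommShift (χ : AddChar ℤ kˣ) : σ.S.CommShift ℤ where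
  commShiftIso p := σ.twistedCommIso χ p
  commShiftIso_zero := by
    ext y
    rw [twistedCommIso_hom_app, AddChar.map_zero_eq_one, Units.val_one, one_smul]
    have h := (IsComm.id (σ := σ) y).of_iso (shiftFunctorZero D ℤ).symm
    rw [(shiftZeta_isComm 0 y).unique h]
    simp
  commShiftIso_add p q := by
    ext y
    have h := ((shiftZeta_isComm (σ := σ) p y).comp
      (shiftZeta_isComm q (y⟦p⟧))).of_iso (shiftFunctorAdd D p q).symm
    rw [Functor.CommShift.isoAdd_hom_app, twistedCommIso_hom_app, twistedCommIso_hom_app,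
      twistedCommIso_hom_app, AddChar.map_add_eq_mul,
      (shiftZeta_isComm (p + q) y).unique h, Functor.map_smul]
    simp only [Linear.smul_comp, Linear.comp_smul, smul_smul, Units.val_mul,
      Category.assoc, Iso.symm_hom, Iso.symm_inv]

theorem twistedCommShift_isEquivariant (χ : AddChar ℤ kˣ) :
    σ.IsEquivariant χ (σ.twistedCommShift χ) := fun _ _ => rfl

end Shift

end SerreStructure
/-! ### Homogeneous components in hom-graded categories -/

namespace HomGraded

variable {k : Type w} [Field k] {C : Type u} [Category.{v} C] [Preadditive C] [Linear k C]
  [HomGraded k C]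

theorem comp_mem' {x y z : C} {p q r : ℤ} {f : x ⟶ y} {g : y ⟶ z} (hf : f ∈ deg k x y p)
    (hg : g ∈ deg k y z q) (h : p + q = r) : f ≫ g ∈ deg k x z r :=
  h ▸ comp_mem hf hg

theorem mem_of_eq {x y : C} {p q : ℤ} {f : x ⟶ y} (hf : f ∈ deg k x y p) (h : p = q) :
    f ∈ deg k x y q := h ▸ hf

variable (k) in
/-- The component of degree `p` of a map in a hom-graded category. -/
def proj (x y : C) (p : ℤ) : (x ⟶ y) →ₗ[k] (x ⟶ y) :=
  (deg k x y p).subtype ∘ₗ DirectSum.component k ℤ (fun p => deg k x y p) p ∘ₗ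
    (LinearEquiv.ofBijective (DirectSum.coeLinearMap (deg k x y))
      (isInternal (k := k) x y)).symm.toLinearMap

theorem proj_mem {x y : C} (p : ℤ) (f : x ⟶ y) : proj k x y p f ∈ deg k x y p :=
  Subtype.property _

theorem symm_coe_of_mem {x y : C} {p : ℤ} {f : x ⟶ y} (hf : f ∈ deg k x y p) :
    (LinearEquiv.ofBijective (DirectSum.coeLinearMap (deg k x y))
      (isInternal (k := k) x y)).symm f = DirectSum.lof k ℤ (fun p => deg k x y p) p ⟨f, hf⟩ := by
  rw [LinearEquiv.symm_apply_eq]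
  exact (DirectSum.coeLinearMap_lof (deg k x y) p ⟨f, hf⟩).symm

theorem proj_of_mem {x y : C} {p : ℤ} {f : x ⟶ y} (hf : f ∈ deg k x y p) :
    proj k x y p f = f := by
  simp only [proj, LinearMap.comp_apply, LinearEquiv.coe_coe]
  rw [symm_coe_of_mem hf, DirectSum.component.lof_self]
  rfl

theorem proj_of_mem_ne {x y : C} {p q : ℤ} {f : x ⟶ y} (hf : f ∈ deg k x y p) (h : p ≠ q) :
    proj k x y q f = 0 := by
  simp only [proj, LinearMap.comp_apply, LinearEquiv.coe_coe]
  rw [symm_coe_of_mem hf, DirectSum.component.of, dif_neg h, map_zero]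

theorem iSup_deg_eq_top (x y : C) : ⨆ p, deg k x y p = ⊤ :=
  (isInternal (k := k) x y).submodule_iSup_eq_top

variable (k) in
@[elab_as_elim]
theorem induction {x y : C} {motive : (x ⟶ y) → Prop} (f : x ⟶ y)
    (mem : ∀ (p : ℤ) (f : x ⟶ y), f ∈ deg k x y p → motive f) (zero : motive 0)
    (add : ∀ f g, motive f → motive g → motive (f + g)) : motive f :=
  Submodule.iSup_induction (deg k x y) (motive := motive)
    (show f ∈ ⨆ p, deg k x y p by rw [iSup_deg_eq_top]; trivial) mem zero add

theorem linearMap_ext {M : Type*} [AddCommGroup M] [Module k M] {x y : C}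
    {Λ Λ' : (x ⟶ y) →ₗ[k] M} (h : ∀ (p : ℤ) (f : x ⟶ y), f ∈ deg k x y p → Λ f = Λ' f) :
    Λ = Λ' := by
  ext f
  refine HomGraded.induction k f ?_ ?_ ?_
  · intro p f hf
    exact h p f hf
  · simp
  · intro f g hf hg
    rw [map_add, map_add, hf, hg]

theorem exists_sum_proj {x y : C} (f : x ⟶ y) : ∃ s : Finset ℤ, ∑ p ∈ s, proj k x y p f = f ∧
    ∀ p ∉ s, proj k x y p f = 0 := by
  classical
  let d := (LinearEquiv.ofBijective (DirectSum.coeLinearMap (deg k x y))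
      (isInternal (k := k) x y)).symm f
  refine ⟨DFinsupp.support d, ?_, fun p hp => ?_⟩
  · have h : DirectSum.coeLinearMap (deg k x y) d = f :=
      (LinearEquiv.ofBijective (DirectSum.coeLinearMap (deg k x y))
        (isInternal (k := k) x y)).apply_symm_apply f
    rw [DirectSum.coeLinearMap_eq_dfinsuppSum] at h
    exact h
  · have : d p = 0 := by simpa using hp
    change ((d p : deg k x y p) : x ⟶ y) = 0
    rw [this]; rfl

theorem eq_zero_of_proj {x y : C} {f : x ⟶ y} (h : ∀ p, proj k x y p f = 0) : f = 0 := by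
  obtain ⟨s, hs, -⟩ := exists_sum_proj (k := k) f
  rw [← hs]
  exact Finset.sum_eq_zero fun p _ => h p

theorem proj_comp_of_mem_left {x y z : C} {p q r : ℤ} {f : x ⟶ y} (hf : f ∈ deg k x y p)
    (g : y ⟶ z) (h : p + q = r) : proj k x z r (f ≫ g) = f ≫ proj k y z q g := by
  refine HomGraded.induction k g ?_ ?_ ?_
  · intro q' g hg
    by_cases hq : q' = q
    · subst hq
      rw [proj_of_mem hg, proj_of_mem (comp_mem' hf hg h)]
    · rw [proj_of_mem_ne hg hq, proj_of_mem_ne (comp_mem hf hg) (by omega), Limits.comp_zero]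
  · simp
  · intro g g' h h'
    simp only [Preadditive.comp_add, map_add, h, h']

theorem proj_comp_of_mem_right {x y z : C} {p q r : ℤ} (f : x ⟶ y) {g : y ⟶ z}
    (hg : g ∈ deg k y z q) (h : p + q = r) : proj k x z r (f ≫ g) = proj k x y p f ≫ g := by
  refine HomGraded.induction k f ?_ ?_ ?_
  · intro p' f hf
    by_cases hp : p' = p
    · subst hp
      rw [proj_of_mem hf, proj_of_mem (comp_mem' hf hg h)]
    · rw [proj_of_mem_ne hf hp, proj_of_mem_ne (comp_mem hf hg) (by omega), Limits.zero_comp]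
  · simp
  · intro g g' h h'
    simp only [Preadditive.add_comp, map_add, h, h']

end HomGraded

/-! ### Isomorphisms of degree-preserving functors -/

namespace GradedEndo

variable {k : Type w} [Field k] {C : Type u} [Category.{v} C] [Preadditive C] [Linear k C]
  [HomGraded k C]

namespace IsIso

theorem refl (F : GradedEndo k C) : IsIso F F :=
  ⟨Iso.refl _, fun x => by
    constructor <;> simpa using HomGraded.id_mem (k := k) (F.H.obj x)⟩

theorem symm {F G : GradedEndo k C} (h : IsIso F G) : IsIso G F := by
  obtain ⟨e, he⟩ := h
  exact ⟨e.symm, fun x => (he x).symm⟩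

theorem trans {F G H : GradedEndo k C} (h : IsIso F G) (h' : IsIso G H) : IsIso F H := by
  obtain ⟨e, he⟩ := h
  obtain ⟨e', he'⟩ := h'
  exact ⟨e ≪≫ e', fun x => ⟨HomGraded.comp_mem' (he x).1 (he' x).1 (by ring),
    HomGraded.comp_mem' (he' x).2 (he x).2 (by ring)⟩⟩

theorem comp {F F' G G' : GradedEndo k C} (h : IsIso F F') (h' : IsIso G G') :
    IsIso (comp G F) (GradedEndo.comp G' F') := by
  obtain ⟨e, he⟩ := h
  obtain ⟨e', he'⟩ := h'
  refine ⟨Functor.isoWhiskerRight e G.H ≪≫ Functor.isoWhiskerLeft F'.H e', fun x => ?_⟩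
  exact ⟨HomGraded.comp_mem' (G.map_mem (he x).1) (he' (F'.H.obj x)).1
      (by simp only [GradedEndo.comp]; ring),
    HomGraded.comp_mem' (he' (F'.H.obj x)).2 (G.map_mem (he x).2)
      (by simp only [GradedEndo.comp]; ring)⟩

theorem pow {F F' : GradedEndo k C} (h : IsIso F F') (n : ℕ) : IsIso (F.pow n) (F'.pow n) := by
  induction n with
  | zero => exact refl _
  | succ n ih => exact comp ih h

end IsIso

theorem idShift_comp_isIso (M N : ℤ) :
    IsIso (comp (idShift M) (idShift N) : GradedEndo k C) (idShift (N + M)) :=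
  ⟨Iso.refl _, fun x => by
    constructor <;>
      exact HomGraded.mem_of_eq (HomGraded.id_mem (k := k) x) (by simp [comp, idShift])⟩

theorem idShift_one_pow_isIso (n : ℕ) :
    IsIso ((idShift 1 : GradedEndo k C).pow n) (idShift (n : ℤ)) := by
  induction n with
  | zero => exact IsIso.refl _
  | succ n ih =>
    rw [Nat.cast_succ]
    exact (ih.comp (IsIso.refl _)).trans (idShift_comp_isIso _ _)

end GradedEndo

/-! ### Uniqueness of hom-graded Serre functors -/

namespace GradedSerreStructure

variable {k : Type w} [Field k] {C : Type u} [Category.{v} C] [Preadditive C] [Linear k C]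
  [HomGraded k C] {χ : AddChar ℤ kˣ} (τ τ' τ'' : GradedSerreStructure C χ)

theorem κ_proj {x y : C} {p : ℤ} {f : x ⟶ y} (hf : f ∈ deg k x y p) (u : y ⟶ τ.S.H.obj x) :
    τ.κ x y f (HomGraded.proj k _ _ (τ.S.γ x - p) u) = τ.κ x y f u := by
  refine HomGraded.induction k u ?_ ?_ ?_
  · intro q u hu
    by_cases hq : q = τ.S.γ x - p
    · subst hq; rw [HomGraded.proj_of_mem hu]
    · rw [HomGraded.proj_of_mem_ne hu hq, map_zero, τ.κ_deg hf hu hq]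
  · simp
  · intro u u' h h'
    simp only [map_add, h, h']

/-- The form `κ` is nondegenerate in its second argument. -/
theorem ext_of_κ {x y : C} {u u' : y ⟶ τ.S.H.obj x}
    (h : ∀ (p : ℤ) (f : x ⟶ y), f ∈ deg k x y p → τ.κ x y f u = τ.κ x y f u') : u = u' := by
  rw [← sub_eq_zero]
  refine HomGraded.eq_zero_of_proj (k := k) fun q => ?_
  obtain ⟨p, rfl⟩ : ∃ p, q = τ.S.γ x - p := ⟨τ.S.γ x - q, by ring⟩
  have key : (⟨_, HomGraded.proj_mem (τ.S.γ x - p) (u - u')⟩ :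
      deg k y (τ.S.H.obj x) (τ.S.γ x - p)) = 0 := by
    rw [← Module.forall_dual_apply_eq_zero_iff k]
    intro Λ
    obtain ⟨f, rfl⟩ := (τ.κ_bijective x y p).2 Λ
    change τ.κ x y f (HomGraded.proj k _ _ (τ.S.γ x - p) (u - u')) = 0
    rw [κ_proj _ f.2, map_sub, h p f f.2, sub_self]
  exact congrArg Subtype.val key

theorem κ_injective (x y : C) {f : x ⟶ y} (h : τ.κ x y f = 0) : f = 0 := by
  refine HomGraded.eq_zero_of_proj (k := k) fun p => ?_
  have key : (⟨_, HomGraded.proj_mem p f⟩ : deg k x y p) = 0 := by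
    apply (τ.κ_bijective x y p).1
    ext u
    change τ.κ x y (HomGraded.proj k x y p f) u = τ.κ x y 0 u
    rw [map_zero, ← h]
    obtain ⟨u, hu⟩ := u
    dsimp only
    clear h
    refine HomGraded.induction k f ?_ ?_ ?_
    · intro q f hf
      by_cases hq : q = p
      · subst hq; rw [HomGraded.proj_of_mem hf]
      · rw [HomGraded.proj_of_mem_ne hf hq, τ.κ_deg hf hu (by omega)]
        simp
    · simp
    · intro f f' h h'
      simp only [map_add, LinearMap.add_apply, h, h']
  exact congrArg Subtype.val key

/-- Every functional on the maps of degree `p` is given by `κ(-)(u)` for a homogeneous `u`. -/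
theorem exists_κ_eq {x y : C} {p : ℤ} (Λ : Module.Dual k (deg k x y p)) :
    ∃ u ∈ deg k y (τ.S.H.obj x) (τ.S.γ x - p), ∀ f : deg k x y p, τ.κ x y f u = Λ f := by
  have := τ.locallyFinite y (τ.S.H.obj x) (τ.S.γ x - p)
  let e := LinearEquiv.ofBijective
    ((deg k y (τ.S.H.obj x) (τ.S.γ x - p)).subtype.dualMap ∘ₗ τ.κ x y ∘ₗ (deg k x y p).subtype)
    (τ.κ_bijective x y p)
  obtain ⟨u, hu⟩ := (Module.evalEquiv k (deg k y (τ.S.H.obj x) (τ.S.γ x - p))).surjective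
    (Λ ∘ₗ e.symm.toLinearMap)
  refine ⟨u, u.2, fun f => ?_⟩
  have h : e f u = Λ (e.symm (e f)) := DFunLike.congr_fun hu (e f)
  rw [e.symm_apply_apply] at h
  exact h

/-- The comparison maps between two hom-graded Serre functors: the map `S x ⟶ S' x` represents the
functional `g ↦ κ(g)(id)` on `C(x, S x)`. -/
theorem exists_comparison : ∃ η : ∀ x, τ.S.H.obj x ⟶ τ'.S.H.obj x, ∀ x,
    η x ∈ deg k _ _ (τ'.S.γ x - τ.S.γ x) ∧
      ∀ (y : C) (f : x ⟶ y) (u : y ⟶ τ.S.H.obj x), τ'.κ x y f (u ≫ η x) = τ.κ x y f u := by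
  have H : ∀ x, ∃ η : τ.S.H.obj x ⟶ τ'.S.H.obj x, η ∈ deg k _ _ (τ'.S.γ x - τ.S.γ x) ∧
      ∀ (y : C) (f : x ⟶ y) (u : y ⟶ τ.S.H.obj x), τ'.κ x y f (u ≫ η) = τ.κ x y f u := by
    intro x
    obtain ⟨η, hη, hκ⟩ := τ'.exists_κ_eq (x := x) (y := τ.S.H.obj x) (p := τ.S.γ x)
      (((τ.κ x (τ.S.H.obj x)).flip (𝟙 _)).domRestrict _)
    refine ⟨η, hη, fun y f u => ?_⟩
    have key : (τ'.κ x (τ.S.H.obj x)).flip η = (τ.κ x (τ.S.H.obj x)).flip (𝟙 _) := by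
      apply HomGraded.linearMap_ext
      intro p g hg
      by_cases hp : p = τ.S.γ x
      · subst hp; exact hκ ⟨g, hg⟩
      · change τ'.κ _ _ g η = τ.κ _ _ g (𝟙 _)
        rw [τ'.κ_deg hg hη (by omega), τ.κ_deg hg (HomGraded.id_mem _) (by omega)]
    refine HomGraded.induction k u ?_ ?_ ?_
    · intro q u hu
      have h1 := τ'.κ_left f u η hu
      have h2 := τ.κ_left f u (𝟙 _) hu
      have h3 : τ'.κ _ _ (f ≫ u) η = τ.κ _ _ (f ≫ u) (𝟙 _) := DFunLike.congr_fun key (f ≫ u)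
      rw [Category.comp_id] at h2
      rw [h1, h2] at h3
      exact mul_left_cancel₀ (χ q).ne_zero h3
    · simp
    · intro u u' h h'
      simp only [map_add, Preadditive.add_comp, h, h']
  choose η hη using H
  exact ⟨η, hη⟩

/-- Hom-graded Serre functors are unique up to isomorphism: the comparison maps are mutually inverse
and natural since `κ` is nondegenerate. -/
theorem isIso : τ.S.IsIso τ'.S := by
  obtain ⟨η, hη⟩ := exists_comparison τ τ'
  obtain ⟨θ, hθ⟩ := exists_comparison τ' τ
  have h1 : ∀ x, η x ≫ θ x = 𝟙 _ := fun x => τ.ext_of_κ fun p f _ => by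
    rw [(hθ x).2, ← (hη x).2 _ f (𝟙 _), Category.id_comp]
  have h2 : ∀ x, θ x ≫ η x = 𝟙 _ := fun x => τ'.ext_of_κ fun p f _ => by
    rw [(hη x).2, ← (hθ x).2 _ f (𝟙 _), Category.id_comp]
  refine ⟨NatIso.ofComponents (fun x => ⟨η x, θ x, h1 x, h2 x⟩) ?_,
    fun x => ⟨(hη x).1, (hθ x).1⟩⟩
  intro x y g
  refine τ'.ext_of_κ fun p f _ => ?_
  have h3 := (hη x).2 _ (g ≫ f) (𝟙 _)
  rw [Category.id_comp, τ.κ_right, Category.id_comp] at h3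
  rw [(hη y).2, ← h3, τ'.κ_right]

end GradedSerreStructure

/-! ### Homogeneous maps in the orbit category -/

namespace Orbit

section

variable {D : Type u} [Category.{v} D] [Preadditive D] [HasShift D ℤ]
  [∀ n : ℤ, (shiftFunctor D n).Additive]

/-- A map `x ⟶ T^p y` viewed as a homogeneous map `x ⟶ y` in the orbit category. -/
def homog {x y : Orbit D} {p : ℤ} (f : ShiftedHom x.obj y.obj p) : x ⟶ y :=
  DirectSum.of (fun p => ShiftedHom x.obj y.obj p) p f

theorem homog_comp {x y z : Orbit D} {p q r : ℤ} (f : ShiftedHom x.obj y.obj p)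
    (g : ShiftedHom y.obj z.obj q) (h : q + p = r) :
    homog f ≫ homog g = homog (f.comp g h) :=
  (compHom_of x.obj y.obj z.obj p q f g).trans (comp_of_eq f g h)

theorem homog_mk₀_comp {X Y Z : D} (f : X ⟶ Y) (g : Y ⟶ Z) :
    homog (x := ⟨X⟩) (y := ⟨Y⟩) (ShiftedHom.mk₀ (0 : ℤ) rfl f) ≫
      homog (y := ⟨Z⟩) (ShiftedHom.mk₀ (0 : ℤ) rfl g) =
        homog (ShiftedHom.mk₀ (0 : ℤ) rfl (f ≫ g)) := by
  rw [homog_comp _ _ (add_zero 0), ShiftedHom.mk₀_comp_mk₀]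

theorem id_eq_homog (x : Orbit D) : 𝟙 x = homog (ShiftedHom.mk₀ (0 : ℤ) rfl (𝟙 x.obj)) := rfl

theorem homog_add {x y : Orbit D} {p : ℤ} (f g : ShiftedHom x.obj y.obj p) :
    homog (f + g) = homog f + homog g :=
  (DirectSum.of (fun p => ShiftedHom x.obj y.obj p) p).map_add f g

theorem homog_injective {x y : Orbit D} {p : ℤ} :
    Function.Injective (homog : ShiftedHom x.obj y.obj p → (x ⟶ y)) :=
  DirectSum.of_injective p

@[elab_as_elim]
theorem hom_induction {x y : Orbit D} {motive : (x ⟶ y) → Prop} (f : x ⟶ y)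
    (homog : ∀ (p : ℤ) (f : ShiftedHom x.obj y.obj p), motive (homog f)) (zero : motive 0)
    (add : ∀ f g, motive f → motive g → motive (f + g)) : motive f :=
  DirectSum.induction_on f zero homog add

/-- A natural isomorphism of functors on the orbit category; naturality has only to be checked
on homogeneous maps. -/
def natIsoMk {H H' : Orbit D ⥤ Orbit D} [H.Additive] [H'.Additive]
    (e : ∀ x, H.obj x ≅ H'.obj x)
    (he : ∀ {x y : Orbit D} {p : ℤ} (f : ShiftedHom x.obj y.obj p),
      H.map (homog f) ≫ (e y).hom = (e x).hom ≫ H'.map (homog f)) : H ≅ H' :=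
  NatIso.ofComponents e fun {x y} f => by
    refine hom_induction f (fun p f => he f) ?_ ?_
    · simp
    · intro f g hf hg
      rw [H.map_add, H'.map_add, Preadditive.add_comp, Preadditive.comp_add, hf, hg]

end

section

variable {k : Type w} [Field k] {D : Type u} [Category.{v} D] [Preadditive D] [Linear k D]
  [HasShift D ℤ] [∀ n : ℤ, (shiftFunctor D n).Additive] [∀ n : ℤ, (shiftFunctor D n).Linear k]

theorem homog_smul {x y : Orbit D} {p : ℤ} (c : k) (f : ShiftedHom x.obj y.obj p) :
    homog (c • f) = c • homog f :=
  (smul_of x.obj y.obj c p f).symm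

theorem homog_mem {x y : Orbit D} {p : ℤ} (f : ShiftedHom x.obj y.obj p) :
    homog f ∈ deg k x y p := ⟨f, rfl⟩

theorem homog_mem' {x y : Orbit D} {p q : ℤ} (f : ShiftedHom x.obj y.obj p) (h : p = q) :
    homog f ∈ deg k x y q := h ▸ homog_mem f

theorem exists_homog_eq {x y : Orbit D} {p : ℤ} {f : x ⟶ y} (hf : f ∈ deg k x y p) :
    ∃ f' : ShiftedHom x.obj y.obj p, homog f' = f := hf

end

end Orbit

/-! ### From equivariant functors to functors on the orbit category -/

namespace EquivariantEndo

variable {k : Type w} [Field k] {D : Type u} [Category.{v} D] [Preadditive D] [Linear k D]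
  [HasShift D ℤ] [∀ n : ℤ, (shiftFunctor D n).Additive]

/-- The action of an equivariant functor on the maps of the orbit category. -/
def orbitMap (F : EquivariantEndo k D) (x y : Orbit D) :
    (x ⟶ y) →+ ((⟨F.Φ.obj x.obj⟩ : Orbit D) ⟶ ⟨F.Φ.obj y.obj⟩) :=
  DirectSum.toAddMonoid fun p =>
    AddMonoidHom.mk' (fun f => Orbit.homog (ShiftedHom.map f F.Φ))
      (fun f g => by rw [ShiftedHom.map_add]; exact Orbit.homog_add _ _)

theorem orbitMap_homog (F : EquivariantEndo k D) {x y : Orbit D} {p : ℤ}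
    (f : ShiftedHom x.obj y.obj p) :
    F.orbitMap x y (Orbit.homog f) = Orbit.homog (ShiftedHom.map f F.Φ) :=
  DirectSum.toAddMonoid_of _ p f

/-- The functor on the orbit category induced by an equivariant functor. -/
def orbitFunctor (F : EquivariantEndo k D) : Orbit D ⥤ Orbit D where
  obj x := ⟨F.Φ.obj x.obj⟩
  map {x y} f := F.orbitMap x y f
  map_id x := by
    rw [Orbit.id_eq_homog, orbitMap_homog, ShiftedHom.map_mk₀, F.Φ.map_id]
    rfl
  map_comp {x y z} f g := by
    refine Orbit.hom_induction f ?_ ?_ ?_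
    · intro p f
      refine Orbit.hom_induction g ?_ ?_ ?_
      · intro q g
        rw [Orbit.homog_comp f g rfl, orbitMap_homog, orbitMap_homog, orbitMap_homog,
          ShiftedHom.map_comp, ← Orbit.homog_comp]
      · simp
      · intro g g' hg hg'
        rw [Preadditive.comp_add, map_add, map_add, Preadditive.comp_add, hg, hg']
    · simp
    · intro f f' hf hf'
      rw [Preadditive.add_comp, map_add, map_add, Preadditive.add_comp, hf, hf']

theorem orbitFunctor_map_homog (F : EquivariantEndo k D) {x y : Orbit D} {p : ℤ}
    (f : ShiftedHom x.obj y.obj p) :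
    F.orbitFunctor.map (Orbit.homog f) = Orbit.homog (ShiftedHom.map f F.Φ) :=
  F.orbitMap_homog f

instance (F : EquivariantEndo k D) : F.orbitFunctor.Additive where
  map_add {x y f g} := (F.orbitMap x y).map_add f g

variable [∀ n : ℤ, (shiftFunctor D n).Linear k]

instance (F : EquivariantEndo k D) : F.orbitFunctor.Linear k where
  map_smul {x y} f c := by
    refine Orbit.hom_induction f ?_ ?_ ?_
    · intro p f
      rw [← Orbit.homog_smul, orbitFunctor_map_homog, orbitFunctor_map_homog,
        ShiftedHom.map_smul, Orbit.homog_smul]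
      rfl
    · simp
    · intro f f' hf hf'
      rw [smul_add, Functor.map_add, Functor.map_add, hf, hf', smul_add]

/-- The degree-preserving endofunctor (with degree adjuster `0`) of the orbit category induced by
an equivariant functor. -/
def toGraded (F : EquivariantEndo k D) : GradedEndo k (Orbit D) where
  H := F.orbitFunctor
  γ _ := 0
  map_mem {x y p f} hf := by
    obtain ⟨f, rfl⟩ := Orbit.exists_homog_eq hf
    rw [orbitFunctor_map_homog]
    exact Orbit.homog_mem' _ (by simp)

theorem toGraded_one : (one : EquivariantEndo k D).toGraded.IsIso (GradedEndo.idShift 0) := by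
  refine ⟨Orbit.natIsoMk (H := orbitFunctor _) (H' := 𝟭 _) (fun x => Iso.refl x) ?_, fun x => ?_⟩
  · intro x y p f
    refine (Category.comp_id _).trans (Eq.trans ?_ (Category.id_comp _).symm)
    exact (orbitFunctor_map_homog _ f).trans (congrArg Orbit.homog (ShiftedHom.id_map f))
  · constructor <;> exact HomGraded.id_mem (k := k) x

theorem toGraded_comp (G F : EquivariantEndo k D) :
    (comp G F).toGraded.IsIso (GradedEndo.comp G.toGraded F.toGraded) := by
  refine ⟨Orbit.natIsoMk (H := orbitFunctor _) (H' := F.orbitFunctor ⋙ G.orbitFunctor)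
    (fun x => Iso.refl ((comp G F).orbitFunctor.obj x)) ?_, fun x => ?_⟩
  · intro x y p f
    refine (Category.comp_id _).trans (Eq.trans ?_ (Category.id_comp _).symm)
    exact (orbitFunctor_map_homog _ f).trans
      (((congrArg Orbit.homog (ShiftedHom.comp_map f F.Φ G.Φ)).trans
        (orbitFunctor_map_homog G _).symm).trans
          (congrArg G.orbitFunctor.map (orbitFunctor_map_homog F f).symm))
  · constructor <;> exact HomGraded.id_mem (k := k) ((comp G F).orbitFunctor.obj x)

theorem toGraded_isIso {F G : EquivariantEndo k D} (h : F.IsIso G) :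
    F.toGraded.IsIso G.toGraded := by
  obtain ⟨e, he⟩ := h
  refine ⟨Orbit.natIsoMk (H := F.orbitFunctor) (H' := G.orbitFunctor)
    (fun x => ⟨Orbit.homog (ShiftedHom.mk₀ (0 : ℤ) rfl (e.hom.app x.obj)),
      Orbit.homog (ShiftedHom.mk₀ (0 : ℤ) rfl (e.inv.app x.obj)), ?_, ?_⟩) ?_, fun x => ?_⟩
  · exact (Orbit.homog_mk₀_comp _ _).trans
      (congrArg (fun g => Orbit.homog (ShiftedHom.mk₀ (0 : ℤ) rfl g)) (e.hom_inv_id_app x.obj))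
  · exact (Orbit.homog_mk₀_comp _ _).trans
      (congrArg (fun g => Orbit.homog (ShiftedHom.mk₀ (0 : ℤ) rfl g)) (e.inv_hom_id_app x.obj))
  · intro x y p f
    rw [orbitFunctor_map_homog, orbitFunctor_map_homog]
    exact (Orbit.homog_comp _ _ (zero_add p)).trans ((congrArg Orbit.homog
      (ShiftedHom.map_naturality f e.hom)).trans (Orbit.homog_comp _ _ (add_zero p)).symm)
  · constructor <;> exact Orbit.homog_mem' _ (by simp [toGraded])

theorem toGraded_pow (F : EquivariantEndo k D) (n : ℕ) :
    (F.pow n).toGraded.IsIso (F.toGraded.pow n) := by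
  induction n with
  | zero => exact toGraded_one
  | succ n ih => exact (toGraded_comp F (F.pow n)).trans (ih.comp (GradedEndo.IsIso.refl _))

/-- An isomorphism between induced functors on the orbit category has components of degree `0`, so
it consists of maps in `D`; its naturality at `𝟙 : T^p y ⟶ T^p y`, a map `T^p y ⟶ y` of degree
`p`, is the compatibility with the equivariant structures. -/
theorem isIso_of_toGraded {F G : EquivariantEndo k D} (h : F.toGraded.IsIso G.toGraded) :
    F.IsIso G := by
  obtain ⟨e, he⟩ := h
  have H : ∀ x : D, ∃ (a : F.Φ.obj x ⟶ G.Φ.obj x) (b : G.Φ.obj x ⟶ F.Φ.obj x),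
      e.hom.app ⟨x⟩ = Orbit.homog (x := ⟨F.Φ.obj x⟩) (y := ⟨G.Φ.obj x⟩)
        (ShiftedHom.mk₀ (0 : ℤ) rfl a) ∧
      e.inv.app ⟨x⟩ = Orbit.homog (x := ⟨G.Φ.obj x⟩) (y := ⟨F.Φ.obj x⟩)
        (ShiftedHom.mk₀ (0 : ℤ) rfl b) := by
    intro x
    obtain ⟨a, ha⟩ := Orbit.exists_homog_eq
      (HomGraded.mem_of_eq (he ⟨x⟩).1 (q := 0) (by simp [toGraded]))
    obtain ⟨b, hb⟩ := Orbit.exists_homog_eq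
      (HomGraded.mem_of_eq (he ⟨x⟩).2 (q := 0) (by simp [toGraded]))
    obtain ⟨a, rfl⟩ := (ShiftedHom.homEquiv (0 : ℤ) rfl).surjective a
    obtain ⟨b, rfl⟩ := (ShiftedHom.homEquiv (0 : ℤ) rfl).surjective b
    exact ⟨a, b, ha.symm, hb.symm⟩
  choose a b ha hb using H
  have inj : ∀ {x y : D} {f g : x ⟶ y}, Orbit.homog (x := ⟨x⟩) (y := ⟨y⟩)
      (ShiftedHom.mk₀ (0 : ℤ) rfl f) = Orbit.homog (x := ⟨x⟩) (y := ⟨y⟩)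
      (ShiftedHom.mk₀ (0 : ℤ) rfl g) → f = g := fun h =>
    (ShiftedHom.homEquiv (0 : ℤ) rfl).injective (Orbit.homog_injective h)
  have nat : ∀ {x y : D} {p : ℤ} (f : ShiftedHom x y p),
      ShiftedHom.map f F.Φ ≫ (a y)⟦p⟧' = a x ≫ ShiftedHom.map f G.Φ := by
    intro x y p f
    have h := e.hom.naturality (Orbit.homog (x := ⟨x⟩) (y := ⟨y⟩) f)
    rw [ha, ha] at h
    simp only [toGraded, orbitFunctor_map_homog] at h
    erw [Orbit.homog_comp _ _ (zero_add p), Orbit.homog_comp _ _ (add_zero p)] at h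
    have h' := Orbit.homog_injective h
    exact (ShiftedHom.comp_mk₀ _ _ rfl _).symm.trans (h'.trans (ShiftedHom.mk₀_comp _ rfl _ _))
  refine ⟨NatIso.ofComponents (fun x => ⟨a x, b x, ?_, ?_⟩) ?_, ?_⟩
  · apply inj
    have h := e.hom_inv_id_app ⟨x⟩
    rw [ha, hb] at h
    exact (Orbit.homog_mk₀_comp _ _).symm.trans h
  · apply inj
    have h := e.inv_hom_id_app ⟨x⟩
    rw [ha, hb] at h
    exact (Orbit.homog_mk₀_comp _ _).symm.trans h
  · intro x y f
    have h := nat (ShiftedHom.mk₀ (0 : ℤ) rfl f)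
    rw [ShiftedHom.map_mk₀, ShiftedHom.map_mk₀, ← ShiftedHom.comp_mk₀ _ 0 rfl,
      ← ShiftedHom.mk₀_comp 0 rfl, ShiftedHom.mk₀_comp_mk₀, ShiftedHom.mk₀_comp_mk₀] at h
    exact (ShiftedHom.homEquiv (0 : ℤ) rfl).injective h
  · refine ⟨fun p => ?_⟩
    ext y
    have h := nat (x := y⟦p⟧) (y := y) (𝟙 (y⟦p⟧))
    simpa [ShiftedHom.map] using h

/-- The identity of `T x` is an isomorphism `T x ≅ x` of degree `1` in the orbit category. -/
theorem toGraded_generator :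
    (generator : EquivariantEndo k D).toGraded.IsIso (GradedEndo.idShift 1) := by
  refine ⟨Orbit.natIsoMk (H := orbitFunctor _) (H' := 𝟭 _)
    (fun x => ⟨Orbit.homog (x := ⟨x.obj⟦(1 : ℤ)⟧⟩) (y := x) (p := 1) (𝟙 (x.obj⟦(1 : ℤ)⟧)),
      Orbit.homog (x := x) (y := ⟨x.obj⟦(1 : ℤ)⟧⟩) (p := -1)
        ((shiftFunctorCompIsoId D (1 : ℤ) (-1) (by simp)).inv.app x.obj), ?_, ?_⟩) ?_,
      fun x => ?_⟩
  · refine (Orbit.homog_comp _ _ (neg_add_cancel 1)).trans (congrArg Orbit.homog ?_)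
    change 𝟙 (x.obj⟦(1 : ℤ)⟧) ≫
      ((shiftFunctorCompIsoId D (1 : ℤ) (-1) (by simp)).inv.app x.obj)⟦(1 : ℤ)⟧' ≫
      (shiftFunctorAdd' D (-1 : ℤ) 1 0 (by simp)).inv.app (x.obj⟦(1 : ℤ)⟧) =
        ShiftedHom.mk₀ 0 rfl (𝟙 (x.obj⟦(1 : ℤ)⟧))
    rw [shift_shiftFunctorCompIsoId_inv_app]
    simp [ShiftedHom.mk₀, shiftFunctorCompIsoId, shiftFunctorZero']
  · refine (Orbit.homog_comp _ _ (add_neg_cancel 1)).trans (congrArg Orbit.homog ?_)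
    change (shiftFunctorCompIsoId D (1 : ℤ) (-1) (by simp)).inv.app x.obj ≫
      (𝟙 (x.obj⟦(1 : ℤ)⟧))⟦(-1 : ℤ)⟧' ≫
      (shiftFunctorAdd' D (1 : ℤ) (-1) 0 (by simp)).inv.app x.obj =
        ShiftedHom.mk₀ 0 rfl (𝟙 x.obj)
    simp [ShiftedHom.mk₀, shiftFunctorCompIsoId, shiftFunctorZero']
  · intro x y p f
    rw [orbitFunctor_map_homog]
    refine (Orbit.homog_comp _ _ rfl).trans (Eq.trans (congrArg Orbit.homog ?_)
      (Orbit.homog_comp _ _ (add_comm p 1)).symm)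
    change (f⟦(1 : ℤ)⟧' ≫ (shiftFunctorComm D p 1).hom.app y.obj) ≫
      (𝟙 (y.obj⟦(1 : ℤ)⟧))⟦p⟧' ≫ (shiftFunctorAdd' D 1 p (1 + p) rfl).inv.app y.obj =
      𝟙 (x.obj⟦(1 : ℤ)⟧) ≫ f⟦(1 : ℤ)⟧' ≫
        (shiftFunctorAdd' D p 1 (1 + p) (add_comm p 1)).inv.app y.obj
    rw [shiftFunctorComm_eq D p 1 _ (add_comm p 1)]
    simp
  · exact ⟨Orbit.homog_mem' _ (by simp [toGraded, GradedEndo.idShift]),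
      Orbit.homog_mem' _ (by simp [toGraded, GradedEndo.idShift])⟩

theorem toGraded_generator_pow (n : ℕ) :
    ((generator : EquivariantEndo k D).pow n).toGraded.IsIso (GradedEndo.idShift (n : ℤ)) :=
  (toGraded_pow _ n).trans ((toGraded_generator.pow n).trans (GradedEndo.idShift_one_pow_isIso n))

end EquivariantEndo

/-! ### Hom-graded Serre functors on orbit categories -/

namespace Orbit

variable {k : Type w} [Field k] {D : Type u} [Category.{v} D] [Preadditive D] [Linear k D]
  [HasShift D ℤ] [∀ n : ℤ, (shiftFunctor D n).Additive] [∀ n : ℤ, (shiftFunctor D n).Linear k]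

/-- The map multiplying the component of degree `p` by `χ(p)`. -/
def twist (χ : AddChar ℤ kˣ) (x y : Orbit D) : (x ⟶ y) →ₗ[k] (x ⟶ y) :=
  DirectSum.toModule k ℤ (DirectSum ℤ fun p => ShiftedHom x.obj y.obj p) fun p =>
    (χ p : k) • DirectSum.lof k ℤ (fun p => ShiftedHom x.obj y.obj p) p

theorem twist_homog (χ : AddChar ℤ kˣ) {x y : Orbit D} {p : ℤ} (f : ShiftedHom x.obj y.obj p) :
    twist χ x y (homog f) = (χ p : k) • homog f :=
  DirectSum.toModule_lof k p f

theorem twist_comp_homog (χ : AddChar ℤ kˣ) {x y z : Orbit D} {p : ℤ} (g : x ⟶ y)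
    (h : ShiftedHom y.obj z.obj p) :
    twist χ x z (g ≫ homog h) = (χ p : k) • (twist χ x y g ≫ homog h) := by
  refine hom_induction g ?_ ?_ ?_
  · intro q g
    rw [homog_comp g h rfl, twist_homog, twist_homog, Linear.smul_comp, homog_comp g h rfl,
      AddChar.map_add_eq_mul, Units.val_mul, mul_smul]
  · simp
  · intro g g' hg hg'
    rw [Preadditive.add_comp, map_add, map_add, Preadditive.add_comp, smul_add, hg, hg']

theorem twist_homog_comp (χ : AddChar ℤ kˣ) {x y z : Orbit D} {p : ℤ}
    (f : ShiftedHom x.obj y.obj p) (g : y ⟶ z) :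
    twist χ x z (homog f ≫ g) = (χ p : k) • (homog f ≫ twist χ y z g) := by
  refine hom_induction g ?_ ?_ ?_
  · intro q g
    rw [homog_comp f g rfl, twist_homog, twist_homog, Linear.comp_smul, homog_comp f g rfl,
      AddChar.map_add_eq_mul, Units.val_mul, mul_comm, mul_smul]
  · simp
  · intro g g' hg hg'
    rw [Preadditive.comp_add, map_add, map_add, Preadditive.comp_add, smul_add, hg, hg']

end Orbit

namespace SerreStructure

variable {k : Type w} [Field k] {D : Type u} [Category.{v} D] [Preadditive D] [Linear k D]
  [HasShift D ℤ] [∀ n : ℤ, (shiftFunctor D n).Additive] [∀ n : ℤ, (shiftFunctor D n).Linear k]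
  (τ : SerreStructure k D)

/-- The trace on the orbit category: the trace of the component of degree `0`. -/
def orbitTr (x : Orbit D) : (x ⟶ (⟨τ.S.obj x.obj⟩ : Orbit D)) →ₗ[k] k :=
  τ.tr x.obj ∘ₗ
    Linear.rightComp k x.obj ((shiftFunctorZero D ℤ).hom.app (τ.S.obj x.obj)) ∘ₗ
      DirectSum.component k ℤ (fun p => ShiftedHom x.obj (τ.S.obj x.obj) p) 0

theorem orbitTr_homog_zero {x : Orbit D} (u : ShiftedHom x.obj (τ.S.obj x.obj) (0 : ℤ)) :
    τ.orbitTr x (Orbit.homog (y := ⟨τ.S.obj x.obj⟩) u) =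
      τ.tr x.obj (u ≫ (shiftFunctorZero D ℤ).hom.app (τ.S.obj x.obj)) := by
  simp only [orbitTr, LinearMap.comp_apply]
  erw [DirectSum.component.lof_self]
  rfl

theorem orbitTr_homog_of_ne {x : Orbit D} {p : ℤ} (hp : p ≠ 0)
    (u : ShiftedHom x.obj (τ.S.obj x.obj) p) :
    τ.orbitTr x (Orbit.homog (y := ⟨τ.S.obj x.obj⟩) u) = 0 := by
  have h : DirectSum.component k ℤ (fun p => ShiftedHom x.obj (τ.S.obj x.obj) p) 0
      (Orbit.homog (y := ⟨τ.S.obj x.obj⟩) u) = 0 :=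
    DirectSum.of_eq_of_ne p 0 u hp.symm
  simp only [orbitTr, LinearMap.comp_apply]
  erw [h]
  rw [map_zero, map_zero]

/-- The bijection `D(y, T^q z) ≃ D(T^p y, z)` for `q + p = 0`. -/
def shiftAdj (y z : D) {p q : ℤ} (h : q + p = 0) : ShiftedHom y z q ≃ₗ[k] (y⟦p⟧ ⟶ z) where
  toFun u := u⟦p⟧' ≫ (shiftFunctorCompIsoId D q p h).hom.app z
  invFun g := (shiftFunctorCompIsoId D p q (by omega)).inv.app y ≫ g⟦q⟧'
  map_add' u u' := by rw [Functor.map_add, Preadditive.add_comp]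
  map_smul' c u := by rw [Functor.map_smul, Linear.smul_comp, RingHom.id_apply]
  left_inv u := by
    dsimp only
    rw [Functor.map_comp, shift_shiftFunctorCompIsoId_hom_app]
    have h1 := (shiftFunctorCompIsoId D p q (by omega)).inv.naturality u
    dsimp at h1
    rw [← reassoc_of% h1]
    simp
  right_inv g := by
    dsimp only
    rw [Functor.map_comp, shift_shiftFunctorCompIsoId_inv_app]
    have h1 := (shiftFunctorCompIsoId D q p h).hom.naturality g
    dsimp at h1
    rw [Category.assoc, h1]
    simp

theorem orbitTr_homog_comp_homog {x y : Orbit D} {p q : ℤ} (h : q + p = 0)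
    (f : ShiftedHom x.obj y.obj p) (u : ShiftedHom y.obj (τ.S.obj x.obj) q) :
    τ.orbitTr x (Orbit.homog f ≫ Orbit.homog (y := ⟨τ.S.obj x.obj⟩) u) =
      τ.κ x.obj (y.obj⟦p⟧) f (shiftAdj (k := k) y.obj (τ.S.obj x.obj) h u) := by
  rw [Orbit.homog_comp f u h, orbitTr_homog_zero, κ_eq_tr]
  simp [shiftAdj, ShiftedHom.comp, shiftFunctorCompIsoId]

theorem orbitTr_homog_comp_homog_of_ne {x y : Orbit D} {p q : ℤ} (h : q + p ≠ 0)
    (f : ShiftedHom x.obj y.obj p) (u : ShiftedHom y.obj (τ.S.obj x.obj) q) :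
    τ.orbitTr x (Orbit.homog f ≫ Orbit.homog (y := ⟨τ.S.obj x.obj⟩) u) = 0 := by
  rw [Orbit.homog_comp f u rfl, orbitTr_homog_of_ne _ h]

variable {τ} {χ : AddChar ℤ kˣ}

/-- The trace on the orbit category is cyclic. -/
theorem orbitTr_comp_zeta {a x : Orbit D} {p : ℤ}
    (f : ShiftedHom a.obj x.obj p) (w : x ⟶ (⟨τ.S.obj a.obj⟩ : Orbit D)) :
    τ.orbitTr x (w ≫ Orbit.homog (x := ⟨τ.S.obj a.obj⟩) (y := ⟨τ.S.obj x.obj⟩)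
      (τ.S.map f ≫ τ.shiftZeta p x.obj)) = τ.orbitTr a (Orbit.homog f ≫ w) := by
  refine Orbit.hom_induction w ?_ ?_ ?_
  · intro q w
    by_cases h : q + p = 0
    · rw [orbitTr_homog_comp_homog τ h,
        orbitTr_homog_comp_homog τ (y := ⟨τ.S.obj a.obj⟩) (show p + q = 0 by omega),
        κ_eq_tr, κ_eq_tr, τ.tr_comp f]
      refine shiftZeta_isComm (σ := τ) p x.obj _ _ ?_
      rw [Functor.map_comp]
      simp only [shiftAdj, LinearEquiv.coe_mk, LinearMap.coe_mk, AddHom.coe_mk]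
      rw [Functor.map_comp, shift_shiftFunctorCompIsoId_hom_app]
      have h1 := (shiftFunctorCompIsoId D q p h).hom.naturality
        (τ.S.map f ≫ τ.shiftZeta p x.obj)
      rw [Functor.id_map, Functor.comp_map] at h1
      rw [h1]
      simp
    · rw [orbitTr_homog_comp_homog_of_ne τ h,
        orbitTr_homog_comp_homog_of_ne τ (y := ⟨τ.S.obj a.obj⟩) (show p + q ≠ 0 by omega)]
  · simp
  · intro w w' hw hw'
    rw [Preadditive.add_comp, map_add, hw, hw', Preadditive.comp_add, map_add]

variable (τ) in
/-- The action of `(S, s)` on the maps of the orbit category. -/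
def orbitMap (s : τ.S.CommShift ℤ) (a x : Orbit D) :
    (a ⟶ x) →+ ((⟨τ.S.obj a.obj⟩ : Orbit D) ⟶ ⟨τ.S.obj x.obj⟩) :=
  (τ.equivariant s).orbitMap a x

theorem orbitMap_homog {s : τ.S.CommShift ℤ} (hs : τ.IsEquivariant χ s)
    {a x : Orbit D} {p : ℤ} (f : ShiftedHom a.obj x.obj p) :
    τ.orbitMap s a x (Orbit.homog f) = (χ p : k) •
      Orbit.homog (x := ⟨τ.S.obj a.obj⟩) (y := ⟨τ.S.obj x.obj⟩)
        (τ.S.map f ≫ τ.shiftZeta p x.obj) := by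
  rw [← Orbit.homog_smul, ← Linear.comp_smul]
  exact ((τ.equivariant s).orbitMap_homog f).trans
    (congrArg (fun z => Orbit.homog (x := ⟨τ.S.obj a.obj⟩) (y := ⟨τ.S.obj x.obj⟩)
      (τ.S.map f ≫ z)) (hs p x.obj))

variable (τ) in
/-- The form `κ(f)(u) = ∑ p, χ(p) tr(f_p ≫ u)` on the orbit category. -/
def orbitκ (χ : AddChar ℤ kˣ) (x y : Orbit D) :
    (x ⟶ y) →ₗ[k] Module.Dual k (y ⟶ (⟨τ.S.obj x.obj⟩ : Orbit D)) :=
  LinearMap.mk₂ k (fun f u => τ.orbitTr x (Orbit.twist χ x y f ≫ u))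
    (fun f f' u => by rw [map_add, Preadditive.add_comp, map_add])
    (fun c f u => by rw [map_smul, Linear.smul_comp, map_smul])
    (fun f u u' => by rw [Preadditive.comp_add, map_add])
    (fun c f u => by rw [Linear.comp_smul, map_smul])

theorem orbitκ_apply {x y : Orbit D} (f : x ⟶ y) (u : y ⟶ (⟨τ.S.obj x.obj⟩ : Orbit D)) :
    τ.orbitκ χ x y f u = τ.orbitTr x (Orbit.twist χ x y f ≫ u) := rfl

theorem orbitκ_homog_homog {x y : Orbit D} {p q : ℤ} (h : q + p = 0)
    (f : ShiftedHom x.obj y.obj p) (u : ShiftedHom y.obj (τ.S.obj x.obj) q) :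
    τ.orbitκ χ x y (Orbit.homog f) (Orbit.homog (y := ⟨τ.S.obj x.obj⟩) u) =
      (χ p : k) * τ.κ x.obj (y.obj⟦p⟧) f (shiftAdj (k := k) y.obj (τ.S.obj x.obj) h u) := by
  rw [orbitκ_apply, Orbit.twist_homog, Linear.smul_comp, map_smul, orbitTr_homog_comp_homog τ h,
    smul_eq_mul]

theorem orbitκ_bijective (x y : Orbit D) {p q : ℤ} (h : q + p = 0) :
    Function.Bijective (fun f : deg k x y p =>
      (τ.orbitκ χ x y f).domRestrict (deg k y (⟨τ.S.obj x.obj⟩ : Orbit D) q)) := by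
  constructor
  · rintro ⟨f, hf⟩ ⟨f', hf'⟩ hff
    obtain ⟨f, rfl⟩ := Orbit.exists_homog_eq hf
    obtain ⟨f', rfl⟩ := Orbit.exists_homog_eq hf'
    congr 2
    apply (τ.κ x.obj (y.obj⟦p⟧)).injective
    ext g
    obtain ⟨u, rfl⟩ := (shiftAdj (k := k) y.obj (τ.S.obj x.obj) h).surjective g
    have h1 := DFunLike.congr_fun hff ⟨_, Orbit.homog_mem (y := ⟨τ.S.obj x.obj⟩) u⟩
    change τ.orbitκ χ x y (Orbit.homog f) (Orbit.homog (y := ⟨τ.S.obj x.obj⟩) u) =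
      τ.orbitκ χ x y (Orbit.homog f') (Orbit.homog (y := ⟨τ.S.obj x.obj⟩) u) at h1
    rw [orbitκ_homog_homog h, orbitκ_homog_homog h] at h1
    exact mul_left_cancel₀ (χ p).ne_zero h1
  · intro Λ
    let L : ShiftedHom y.obj (τ.S.obj x.obj) q →ₗ[k]
        deg k y (⟨τ.S.obj x.obj⟩ : Orbit D) q :=
      LinearMap.rangeRestrict (DirectSum.lof k ℤ (fun p => ShiftedHom y.obj (τ.S.obj x.obj) p) q)
    let f := (τ.κ x.obj (y.obj⟦p⟧)).symm
      (Λ ∘ₗ L ∘ₗ (shiftAdj (k := k) y.obj (τ.S.obj x.obj) h).symm.toLinearMap)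
    refine ⟨⟨_, Orbit.homog_mem (((χ p)⁻¹ : kˣ).val • f)⟩, ?_⟩
    ext ⟨u, hu⟩
    obtain ⟨u, rfl⟩ := Orbit.exists_homog_eq hu
    change τ.orbitκ χ x y (Orbit.homog (((χ p)⁻¹ : kˣ).val • f))
      (Orbit.homog (y := ⟨τ.S.obj x.obj⟩) u) = _
    rw [orbitκ_homog_homog h, map_smul, LinearMap.smul_apply, smul_eq_mul,
      Units.mul_inv_cancel_left, LinearEquiv.apply_symm_apply]
    simp only [LinearMap.comp_apply, LinearEquiv.coe_coe, LinearEquiv.symm_apply_apply]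
    rfl

theorem orbitκ_eq_zero {x y : Orbit D} {p q : ℤ} {f : x ⟶ y}
    {u : y ⟶ (⟨τ.S.obj x.obj⟩ : Orbit D)} (hf : f ∈ deg k x y p) (hu : u ∈ deg k y _ q)
    (h : q + p ≠ 0) : τ.orbitκ χ x y f u = 0 := by
  obtain ⟨f, rfl⟩ := Orbit.exists_homog_eq hf
  obtain ⟨u, rfl⟩ := Orbit.exists_homog_eq hu
  rw [orbitκ_apply, Orbit.twist_homog, Linear.smul_comp, map_smul,
    orbitTr_homog_comp_homog_of_ne τ h f u, smul_zero]

theorem orbitκ_left {x y z : Orbit D} {r : ℤ} (g : x ⟶ y) {h : y ⟶ z}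
    (u : z ⟶ (⟨τ.S.obj x.obj⟩ : Orbit D)) (hh : h ∈ deg k y z r) :
    τ.orbitκ χ x z (g ≫ h) u = (χ r : k) * τ.orbitκ χ x y g (h ≫ u) := by
  obtain ⟨h, rfl⟩ := Orbit.exists_homog_eq hh
  rw [orbitκ_apply, orbitκ_apply, Orbit.twist_comp_homog, Linear.smul_comp, map_smul,
    Category.assoc, smul_eq_mul]

theorem orbitκ_right {s : τ.S.CommShift ℤ} (hs : τ.IsEquivariant χ s) {a x y : Orbit D}
    (f : a ⟶ x) (g : x ⟶ y) (u : y ⟶ (⟨τ.S.obj a.obj⟩ : Orbit D)) :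
    τ.orbitκ χ a y (f ≫ g) u = τ.orbitκ χ x y g (u ≫ τ.orbitMap s a x f) := by
  rw [orbitκ_apply, orbitκ_apply]
  refine Orbit.hom_induction f ?_ ?_ ?_
  · intro p f
    have h2 := orbitTr_comp_zeta f (Orbit.twist χ x y g ≫ u)
    rw [Orbit.twist_homog_comp, Linear.smul_comp, map_smul, Category.assoc, ← h2,
      orbitMap_homog hs, Linear.comp_smul, Linear.comp_smul, map_smul, Category.assoc]
  · simp
  · intro f f' hf hf'
    rw [Preadditive.add_comp, map_add, Preadditive.add_comp, map_add, hf, hf', map_add,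
      Preadditive.comp_add, Preadditive.comp_add, map_add]

theorem equivariant_isEquiv (s : τ.S.CommShift ℤ) : (τ.equivariant s).toGraded.IsEquiv := by
  let _ : τ.S.asEquivalence.functor.CommShift ℤ := s
  let _ := τ.S.asEquivalence.commShiftInverse ℤ
  have := τ.S.asEquivalence.commShift_of_functor ℤ
  have : τ.S.asEquivalence.functor.Additive := τ.additive
  have : τ.S.asEquivalence.functor.Linear k := τ.linear
  let G : EquivariantEndo k D := { Φ := τ.S.asEquivalence.inverse }
  refine ⟨G.toGraded, ?_, ?_⟩
  · refine ((EquivariantEndo.toGraded_comp _ _).symm.trans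
      (EquivariantEndo.toGraded_isIso ?_)).trans EquivariantEndo.toGraded_one
    exact ⟨τ.S.asEquivalence.unitIso.symm,
      inferInstanceAs (NatTrans.CommShift τ.S.asEquivalence.unitIso.symm.hom ℤ)⟩
  · refine ((EquivariantEndo.toGraded_comp _ _).symm.trans
      (EquivariantEndo.toGraded_isIso ?_)).trans EquivariantEndo.toGraded_one
    exact ⟨τ.S.asEquivalence.counitIso,
      inferInstanceAs (NatTrans.CommShift τ.S.asEquivalence.counitIso.hom ℤ)⟩

/-- A `χ`-equivariant Serre functor induces a `χ`-hom-graded Serre functor on the orbit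
category. -/
def orbitSerre {s : τ.S.CommShift ℤ} (hs : τ.IsEquivariant χ s) :
    GradedSerreStructure (k := k) (Orbit D) χ where
  S := (τ.equivariant s).toGraded
  isEquiv := equivariant_isEquiv s
  locallyFinite x y p :=
    have : Module.Finite k (ShiftedHom x.obj y.obj p) := τ.homFinite _ _
    Module.Finite.range (DirectSum.lof k ℤ (fun p => ShiftedHom x.obj y.obj p) p)
  κ x y := τ.orbitκ χ x y
  κ_deg hf hu hq := orbitκ_eq_zero hf hu fun h => hq (by simp [EquivariantEndo.toGraded]; omega)
  κ_bijective x y p := orbitκ_bijective x y (q := 0 - p) (by ring)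
  κ_left g _ u hh := orbitκ_left g u hh
  κ_right f g u := orbitκ_right hs f g u

end SerreStructure

/-- `D` is equivariantly fractionally Calabi-Yau if and only if its orbit category is so in the
hom-graded sense: up to isomorphism, all hom-graded Serre functors come from that of `D`. -/
theorem equivariant_iff_orbit {k : Type w} [Field k] {D : Type u} [Category.{v} D] [Preadditive D]
    [Linear k D] [HasShift D ℤ] [∀ n : ℤ, (shiftFunctor D n).Additive]
    [∀ n : ℤ, (shiftFunctor D n).Linear k] (χ : AddChar ℤ kˣ) (l N : ℕ)
    (σ : SerreStructure k D) :
    (∃ (τ : SerreStructure k D) (s : τ.S.CommShift ℤ), τ.IsEquivariant χ s ∧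
        ((τ.equivariant s).pow l).IsIso ((generator (k := k) (D := D)).pow N)) ↔
      ∃ τ : GradedSerreStructure (k := k) (Orbit D) χ,
        (τ.S.pow l).IsIso (GradedEndo.idShift (N : ℤ)) := by
  constructor
  · rintro ⟨τ, s, hs, h⟩
    exact ⟨SerreStructure.orbitSerre hs, ((τ.equivariant s).toGraded_pow l).symm.trans
      ((EquivariantEndo.toGraded_isIso h).trans (EquivariantEndo.toGraded_generator_pow N))⟩
  · rintro ⟨τ, h⟩
    have hs := σ.twistedCommShift_isEquivariant χ
    refine ⟨σ, σ.twistedCommShift χ, hs, EquivariantEndo.isIso_of_toGraded ?_⟩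
    exact (EquivariantEndo.toGraded_pow _ l).trans
      ((((SerreStructure.orbitSerre hs).isIso τ).pow l).trans
        (h.trans (EquivariantEndo.toGraded_generator_pow N).symm))

/-! ### The graded base algebra -/

section BaseAlgebra

variable {k : Type w} [Field k] {C : Type u} [Category.{v} C] [Preadditive C] [Linear k C]
  [HomGraded k C]

theorem karoubiDeg_comp_mem {P Q R : Karoubi C} {p q r : ℤ} {f : P ⟶ Q} {g : Q ⟶ R}
    (hf : f ∈ karoubiDeg k P Q p) (hg : g ∈ karoubiDeg k Q R q) (h : p + q = r) :
    f ≫ g ∈ karoubiDeg k P R r :=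
  HomGraded.comp_mem' (k := k) (f := f.f) (g := g.f) hf hg h

theorem karoubiDeg_of_eq {P Q : Karoubi C} {p q : ℤ} {f : P ⟶ Q}
    (hf : f ∈ karoubiDeg k P Q p) (h : p = q) : f ∈ karoubiDeg k P Q q := h ▸ hf

theorem karoubiDeg_id_mem {P : Karoubi C} (hP : P.p ∈ deg k P.X P.X 0) :
    𝟙 P ∈ karoubiDeg k P P 0 := hP

variable (k) in
/-- The component of degree `p` of a map between objects of the idempotent completion given by
idempotents of degree `0`. -/
def karoubiProj {P Q : Karoubi C} (hP : P.p ∈ deg k P.X P.X 0) (hQ : Q.p ∈ deg k Q.X Q.X 0)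
    (p : ℤ) (f : P ⟶ Q) : P ⟶ Q where
  f := HomGraded.proj k P.X Q.X p f.f
  comm := by
    rw [← HomGraded.proj_comp_of_mem_right (k := k) (p := p) (r := p) _ hQ (by ring),
      ← HomGraded.proj_comp_of_mem_left (k := k) (q := p) (r := p) hP _ (by ring)]
    exact congrArg _ f.comm

theorem karoubiProj_mem {P Q : Karoubi C} (hP : P.p ∈ deg k P.X P.X 0)
    (hQ : Q.p ∈ deg k Q.X Q.X 0) (p : ℤ) (f : P ⟶ Q) :
    karoubiProj k hP hQ p f ∈ karoubiDeg k P Q p :=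
  HomGraded.proj_mem (k := k) p f.f

variable {ι : Type t} {P : ι → Karoubi C}

theorem algDeg_of_eq {p q : ℤ} {a : HomAlg P} (ha : a ∈ algDeg k P p) (h : p = q) :
    a ∈ algDeg k P q := h ▸ ha

theorem algDeg_mul_mem [Fintype ι] {p q r : ℤ} {a b : HomAlg P} (ha : a ∈ algDeg k P p)
    (hb : b ∈ algDeg k P q) (h : p + q = r) : a * b ∈ algDeg k P r := by
  intro i j
  rw [HomAlg.mul_apply]
  exact Submodule.sum_mem _ fun l _ => karoubiDeg_comp_mem (hb i l) (ha l j) (by omega)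

theorem idem_mem_algDeg (hP : ∀ i, (P i).p ∈ deg k (P i).X (P i).X 0) (i : ι) :
    HomAlg.idem P i ∈ algDeg k P 0 := by
  classical
  intro a b
  by_cases ha : a = i
  · subst ha
    by_cases hb : b = a
    · subst hb
      simpa [HomAlg.idem] using karoubiDeg_id_mem (hP b)
    · rw [HomAlg.idem, Pi.single_eq_same, Pi.single_eq_of_ne hb]
      exact Submodule.zero_mem _
  · rw [HomAlg.idem, Pi.single_eq_of_ne ha]
    exact Submodule.zero_mem _

theorem algDeg_exists_sum [Fintype ι] (hP : ∀ i, (P i).p ∈ deg k (P i).X (P i).X 0)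
    (a : HomAlg P) : ∃ (s : Finset ℤ) (b : ℤ → HomAlg P),
      (∀ p, b p ∈ algDeg k P p) ∧ ∑ p ∈ s, b p = a := by
  classical
  choose s hs hs' using fun i j => HomGraded.exists_sum_proj (k := k) (a i j).f
  let S : Finset ℤ := Finset.univ.biUnion fun i => Finset.univ.biUnion fun j => s i j
  let b : ℤ → HomAlg P := fun p i j => karoubiProj k (hP i) (hP j) p (a i j)
  have happ : ∀ (T : Finset ℤ) (i j : ι), (∑ p ∈ T, b p) i j = ∑ p ∈ T, b p i j := by
    intro T i j
    induction T using Finset.induction_on with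
    | empty => rfl
    | insert x T hx ih => rw [Finset.sum_insert hx, Finset.sum_insert hx, HomAlg.add_apply, ih]
  refine ⟨S, b, fun p i j => karoubiProj_mem (hP i) (hP j) p (a i j), ?_⟩
  ext i j
  rw [happ]
  rw [Karoubi.sum_hom]
  conv_rhs => rw [← hs i j]
  symm
  refine Finset.sum_subset ?_ fun p _ hp => hs' i j p hp
  intro p hp
  simp only [S, Finset.mem_biUnion, Finset.mem_univ, true_and]
  exact ⟨i, j, hp⟩

@[elab_as_elim]
theorem algDeg_induction [Fintype ι] (hP : ∀ i, (P i).p ∈ deg k (P i).X (P i).X 0)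
    {motive : HomAlg P → Prop} (a : HomAlg P)
    (mem : ∀ p, ∀ a ∈ algDeg k P p, motive a) (zero : motive 0)
    (add : ∀ a b, motive a → motive b → motive (a + b)) : motive a := by
  obtain ⟨s, b, hb, rfl⟩ := algDeg_exists_sum hP a
  exact Finset.sum_induction _ _ add zero fun p _ => mem p _ (hb p)

/-! ### Isomorphisms of degree-adjusted automorphisms -/

namespace DegAdjAut

variable [Fintype ι]

namespace IsIso

theorem refl (hP : ∀ i, (P i).p ∈ deg k (P i).X (P i).X 0) (f : DegAdjAut k P) : IsIso f f := by
  refine ⟨1, fun a => by simp, fun i => ?_⟩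
  rw [Units.val_one, mul_one, f.map_idem, HomAlg.idem_mul_self, sub_self]
  exact idem_mem_algDeg hP _

theorem trans {f g h : DegAdjAut k P} (hfg : IsIso f g) (hgh : IsIso g h) : IsIso f h := by
  obtain ⟨b, hb, hb'⟩ := hfg
  obtain ⟨c, hc, hc'⟩ := hgh
  refine ⟨c * b, fun a => ?_, fun i => ?_⟩
  · rw [Units.val_mul, ← mul_assoc, hc, mul_assoc, hb, mul_assoc]
  · have h1 : h.α (HomAlg.idem P i) * ((c * b : (HomAlg P)ˣ) : HomAlg P) *
        f.α (HomAlg.idem P i) =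
          (h.α (HomAlg.idem P i) * c * g.α (HomAlg.idem P i)) *
            (g.α (HomAlg.idem P i) * b * f.α (HomAlg.idem P i)) := by
      have e : g.α (HomAlg.idem P i) * g.α (HomAlg.idem P i) = g.α (HomAlg.idem P i) := by
        rw [← map_mul, HomAlg.idem_mul_self]
      have e' : h.α (HomAlg.idem P i) * h.α (HomAlg.idem P i) = h.α (HomAlg.idem P i) := by
        rw [← map_mul, HomAlg.idem_mul_self]
      rw [hc, mul_assoc (c : HomAlg P), e, ← hc]
      simp only [mul_assoc, Units.val_mul]
      simp only [← mul_assoc]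
      rw [mul_assoc (h.α (HomAlg.idem P i)) c (g.α (HomAlg.idem P i)), ← hc, ← mul_assoc, e']
    rw [h1]
    exact algDeg_mul_mem (hc' i) (hb' i) (by ring)

theorem comp {f f' g g' : DegAdjAut k P} (hf : IsIso f f') (hg : IsIso g g') :
    IsIso (comp g f) (DegAdjAut.comp g' f') := by
  obtain ⟨b, hb, hb'⟩ := hf
  obtain ⟨c, hc, hc'⟩ := hg
  refine ⟨Units.map g'.α.toAlgHom.toMonoidHom b * c, fun a => ?_, fun i => ?_⟩
  · change g'.α (f'.α a) * (g'.α b * c) = g'.α b * c * g.α (f.α a)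
    rw [← mul_assoc, ← map_mul, hb, map_mul, mul_assoc, hc, mul_assoc]
  · change g'.α (f'.α (HomAlg.idem P i)) * (g'.α b * c) * g.α (f.α (HomAlg.idem P i)) ∈
      algDeg k P ((f'.ℓ i + g'.ℓ (f'.perm i)) - (f.ℓ i + g.ℓ (f.perm i)))
    have e : f.α (HomAlg.idem P i) * f.α (HomAlg.idem P i) = f.α (HomAlg.idem P i) := by
      rw [← map_mul, HomAlg.idem_mul_self]
    have e' : f'.α (HomAlg.idem P i) * f'.α (HomAlg.idem P i) = f'.α (HomAlg.idem P i) := by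
      rw [← map_mul, HomAlg.idem_mul_self]
    have h1 : g'.α (f'.α (HomAlg.idem P i)) * (g'.α b * c) * g.α (f.α (HomAlg.idem P i)) =
        g'.α (f'.α (HomAlg.idem P i) * b * f.α (HomAlg.idem P i)) *
          (g'.α (f.α (HomAlg.idem P i)) * c * g.α (f.α (HomAlg.idem P i))) := by
      have hz : g.α (f.α (HomAlg.idem P i)) * g.α (f.α (HomAlg.idem P i)) =
          g.α (f.α (HomAlg.idem P i)) := by rw [← map_mul, e]
      have hy : g'.α (f.α (HomAlg.idem P i)) * g'.α (f.α (HomAlg.idem P i)) =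
          g'.α (f.α (HomAlg.idem P i)) := by rw [← map_mul, e]
      have hyc := hc (f.α (HomAlg.idem P i))
      rw [map_mul, map_mul]
      generalize g'.α (f.α (HomAlg.idem P i)) = y at *
      generalize g.α (f.α (HomAlg.idem P i)) = z at *
      simp only [mul_assoc]
      rw [← mul_assoc y y, hy, ← mul_assoc y _ z, hyc, mul_assoc, hz]
    have h2 := hc' (f.perm i)
    rw [← f.map_idem] at h2
    rw [h1]
    refine algDeg_mul_mem ?_ (h2) (p := f'.ℓ i - f.ℓ i + g'.ℓ (f'.perm i) - g'.ℓ (f.perm i))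
      (by ring)
    have h3 := g'.map_mem (hb' i) (f'.perm i) (f.perm i)
    rw [← f.map_idem, ← f'.map_idem] at h3
    convert h3 using 2
    simp only [← mul_assoc, e']
    simp only [mul_assoc, e]

theorem pow (hP : ∀ i, (P i).p ∈ deg k (P i).X (P i).X 0) {f f' : DegAdjAut k P}
    (h : IsIso f f') (n : ℕ) : IsIso (f.pow n) (f'.pow n) := by
  induction n with
  | zero => exact refl hP _
  | succ n ih => exact comp ih h

end IsIso

/-! ### Uniqueness of the Nakayama automorphism -/

theorem IsFrobenius.exists_mul_eq (hP : ∀ i, (P i).p ∈ deg k (P i).X (P i).X 0)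
    {χ : AddChar ℤ kˣ} {f f' : DegAdjAut k P} {φ φ' : HomAlg P ≃ₗ[k] Module.Dual k (HomAlg P)}
    (h : f.IsFrobenius χ φ) (h' : f'.IsFrobenius χ φ') :
    ∃ u : HomAlg P, ∀ c, φ c = φ' (c * u) := by
  refine ⟨φ'.symm (φ 1), fun c => ?_⟩
  refine algDeg_induction (k := k) hP c ?_ ?_ ?_
  · intro p c hc
    ext m
    rw [h'.map_mul_left hc, φ'.apply_symm_apply, ← h.map_mul_left hc, mul_one]
  · simp
  · intro a b ha hb
    rw [map_add, ha, hb, add_mul, map_add]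

/-- Two Nakayama automorphisms of `A` differ by the inner automorphism of the unit comparing the
two bimodule isomorphisms `A ≅ A^*`. -/
theorem IsNakayama.isIso (hP : ∀ i, (P i).p ∈ deg k (P i).X (P i).X 0)
    {χ : AddChar ℤ kˣ} {f f' : DegAdjAut k P} (hf : f.IsNakayama χ) (hf' : f'.IsNakayama χ) :
    f.IsIso f' := by
  obtain ⟨φ, h⟩ := hf
  obtain ⟨φ', h'⟩ := hf'
  obtain ⟨u, hu⟩ := h.exists_mul_eq hP h'
  obtain ⟨v, hv⟩ := h'.exists_mul_eq hP h
  have huv : u * v = 1 := by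
    apply φ.injective
    rw [← hv, ← one_mul u, ← hu]
  have hvu : v * u = 1 := by
    apply φ'.injective
    rw [← hu, ← one_mul v, ← hv]
  have hcomm : ∀ c, c * u = u * f'.α.symm (f.α c) := by
    intro c
    apply φ'.injective
    ext m
    rw [← hu, h'.map_mul_right, AlgEquiv.apply_symm_apply, ← one_mul u, ← hu, ← h.map_mul_right,
      one_mul]
  refine ⟨⟨f'.α u, f'.α v, by rw [← map_mul, huv, map_one], by rw [← map_mul, hvu, map_one]⟩,
    fun a => ?_, fun i => ?_⟩
  · change f'.α a * f'.α u = f'.α u * f.α a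
    rw [← map_mul, hcomm, map_mul, AlgEquiv.apply_symm_apply]
  · change f'.α (HomAlg.idem P i) * f'.α u * f.α (HomAlg.idem P i) ∈ _
    obtain ⟨j, hj⟩ := f'.perm.surjective (f.perm i)
    have hij : HomAlg.idem P i * u = HomAlg.idem P i * u * HomAlg.idem P j := by
      have : HomAlg.idem P i * u = u * HomAlg.idem P j := by
        rw [hcomm, f.map_idem, ← hj, ← f'.map_idem, AlgEquiv.symm_apply_apply]
      rw [this, mul_assoc, HomAlg.idem_mul_self]
    have hmem : HomAlg.idem P i * u ∈ algDeg k P (f'.ℓ j - f.ℓ i) := by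
      obtain ⟨s, b, hb, hsum⟩ := algDeg_exists_sum hP u
      have hb' : ∀ p, HomAlg.idem P i * b p ∈ algDeg k P p := fun p =>
        algDeg_mul_mem (idem_mem_algDeg hP i) (hb p) (zero_add p)
      have hx : HomAlg.idem P i * u = ∑ p ∈ s, HomAlg.idem P i * b p * HomAlg.idem P j := by
        rw [hij, ← hsum, Finset.mul_sum, Finset.sum_mul]
      have hzero : ∀ d ∈ s, d ≠ f'.ℓ j - f.ℓ i → HomAlg.idem P i * b d * HomAlg.idem P j = 0 := by
        intro d hd hne
        apply φ'.injective
        rw [map_zero]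
        ext m
        refine algDeg_induction (k := k) hP m ?_ ?_ ?_
        · intro q m hm
          by_cases hq : q = f'.ℓ j - d
          · have h1 : φ' (HomAlg.idem P i * u) m =
                φ' (HomAlg.idem P i * b d * HomAlg.idem P j) m := by
              rw [hx, map_sum, LinearMap.sum_apply, Finset.sum_eq_single_of_mem d hd]
              intro p _ hp
              exact h'.map_deg j (hb' p) hm (by omega)
            rw [← h1, ← hu, ← HomAlg.idem_mul_self]
            exact h.map_deg i (idem_mem_algDeg hP i) hm (by omega)
          · exact h'.map_deg j (hb' d) hm hq
        · simp
        · intro a b ha hb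
          rw [map_add, ha, hb, map_add]
      rw [hx]
      refine Submodule.sum_mem _ fun d hd => ?_
      by_cases hne : d = f'.ℓ j - f.ℓ i
      · rw [← hne]
        exact HomAlg.idem_mul_mul_idem_mem P (hb d) i j
      · rw [hzero d hd hne]
        exact Submodule.zero_mem _
    have h1 : f'.α (HomAlg.idem P i) * f'.α u * f.α (HomAlg.idem P i) =
        f'.α (HomAlg.idem P i * (HomAlg.idem P i * u) * HomAlg.idem P j) := by
      rw [← mul_assoc, HomAlg.idem_mul_self, map_mul, map_mul, f'.map_idem j, hj, f.map_idem]
    rw [h1]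
    exact algDeg_of_eq (f'.map_mem hmem i j) (by ring)

end DegAdjAut

end BaseAlgebra

/-! ### Indecomposable objects and local endomorphism rings -/

/-- Fitting's lemma for an element of a finite-dimensional algebra without nontrivial
idempotents. -/
theorem isNilpotent_or_isUnit_of_idempotents (k : Type*) [Field k] {R : Type*} [Ring R]
    [Algebra k R] [Module.Finite k R] (h : ∀ e : R, e * e = e → e = 0 ∨ e = 1) (u : R) :
    IsNilpotent u ∨ IsUnit u := by
  obtain ⟨n, hn, hpos⟩ := ((LinearMap.eventually_isCompl_ker_pow_range_pow
    (LinearMap.mulLeft k u)).and (Filter.eventually_ge_atTop 1)).exists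
  rw [LinearMap.pow_mulLeft] at hn
  obtain ⟨a, ha, b, ⟨x, hx⟩, hab⟩ := Submodule.mem_sup.1
    (show (1 : R) ∈ _ ⊔ _ by rw [hn.sup_eq_top]; trivial)
  rw [LinearMap.mem_ker, LinearMap.mulLeft_apply] at ha
  rw [LinearMap.mulLeft_apply] at hx
  have hba : b * a = 0 := by
    have h1 : b * a ∈ LinearMap.ker (LinearMap.mulLeft k (u ^ n)) := by
      have : b * a = a - a * a := by rw [eq_sub_of_add_eq' hab, sub_mul, one_mul]
      rw [LinearMap.mem_ker, LinearMap.mulLeft_apply, this, mul_sub, ← mul_assoc, ha, zero_mul,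
        sub_zero]
    have h2 : b * a ∈ LinearMap.range (LinearMap.mulLeft k (u ^ n)) :=
      ⟨x * a, by rw [LinearMap.mulLeft_apply, ← mul_assoc, hx]⟩
    exact (Submodule.disjoint_def.1 hn.disjoint) _ h1 h2
  have haa : a * a = a := by
    have : (a + b) * a = a := by rw [hab, one_mul]
    rwa [add_mul, hba, add_zero] at this
  rcases h a haa with rfl | rfl
  · right
    rw [zero_add] at hab
    rw [hab] at hx
    have hsurj : Function.Surjective (LinearMap.mulLeft k (u ^ n)) := fun y =>
      ⟨x * y, by rw [LinearMap.mulLeft_apply, ← mul_assoc, hx, one_mul]⟩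
    have hinj := LinearMap.injective_iff_surjective.2 hsurj
    have hx' : x * u ^ n = 1 := hinj (by
      rw [LinearMap.mulLeft_apply, LinearMap.mulLeft_apply, ← mul_assoc, hx, one_mul, mul_one])
    have hun : IsUnit (u ^ n) := ⟨⟨u ^ n, x, hx, hx'⟩, rfl⟩
    exact (isUnit_pow_iff (by omega)).1 hun
  · left
    exact ⟨n, by rwa [mul_one] at ha⟩

/-- A finite-dimensional algebra without nontrivial idempotents is local. -/
theorem exists_isUnit_of_sum (k : Type*) [Field k] {R : Type*} [Ring R]
    [Algebra k R] [Module.Finite k R] [Nontrivial R]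
    (h : ∀ e : R, e * e = e → e = 0 ∨ e = 1) {α : Type*} (s : Finset α) (u : α → R)
    (hu : IsUnit (∑ i ∈ s, u i)) : ∃ i ∈ s, IsUnit (u i) := by
  classical
  induction s using Finset.induction_on with
  | empty => simp at hu
  | insert i s hi ih =>
    rw [Finset.sum_insert hi] at hu
    obtain ⟨w, hw⟩ := hu
    have h1 : (↑w⁻¹ : R) * u i + ↑w⁻¹ * ∑ j ∈ s, u j = 1 := by
      rw [← mul_add, ← hw, Units.inv_mul]
    rcases isNilpotent_or_isUnit_of_idempotents k h ((↑w⁻¹ : R) * u i) with hn | hn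
    · have h2 := hn.isUnit_one_sub
      rw [← h1, add_sub_cancel_left, Units.isUnit_units_mul] at h2
      obtain ⟨j, hj, hj'⟩ := ih h2
      exact ⟨j, Finset.mem_insert_of_mem hj, hj'⟩
    · rw [Units.isUnit_units_mul] at hn
      exact ⟨i, Finset.mem_insert_self _ _, hn⟩

section Indecomposable

variable {B : Type u} [Category.{v} B] [Preadditive B]

/-- An indecomposable object has no nontrivial idempotents, as these would split off a summand. -/
theorem IsIndecomposable.eq_zero_or_eq_id [IsIdempotentComplete B] {x : B}
    (hx : IsIndecomposable x) (e : x ⟶ x) (he : e ≫ e = e) : e = 0 ∨ e = 𝟙 x := by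
  obtain ⟨y, i, p, hip, hpi⟩ := IsIdempotentComplete.idempotents_split x e he
  obtain ⟨z, j, q, hjq, hqj⟩ := IsIdempotentComplete.idempotents_split x (𝟙 x - e)
    (by simp [he])
  have hiq : i ≫ q = 0 := by
    have h1 : i ≫ e = i := by rw [← hpi, reassoc_of% hip]
    have h2 : (𝟙 x - e) ≫ q = q := by rw [← hqj, Category.assoc, hjq, Category.comp_id]
    rw [← h1, ← h2, Category.assoc, ← Category.assoc e, Preadditive.comp_sub, he]
    simp
  have hjp : j ≫ p = 0 := by
    have h1 : j ≫ (𝟙 x - e) = j := by rw [← hqj, reassoc_of% hjq]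
    have h2 : e ≫ p = p := by rw [← hpi, Category.assoc, hip, Category.comp_id]
    rw [← h1, ← h2, Category.assoc, ← Category.assoc (𝟙 x - e), Preadditive.sub_comp, he]
    simp
  let b : Limits.BinaryBicone y z :=
    { pt := x, fst := p, snd := q, inl := i, inr := j, inl_fst := hip, inl_snd := hiq
      inr_fst := hjp, inr_snd := hjq }
  rcases hx.2 y z b ⟨Limits.isBinaryBilimitOfTotal b (by simp [b, hpi, hqj])⟩ ⟨Iso.refl _⟩ with
    h | h
  · left
    rw [← hpi, h.eq_of_tgt p 0, Limits.zero_comp]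
  · right
    rw [h.eq_of_tgt q 0, Limits.zero_comp] at hqj
    exact (sub_eq_zero.1 hqj.symm).symm

theorem isIndecomposable_of_idempotents {x : B} (hx : ¬ Limits.IsZero x)
    (h : ∀ e : x ⟶ x, e ≫ e = e → e = 0 ∨ e = 𝟙 x) : IsIndecomposable x := by
  refine ⟨hx, fun y z b _ ⟨iso⟩ => ?_⟩
  rcases h (iso.hom ≫ b.fst ≫ b.inl ≫ iso.inv) (by simp) with h | h
  · left
    have h1 : b.fst ≫ b.inl = 0 := by
      rw [← cancel_epi iso.hom, ← cancel_mono iso.inv]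
      simpa using h
    rw [Limits.IsZero.iff_id_eq_zero]
    calc 𝟙 y = b.inl ≫ (b.fst ≫ b.inl) ≫ b.fst := by simp
      _ = 0 := by rw [h1]; simp
  · right
    have h1 : b.fst ≫ b.inl = 𝟙 _ := by
      rw [← cancel_epi iso.hom, ← cancel_mono iso.inv]
      simpa using h
    rw [Limits.IsZero.iff_id_eq_zero]
    calc 𝟙 z = b.inr ≫ (𝟙 _) ≫ b.snd := by simp
      _ = 0 := by rw [← h1]; simp

variable {k : Type w} [Field k] [Linear k B]

theorem IsIndecomposable.exists_isIso_of_sum [IsIdempotentComplete B] {x : B}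
    (hx : IsIndecomposable x) [hfin : Module.Finite k (x ⟶ x)] {α : Type*} (s : Finset α)
    (u : α → (x ⟶ x)) (hu : ∑ i ∈ s, u i = 𝟙 x) : ∃ i ∈ s, IsIso (u i) := by
  have : Module.Finite k (End x) := hfin
  have : Nontrivial (End x) := ⟨⟨𝟙 x, 0, fun h => hx.1 ((Limits.IsZero.iff_id_eq_zero x).2 h)⟩⟩
  obtain ⟨i, hi, h⟩ := exists_isUnit_of_sum k (R := End x)
    (fun e he => hx.eq_zero_or_eq_id e he) s u (by
      have h1 : (∑ i ∈ s, u i : End x) = 1 := hu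
      rw [h1]; exact isUnit_one)
  exact ⟨i, hi, (isUnit_iff_isIso _).1 h⟩

theorem finrank_end_lt_of_retract {x y : B} [Module.Finite k (x ⟶ x)] (i : y ⟶ x) (p : x ⟶ y)
    (h : i ≫ p = 𝟙 y) (h' : p ≫ i ≠ 𝟙 x) :
    Module.finrank k (y ⟶ y) < Module.finrank k (x ⟶ x) := by
  let L : (y ⟶ y) →ₗ[k] (x ⟶ x) := Linear.leftComp k x p ∘ₗ Linear.rightComp k y i
  have hL : ∀ f, L f = p ≫ f ≫ i := fun f => rfl
  have hinj : Function.Injective L := by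
    intro f g hfg
    have := congrArg (fun z => i ≫ z ≫ p) hfg
    simpa [hL, h, reassoc_of% h] using this
  rw [← LinearMap.finrank_range_of_inj hinj]
  apply Submodule.finrank_lt
  intro htop
  obtain ⟨f, hf⟩ : 𝟙 x ∈ LinearMap.range L := by rw [htop]; trivial
  rw [hL] at hf
  apply h'
  calc p ≫ i = (p ≫ f ≫ i) ≫ p ≫ i := by rw [hf, Category.id_comp]
    _ = 𝟙 x := by
      rw [← hf]
      simp [reassoc_of% h]

theorem finite_end_of_retract {x y : B} [Module.Finite k (x ⟶ x)] (i : y ⟶ x) (p : x ⟶ y)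
    (h : i ≫ p = 𝟙 y) : Module.Finite k (y ⟶ y) := by
  let L : (y ⟶ y) →ₗ[k] (x ⟶ x) := Linear.leftComp k x p ∘ₗ Linear.rightComp k y i
  have hL : ∀ f, L f = p ≫ f ≫ i := fun f => rfl
  refine Module.Finite.of_injective L fun f g hfg => ?_
  have := congrArg (fun z => i ≫ z ≫ p) hfg
  simpa [hL, h, reassoc_of% h] using this

theorem exists_indecomposable_retract [IsIdempotentComplete B] {x : B}
    [Module.Finite k (x ⟶ x)] (hx : ¬ Limits.IsZero x) :
    ∃ (y : B) (i : y ⟶ x) (p : x ⟶ y), IsIndecomposable y ∧ i ≫ p = 𝟙 y := by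
  induction hn : Module.finrank k (x ⟶ x) using Nat.strong_induction_on generalizing x with
  | _ n ih =>
    by_cases hind : IsIndecomposable x
    · exact ⟨x, 𝟙 x, 𝟙 x, hind, Category.comp_id _⟩
    · have : ∃ e : x ⟶ x, e ≫ e = e ∧ e ≠ 0 ∧ e ≠ 𝟙 x := by
        by_contra! hcon
        exact hind (isIndecomposable_of_idempotents hx fun e he =>
          or_iff_not_imp_left.2 (hcon e he))
      obtain ⟨e, he, he0, he1⟩ := this
      obtain ⟨y, i, p, hip, hpi⟩ := IsIdempotentComplete.idempotents_split x e he
      have := finite_end_of_retract (k := k) i p hip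
      have hy : ¬ Limits.IsZero y := fun h0 => he0 (by
        rw [← hpi, h0.eq_of_tgt p 0, Limits.zero_comp])
      obtain ⟨z, j, q, hz, hjq⟩ := ih _ (hn ▸ finrank_end_lt_of_retract (k := k) i p hip
        (by rwa [hpi])) hy rfl
      exact ⟨z, j ≫ i, p ≫ q, hz, by rw [Category.assoc, reassoc_of% hip, hjq]⟩

end Indecomposable

/-! ### Homogeneous decompositions in the idempotent completion -/

section Homogeneous

variable {k : Type w} [Field k] {C : Type u} [Category.{v} C] [Preadditive C] [Linear k C]

theorem karoubi_finite (hfin : ∀ x y : C, Module.Finite k (x ⟶ y)) (P Q : Karoubi C) :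
    Module.Finite k (P ⟶ Q) := by
  have := hfin P.X Q.X
  let L : (P ⟶ Q) →ₗ[k] (P.X ⟶ Q.X) :=
    { toFun := fun f => f.f, map_add' := fun _ _ => rfl, map_smul' := fun _ _ => rfl }
  exact Module.Finite.of_injective L fun f g h => Karoubi.Hom.ext h

variable [HomGraded k C]

/-- A retract of an object of degree `0` which is indecomposable and of degree `0` is a
homogeneous retract. -/
theorem exists_homogeneous_retract {P Q : Karoubi C} [Module.Finite k (P ⟶ P)]
    (hP : P.p ∈ deg k P.X P.X 0) (hQ : Q.p ∈ deg k Q.X Q.X 0) (hind : IsIndecomposable P)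
    (i : P ⟶ Q) (r : Q ⟶ P) (h : i ≫ r = 𝟙 P) :
    ∃ d, ∃ i' ∈ karoubiDeg k P Q d, ∃ r' ∈ karoubiDeg k Q P (-d), i' ≫ r' = 𝟙 P := by
  obtain ⟨s, hs, -⟩ := HomGraded.exists_sum_proj (k := k) i.f
  have hs' : ∑ d ∈ s, karoubiProj k hP hQ d i = i := by
    ext
    rw [Karoubi.sum_hom]
    exact hs
  obtain ⟨d, -, hd⟩ := hind.exists_isIso_of_sum (k := k) s (fun d => karoubiProj k hP hQ d i ≫ r)
    (by rw [← Preadditive.sum_comp, hs', h])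
  let t := inv (karoubiProj k hP hQ d i ≫ r)
  have ht : karoubiProj k hP hQ d i ≫ r ≫ t = 𝟙 P := by
    rw [← Category.assoc, IsIso.hom_inv_id]
  refine ⟨d, karoubiProj k hP hQ d i, karoubiProj_mem _ _ _ _,
    karoubiProj k hQ hP (-d) (r ≫ t), karoubiProj_mem _ _ _ _, ?_⟩
  ext
  have h1 := HomGraded.proj_comp_of_mem_left (k := k) (karoubiProj_mem hP hQ d i)
    (r ≫ t).f (add_neg_cancel d)
  have h2 : (karoubiProj k hP hQ d i).f ≫ (r ≫ t).f = P.p := congrArg Karoubi.Hom.f ht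
  rw [h2, HomGraded.proj_of_mem hP] at h1
  exact h1.symm

variable {ι : Type t}

/-- Endomorphisms which are composites of homogeneous maps of opposite degrees through one of the
objects `P i`. -/
def homogeneousFactor (k : Type w) [Field k] [Linear k C] [HomGraded k C] (P : ι → Karoubi C)
    (Q : Karoubi C) : Set (Q ⟶ Q) :=
  {f | ∃ i d, ∃ a ∈ karoubiDeg k Q (P i) d, ∃ b ∈ karoubiDeg k (P i) Q (-d), a ≫ b = f}

theorem id_mem_span_homogeneousFactor {P : ι → Karoubi C}
    (hfin : ∀ x y : C, Module.Finite k (x ⟶ y)) (hP : IsBaseSkeleton k P) (Q : Karoubi C)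
    (hQ : Q.p ∈ deg k Q.X Q.X 0) : 𝟙 Q ∈ Submodule.span k (homogeneousFactor k P Q) := by
  have hfin' := karoubi_finite hfin
  induction hn : Module.finrank k (Q ⟶ Q) using Nat.strong_induction_on generalizing Q with
  | _ n ih =>
    by_cases hzero : Limits.IsZero Q
    · rw [hzero.eq_of_tgt (𝟙 Q) 0]
      exact Submodule.zero_mem _
    obtain ⟨R, i, r, hR, hir⟩ := exists_indecomposable_retract (k := k) hzero
    obtain ⟨l, ⟨iso⟩⟩ := hP.complete R hR
    obtain ⟨d, i', hi', r', hr', hir'⟩ := exists_homogeneous_retract (hP.idem_mem l) hQ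
      (hP.indecomposable l) (iso.inv ≫ i) (r ≫ iso.hom) (by simp [reassoc_of% hir])
    have he : r' ≫ i' ∈ karoubiDeg k Q Q 0 := karoubiDeg_comp_mem hr' hi' (by ring)
    -- the complementary summand `1 - e` of the homogeneous summand `e ≅ P l`
    let g : Q ⟶ Q := 𝟙 Q - r' ≫ i'
    have hg : g ≫ g = g := by simp [g, reassoc_of% hir']
    have hg0 : g ∈ karoubiDeg k Q Q 0 := Submodule.sub_mem _ (karoubiDeg_id_mem hQ) he
    let Q' : Karoubi C := ⟨Q.X, g.f, congrArg Karoubi.Hom.f hg⟩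
    let j : Q' ⟶ Q := ⟨g.f, by
      have h1 := congrArg Karoubi.Hom.f hg
      have h2 := Karoubi.comp_p g
      dsimp [Q'] at h1 ⊢
      rw [h2, h1]⟩
    let q : Q ⟶ Q' := ⟨g.f, by
      have h1 := congrArg Karoubi.Hom.f hg
      have h2 := Karoubi.p_comp g
      dsimp [Q'] at h1 ⊢
      rw [h1, h2]⟩
    have hj : j ∈ karoubiDeg k Q' Q 0 := hg0
    have hq : q ∈ karoubiDeg k Q Q' 0 := hg0
    have hgf : g.f ≫ g.f = g.f := congrArg Karoubi.Hom.f hg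
    have hjq : j ≫ q = 𝟙 Q' := Karoubi.Hom.ext hgf
    have hqj : q ≫ j = g := Karoubi.Hom.ext hgf
    have hne : q ≫ j ≠ 𝟙 Q := by
      intro h
      rw [hqj] at h
      have h0 : r' ≫ i' = 0 := by simpa [g] using h
      refine (hP.indecomposable l).1 ((Limits.IsZero.iff_id_eq_zero _).2 ?_)
      calc 𝟙 (P l) = i' ≫ (r' ≫ i') ≫ r' := by simp [hir']
        _ = 0 := by rw [h0]; simp
    have hQ' := ih _ (hn ▸ finrank_end_lt_of_retract (k := k) j q hjq hne) Q' hg0 rfl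
    let L : (Q' ⟶ Q') →ₗ[k] (Q ⟶ Q) := Linear.leftComp k Q q ∘ₗ Linear.rightComp k Q' j
    have hL : Submodule.map L (Submodule.span k (homogeneousFactor k P Q')) ≤
        Submodule.span k (homogeneousFactor k P Q) := by
      rw [Submodule.map_span]
      refine Submodule.span_mono ?_
      rintro _ ⟨_, ⟨l, d, a, ha, b, hb, rfl⟩, rfl⟩
      exact ⟨l, d, q ≫ a, karoubiDeg_comp_mem hq ha (by ring), b ≫ j,
        karoubiDeg_comp_mem hb hj (by ring), by simp [L]⟩
    have h1 : g ∈ Submodule.span k (homogeneousFactor k P Q) := by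
      rw [← hqj]
      simpa [L] using hL (Submodule.mem_map_of_mem hQ')
    have h2 : r' ≫ i' ∈ Submodule.span k (homogeneousFactor k P Q) :=
      Submodule.subset_span ⟨l, -d, r', hr', i', karoubiDeg_of_eq hi' (by ring), rfl⟩
    have := Submodule.add_mem _ h1 h2
    simpa [g] using this

/-- The identity of an object is a finite sum of composites of homogeneous maps of opposite
degrees through the objects `P i`. -/
theorem exists_sum_homogeneousFactor {P : ι → Karoubi C}
    (hfin : ∀ x y : C, Module.Finite k (x ⟶ y)) (hP : IsBaseSkeleton k P) (Q : Karoubi C)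
    (hQ : Q.p ∈ deg k Q.X Q.X 0) : ∃ (n : ℕ) (l : Fin n → ι) (d : Fin n → ℤ)
      (a : ∀ s, Q ⟶ P (l s)) (b : ∀ s, P (l s) ⟶ Q),
      (∀ s, a s ∈ karoubiDeg k Q (P (l s)) (d s)) ∧
        (∀ s, b s ∈ karoubiDeg k (P (l s)) Q (-d s)) ∧ ∑ s, a s ≫ b s = 𝟙 Q := by
  obtain ⟨n, c, f, hf⟩ := Submodule.mem_span_set'.1
    (id_mem_span_homogeneousFactor hfin hP Q hQ)
  choose l d a ha b hb hab using fun s => (f s).2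
  refine ⟨n, l, d, fun s => c s • a s, b, fun s => Submodule.smul_mem _ _ (ha s), hb, ?_⟩
  simpa [hab] using hf

end Homogeneous

/-! ### Degree-preserving functors and automorphisms of the base algebra -/

section

variable {k : Type w} [Field k] {C : Type u} [Category.{v} C] [Preadditive C] [Linear k C]
  [HomGraded k C] {ι : Type t} {P : ι → Karoubi C}

/-- The extension of a degree-preserving functor to the idempotent completion. -/
def GradedEndo.karoubiExt (F : GradedEndo k C) : Karoubi C ⥤ Karoubi C where
  obj Q := ⟨F.H.obj Q.X, F.H.map Q.p, by rw [← F.H.map_comp, Q.idem]⟩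
  map {Q R} f := ⟨F.H.map f.f, by
    have h := congrArg F.H.map f.comm
    rwa [F.H.map_comp, F.H.map_comp] at h⟩
  map_id _ := rfl
  map_comp f g := Karoubi.Hom.ext (F.H.map_comp f.f g.f)

instance (F : GradedEndo k C) : F.karoubiExt.Additive where
  map_add {_ _ f g} := Karoubi.Hom.ext (F.H.map_add (f := f.f) (g := g.f))

instance (F : GradedEndo k C) : F.karoubiExt.Linear k where
  map_smul f c := Karoubi.Hom.ext (F.H.map_smul c f.f)

theorem GradedEndo.karoubiExt_map_mem (F : GradedEndo k C) {Q R : Karoubi C} {p : ℤ} {f : Q ⟶ R}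
    (hf : f ∈ karoubiDeg k Q R p) :
    F.karoubiExt.map f ∈ karoubiDeg k _ _ (p + F.γ R.X - F.γ Q.X) :=
  F.map_mem hf

theorem GradedEndo.karoubiExt_obj_p_mem (F : GradedEndo k C) {Q : Karoubi C}
    (hQ : Q.p ∈ deg k Q.X Q.X 0) :
    (F.karoubiExt.obj Q).p ∈ deg k (F.karoubiExt.obj Q).X (F.karoubiExt.obj Q).X 0 :=
  HomGraded.mem_of_eq (F.map_mem hQ) (by ring)

/-- The map which a natural transformation induces on an object of the idempotent completion. -/
def GradedEndo.karoubiApp {F G : GradedEndo k C} (e : F.H ⟶ G.H) (Q : Karoubi C) :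
    F.karoubiExt.obj Q ⟶ G.karoubiExt.obj Q where
  f := F.H.map Q.p ≫ e.app Q.X
  comm := by
    change F.H.map Q.p ≫ (F.H.map Q.p ≫ e.app Q.X) ≫ G.H.map Q.p = F.H.map Q.p ≫ e.app Q.X
    rw [Category.assoc, ← e.naturality, ← F.H.map_comp_assoc, ← F.H.map_comp_assoc, Q.idem, Q.idem]

theorem GradedEndo.karoubiApp_naturality {F G : GradedEndo k C} (e : F.H ⟶ G.H) {Q R : Karoubi C}
    (a : Q ⟶ R) : F.karoubiExt.map a ≫ GradedEndo.karoubiApp e R =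
      GradedEndo.karoubiApp e Q ≫ G.karoubiExt.map a := by
  refine Karoubi.Hom.ext ?_
  change F.H.map a.f ≫ F.H.map R.p ≫ e.app R.X = (F.H.map Q.p ≫ e.app Q.X) ≫ G.H.map a.f
  rw [Category.assoc, ← e.naturality, ← F.H.map_comp_assoc, ← F.H.map_comp_assoc, Karoubi.p_comp,
    Karoubi.comp_p]

theorem GradedEndo.karoubiApp_comp {F G : GradedEndo k C} {e : F.H ⟶ G.H} {e' : G.H ⟶ F.H}
    (h : e ≫ e' = 𝟙 _) (Q : Karoubi C) :
    GradedEndo.karoubiApp e Q ≫ GradedEndo.karoubiApp e' Q = 𝟙 _ := by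
  refine Karoubi.Hom.ext ?_
  change (F.H.map Q.p ≫ e.app Q.X) ≫ G.H.map Q.p ≫ e'.app Q.X = F.H.map Q.p
  rw [Category.assoc, ← e.naturality_assoc, ← NatTrans.comp_app, h, NatTrans.id_app,
    Category.comp_id, ← F.H.map_comp, Q.idem]

theorem GradedEndo.karoubiApp_mem {F G : GradedEndo k C} {e : F.H ⟶ G.H} {Q : Karoubi C}
    (hQ : Q.p ∈ deg k Q.X Q.X 0) {d : ℤ} (he : e.app Q.X ∈ deg k _ _ d) :
    GradedEndo.karoubiApp e Q ∈ karoubiDeg k _ _ d :=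
  HomGraded.comp_mem' (F.map_mem hQ) he (by ring)

/-- The inverse of a homogeneous isomorphism is homogeneous. -/
theorem inv_mem_karoubiDeg {Q R : Karoubi C} (hQ : Q.p ∈ deg k Q.X Q.X 0)
    (hR : R.p ∈ deg k R.X R.X 0) {d : ℤ} {f : Q ⟶ R} {g : R ⟶ Q}
    (hf : f ∈ karoubiDeg k Q R d) (hfg : f ≫ g = 𝟙 Q) (hgf : g ≫ f = 𝟙 R) :
    g ∈ karoubiDeg k R Q (-d) := by
  have h1 := HomGraded.proj_comp_of_mem_left (k := k) hf g.f (add_neg_cancel d)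
  have h2 : f.f ≫ g.f = Q.p := congrArg Karoubi.Hom.f hfg
  rw [h2, HomGraded.proj_of_mem hQ] at h1
  have h3 : f ≫ karoubiProj k hR hQ (-d) g = 𝟙 Q := Karoubi.Hom.ext h1.symm
  have h4 : karoubiProj k hR hQ (-d) g = g := by
    rw [← Category.id_comp (karoubiProj k hR hQ (-d) g), ← hgf, Category.assoc, h3,
      Category.comp_id]
  rw [← h4]
  exact karoubiProj_mem hR hQ (-d) g

/-- Maps into `Φ Q` are determined by their composites with the maps `Φ (a s)`, if the identity of
`Q` is a sum of maps which factor through the `a s`. -/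
theorem map_hom_ext {B B' : Type*} [Category* B] [Category* B'] [Preadditive B] [Preadditive B']
    (Φ : B ⥤ B') [Φ.Additive] {Q : B} {α : Type*} [Fintype α] {R : α → B} {a : ∀ s, Q ⟶ R s}
    {b : ∀ s, R s ⟶ Q} (hab : ∑ s, a s ≫ b s = 𝟙 Q) {Z : B'} {u u' : Z ⟶ Φ.obj Q}
    (h : ∀ s, u ≫ Φ.map (a s) = u' ≫ Φ.map (a s)) : u = u' := by
  rw [← Category.comp_id u, ← Category.comp_id u', ← Φ.map_id, ← hab, Φ.map_sum,
    Preadditive.comp_sum, Preadditive.comp_sum]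
  refine Finset.sum_congr rfl fun s _ => ?_
  rw [Φ.map_comp, ← Category.assoc, h, Category.assoc]

/-- A homogeneous natural transformation on the objects `P i` of the base category extends to all
objects of degree `0` of the idempotent completion. -/
theorem exists_extension (hfin : ∀ x y : C, Module.Finite k (x ⟶ y)) (hP : IsBaseSkeleton k P)
    (F G : GradedEndo k C) (e : ∀ i, F.karoubiExt.obj (P i) ⟶ G.karoubiExt.obj (P i))
    (he : ∀ i, e i ∈ karoubiDeg k _ _ (G.γ (P i).X - F.γ (P i).X))
    (hnat : ∀ i j (a : P i ⟶ P j), F.karoubiExt.map a ≫ e j = e i ≫ G.karoubiExt.map a)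
    (Q : Karoubi C) (hQ : Q.p ∈ deg k Q.X Q.X 0) :
    ∃ E : F.karoubiExt.obj Q ⟶ G.karoubiExt.obj Q,
      E ∈ karoubiDeg k _ _ (G.γ Q.X - F.γ Q.X) ∧
      ∀ (i : ι) (a : Q ⟶ P i), F.karoubiExt.map a ≫ e i = E ≫ G.karoubiExt.map a := by
  obtain ⟨n, l, d, a, b, ha, hb, hab⟩ := exists_sum_homogeneousFactor hfin hP Q hQ
  refine ⟨∑ s, F.karoubiExt.map (a s) ≫ e (l s) ≫ G.karoubiExt.map (b s), ?_, fun i a' => ?_⟩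
  · refine Submodule.sum_mem _ fun s _ => ?_
    exact karoubiDeg_comp_mem (F.karoubiExt_map_mem (ha s))
      (karoubiDeg_comp_mem (he (l s)) (G.karoubiExt_map_mem (hb s)) rfl) (by ring)
  · have h1 : a' = ∑ s, a s ≫ b s ≫ a' := by
      simp_rw [← Category.assoc]
      rw [← Preadditive.sum_comp, hab, Category.id_comp]
    conv_lhs => rw [h1]
    rw [Functor.map_sum, Preadditive.sum_comp, Preadditive.sum_comp]
    refine Finset.sum_congr rfl fun s _ => ?_
    rw [F.karoubiExt.map_comp, Category.assoc, hnat, G.karoubiExt.map_comp, Category.assoc,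
      Category.assoc]

/-- A homogeneous natural isomorphism on the objects `P i` of the base category extends to `C`. -/
theorem GradedEndo.isIso_of_base (hfin : ∀ x y : C, Module.Finite k (x ⟶ y))
    (hP : IsBaseSkeleton k P) (F G : GradedEndo k C)
    (e : ∀ i, F.karoubiExt.obj (P i) ≅ G.karoubiExt.obj (P i))
    (he : ∀ i, (e i).hom ∈ karoubiDeg k _ _ (G.γ (P i).X - F.γ (P i).X))
    (he' : ∀ i, (e i).inv ∈ karoubiDeg k _ _ (F.γ (P i).X - G.γ (P i).X))
    (hnat : ∀ i j (a : P i ⟶ P j),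
      F.karoubiExt.map a ≫ (e j).hom = (e i).hom ≫ G.karoubiExt.map a) : F.IsIso G := by
  have hnat' : ∀ i j (a : P i ⟶ P j),
      G.karoubiExt.map a ≫ (e j).inv = (e i).inv ≫ F.karoubiExt.map a := fun i j a => by
    rw [Iso.comp_inv_eq, Category.assoc, hnat, Iso.inv_hom_id_assoc]
  choose E hE hEa using fun x : C => exists_extension hfin hP F G (fun i => (e i).hom) he hnat
    ((toKaroubi C).obj x) (HomGraded.id_mem x)
  choose E' hE' hEa' using fun x : C => exists_extension hfin hP G F (fun i => (e i).inv) he' hnat'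
    ((toKaroubi C).obj x) (HomGraded.id_mem x)
  have h1 : ∀ x, E x ≫ E' x = 𝟙 _ := by
    intro x
    obtain ⟨n, l, d, a, b, -, -, hab⟩ := exists_sum_homogeneousFactor hfin hP
      ((toKaroubi C).obj x) (HomGraded.id_mem x)
    refine map_hom_ext F.karoubiExt hab fun s => ?_
    rw [Category.assoc, ← hEa', ← Category.assoc, ← hEa, Category.assoc, Iso.hom_inv_id,
      Category.comp_id, Category.id_comp]
  have h2 : ∀ x, E' x ≫ E x = 𝟙 _ := by
    intro x
    obtain ⟨n, l, d, a, b, -, -, hab⟩ := exists_sum_homogeneousFactor hfin hP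
      ((toKaroubi C).obj x) (HomGraded.id_mem x)
    refine map_hom_ext G.karoubiExt hab fun s => ?_
    rw [Category.assoc, ← hEa, ← Category.assoc, ← hEa', Category.assoc, Iso.inv_hom_id,
      Category.comp_id, Category.id_comp]
  have h3 : ∀ (x y : C) (f : x ⟶ y), F.karoubiExt.map ((toKaroubi C).map f) ≫ E y =
      E x ≫ G.karoubiExt.map ((toKaroubi C).map f) := by
    intro x y f
    obtain ⟨n, l, d, a, b, -, -, hab⟩ := exists_sum_homogeneousFactor hfin hP
      ((toKaroubi C).obj y) (HomGraded.id_mem y)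
    refine map_hom_ext G.karoubiExt hab fun s => ?_
    rw [Category.assoc, ← hEa, Category.assoc, ← G.karoubiExt.map_comp, ← hEa,
      F.karoubiExt.map_comp, Category.assoc]
  exact ⟨NatIso.ofComponents
    (fun x => ⟨(E x).f, (E' x).f, (congrArg Karoubi.Hom.f (h1 x)).trans (F.H.map_id x),
      (congrArg Karoubi.Hom.f (h2 x)).trans (G.H.map_id x)⟩)
    fun f => congrArg Karoubi.Hom.f (h3 _ _ f), fun x => ⟨hE x, hE' x⟩⟩

/-! ### Block monomial elements of the base algebra -/

namespace HomAlg

theorem one_apply_self (i : ι) : (1 : HomAlg P) i i = 𝟙 (P i) := by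
  classical
  rw [one_apply, Pi.single_eq_same]

variable (π π' : Equiv.Perm ι)

/-- An element whose component `P (π i) ⟶ P (π' j)` vanishes for `i ≠ j`. -/
def IsMonomial (b : HomAlg P) : Prop := ∀ i j, i ≠ j → b (π i) (π' j) = 0

theorem exists_isMonomial [Fintype ι] (c : ∀ i, P (π i) ⟶ P (π' i)) :
    ∃ b : HomAlg P, IsMonomial π π' b ∧ ∀ i, b (π i) (π' i) = c i := by
  classical
  let b : HomAlg P := fun s t =>
    ∑ i, (Pi.single (π i) (Pi.single (π' i) (c i) : ∀ t, P (π i) ⟶ P t) : ∀ s t, P s ⟶ P t) s t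
  refine ⟨b, fun i j hij => ?_, fun i => ?_⟩
  · refine Finset.sum_eq_zero fun l _ => ?_
    by_cases h : l = i
    · subst h
      rw [Pi.single_eq_same, Pi.single_eq_of_ne (π'.injective.ne hij.symm)]
    · rw [Pi.single_eq_of_ne (π.injective.ne (Ne.symm h))]
      rfl
  · refine (Finset.sum_eq_single i (fun l _ h => ?_) (by simp)).trans (by simp)
    rw [Pi.single_eq_of_ne (π.injective.ne h.symm)]
    rfl

variable {π π'} [Fintype ι]

theorem IsMonomial.mul_right_apply {b : HomAlg P} (hb : IsMonomial π π' b) (a : HomAlg P)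
    (i t : ι) : (a * b) (π i) t = b (π i) (π' i) ≫ a (π' i) t := by
  rw [mul_apply, ← Equiv.sum_comp π', Finset.sum_eq_single i]
  · intro j _ hj
    rw [hb i j hj.symm, Limits.zero_comp]
  · simp

theorem IsMonomial.mul_left_apply {b : HomAlg P} (hb : IsMonomial π π' b) (a : HomAlg P)
    (s j : ι) : (b * a) s (π' j) = a s (π j) ≫ b (π j) (π' j) := by
  rw [mul_apply, ← Equiv.sum_comp π, Finset.sum_eq_single j]
  · intro i _ hi
    rw [hb i j hi, Limits.comp_zero]
  · simp

theorem IsMonomial.mul_eq_one {b b' : HomAlg P} (hb : IsMonomial π π' b)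
    (hb' : IsMonomial π' π b')
    (h : ∀ i, b (π i) (π' i) ≫ b' (π' i) (π i) = 𝟙 _) : b' * b = 1 := by
  classical
  ext s t
  obtain ⟨i, rfl⟩ := π.surjective s
  obtain ⟨j, rfl⟩ := π.surjective t
  rw [hb.mul_right_apply]
  by_cases hij : i = j
  · subst hij
    rw [h, one_apply_self]
  · rw [hb' i j hij, Limits.comp_zero, one_apply,
      Pi.single_eq_of_ne (π.injective.ne (Ne.symm hij))]

open Classical in
theorem idem_mul_apply (a : HomAlg P) (d s t : ι) :
    (idem P d * a) s t = if t = d then a s t else 0 := by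
  classical
  rw [mul_apply, Finset.sum_eq_single d]
  · by_cases h : t = d
    · subst h; simp [idem]
    · simp [idem, h]
  · intro l _ hl
    simp [idem, Pi.single_eq_of_ne hl]
  · simp

open Classical in
theorem mul_idem_apply (a : HomAlg P) (d s t : ι) :
    (a * idem P d) s t = if s = d then a s t else 0 := by
  classical
  by_cases h : s = d
  · subst h
    rw [mul_apply, Finset.sum_eq_single s]
    · simp [idem]
    · intro l _ hl
      simp [idem, Pi.single_eq_of_ne hl]
    · simp
  · rw [mul_apply, if_neg h]
    exact Finset.sum_eq_zero fun l _ => by simp [idem, h]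

end HomAlg

/-! ### Realizing automorphisms by functors -/

/-- The automorphism `f` of the base algebra is the one which the functor `F` induces by means of
homogeneous isomorphisms `F (P i) ≅ P (f i)`. -/
structure Realizes [Fintype ι] (F : GradedEndo k C) (f : DegAdjAut k P) where
  /-- the isomorphisms `F (P i) ≅ P (f i)` -/
  θ : ∀ i, F.karoubiExt.obj (P i) ≅ P (f.perm i)
  hom_mem : ∀ i, (θ i).hom ∈ karoubiDeg k _ _ (f.ℓ i - F.γ (P i).X)
  inv_mem : ∀ i, (θ i).inv ∈ karoubiDeg k _ _ (F.γ (P i).X - f.ℓ i)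
  α_apply : ∀ (a : HomAlg P) (i j : ι), f.α a (f.perm i) (f.perm j) =
    (θ i).inv ≫ F.karoubiExt.map (a i j) ≫ (θ j).hom

namespace Realizes

variable [Fintype ι]

theorem idShift (hP : ∀ i, (P i).p ∈ deg k (P i).X (P i).X 0) (N : ℤ) :
    Nonempty (Realizes (GradedEndo.idShift N) (DegAdjAut.idShift (k := k) (P := P) N)) :=
  ⟨{ θ := fun i => Iso.refl (P i)
     hom_mem := fun i => karoubiDeg_of_eq (karoubiDeg_id_mem (hP i)) (sub_self N).symm
     inv_mem := fun i => karoubiDeg_of_eq (karoubiDeg_id_mem (hP i)) (sub_self N).symm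
     α_apply := fun a i j =>
      ((Category.id_comp _).trans (Category.comp_id (a i j))).symm }⟩

theorem comp {F G : GradedEndo k C} {f g : DegAdjAut k P} (hF : Realizes F f)
    (hG : Realizes G g) : Nonempty (Realizes (GradedEndo.comp G F) (DegAdjAut.comp g f)) :=
  ⟨{ θ := fun i => G.karoubiExt.mapIso (hF.θ i) ≪≫ hG.θ (f.perm i)
     hom_mem := fun i => karoubiDeg_comp_mem (G.karoubiExt_map_mem (hF.hom_mem i))
      (hG.hom_mem (f.perm i)) (by
        simp only [GradedEndo.comp, DegAdjAut.comp, GradedEndo.karoubiExt]; ring)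
     inv_mem := fun i => karoubiDeg_comp_mem (hG.inv_mem (f.perm i))
      (G.karoubiExt_map_mem (hF.inv_mem i)) (by
        simp only [GradedEndo.comp, DegAdjAut.comp, GradedEndo.karoubiExt]; ring)
     α_apply := fun a i j => by
      have h := hG.α_apply (f.α a) (f.perm i) (f.perm j)
      rw [hF.α_apply] at h
      refine h.trans ?_
      change _ = ((hG.θ (f.perm i)).inv ≫ G.karoubiExt.map (hF.θ i).inv) ≫
        G.karoubiExt.map (F.karoubiExt.map (a i j)) ≫
          (G.karoubiExt.map (hF.θ j).hom ≫ (hG.θ (f.perm j)).hom)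
      simp only [Functor.map_comp, Category.assoc] }⟩

theorem pow (hP : ∀ i, (P i).p ∈ deg k (P i).X (P i).X 0) {F : GradedEndo k C}
    {f : DegAdjAut k P} (hF : Realizes F f) (n : ℕ) :
    Nonempty (Realizes (F.pow n) (f.pow n)) := by
  induction n with
  | zero => exact idShift hP 0
  | succ n ih =>
    obtain ⟨h⟩ := ih
    exact h.comp hF

variable {F G : GradedEndo k C} {f g : DegAdjAut k P}

/-- The unit of the base algebra is formed by the components of the natural isomorphism at the
objects `P i`, transported along the isomorphisms `θ`. -/
theorem isIso_automorphism (hP : ∀ i, (P i).p ∈ deg k (P i).X (P i).X 0) (hF : Realizes F f)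
    (hG : Realizes G g) (h : F.IsIso G) : f.IsIso g := by
  classical
  obtain ⟨e, he⟩ := h
  obtain ⟨b, hb, hbc⟩ := HomAlg.exists_isMonomial f.perm g.perm fun i =>
    (hF.θ i).inv ≫ GradedEndo.karoubiApp e.hom (P i) ≫ (hG.θ i).hom
  obtain ⟨b', hb', hbc'⟩ := HomAlg.exists_isMonomial g.perm f.perm fun i =>
    (hG.θ i).inv ≫ GradedEndo.karoubiApp e.inv (P i) ≫ (hF.θ i).hom
  have h1 : b' * b = 1 := hb.mul_eq_one hb' fun i => by
    rw [hbc, hbc']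
    simp only [Category.assoc, Iso.hom_inv_id_assoc]
    rw [← Category.assoc (GradedEndo.karoubiApp e.hom (P i)),
      GradedEndo.karoubiApp_comp e.hom_inv_id, Category.id_comp, Iso.inv_hom_id]
  have h2 : b * b' = 1 := hb'.mul_eq_one hb fun i => by
    rw [hbc, hbc']
    simp only [Category.assoc, Iso.hom_inv_id_assoc]
    rw [← Category.assoc (GradedEndo.karoubiApp e.inv (P i)),
      GradedEndo.karoubiApp_comp e.inv_hom_id, Category.id_comp, Iso.inv_hom_id]
  refine ⟨⟨b, b', h2, h1⟩, fun a => ?_, fun i s t => ?_⟩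
  · change g.α a * b = b * f.α a
    ext s t
    obtain ⟨i, rfl⟩ := f.perm.surjective s
    obtain ⟨j, rfl⟩ := g.perm.surjective t
    rw [hb.mul_right_apply, hb.mul_left_apply, hbc, hbc, hF.α_apply, hG.α_apply]
    simp only [Category.assoc, Iso.hom_inv_id_assoc]
    rw [← Category.assoc (F.karoubiExt.map (a i j)), GradedEndo.karoubiApp_naturality,
      Category.assoc]
  · change (g.α (HomAlg.idem P i) * b * f.α (HomAlg.idem P i)) s t ∈ _
    rw [f.map_idem, g.map_idem, HomAlg.idem_mul_mul_idem_apply]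
    split_ifs with hst
    · obtain ⟨rfl, rfl⟩ := hst
      rw [hbc]
      exact karoubiDeg_comp_mem (hF.inv_mem i) (karoubiDeg_comp_mem
        (GradedEndo.karoubiApp_mem (hP i) (he _).1) (hG.hom_mem i) rfl) (by ring)
    · exact Submodule.zero_mem _

/-- A unit of the base algebra relating the automorphisms is block monomial, since it intertwines
the idempotents `e_i`; its blocks form a natural isomorphism on the objects `P i`, which extends
to `C`. -/
theorem isIso_functor (hfin : ∀ x y : C, Module.Finite k (x ⟶ y)) (hP : IsBaseSkeleton k P)
    (hF : Realizes F f) (hG : Realizes G g) (h : f.IsIso g) : F.IsIso G := by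
  classical
  obtain ⟨b, hb, hb'⟩ := h
  have hmon : HomAlg.IsMonomial f.perm g.perm (b : HomAlg P) := by
    intro i j hij
    have h1 := congrArg (fun x : HomAlg P => x (f.perm i) (g.perm j)) (hb (HomAlg.idem P j))
    simp only [f.map_idem, g.map_idem, HomAlg.idem_mul_apply, HomAlg.mul_idem_apply] at h1
    simpa [hij] using h1
  have hmon' : HomAlg.IsMonomial g.perm f.perm (↑b⁻¹ : HomAlg P) := by
    intro i j hij
    have h0 : (↑b⁻¹ : HomAlg P) * g.α (HomAlg.idem P j) = f.α (HomAlg.idem P j) * ↑b⁻¹ := by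
      rw [Units.inv_mul_eq_iff_eq_mul, ← mul_assoc, ← hb, mul_assoc, Units.mul_inv, mul_one]
    have h1 := congrArg (fun x : HomAlg P => x (g.perm i) (f.perm j)) h0
    simp only [f.map_idem, g.map_idem, HomAlg.idem_mul_apply, HomAlg.mul_idem_apply] at h1
    simpa [hij] using h1.symm
  let c : ∀ i, P (f.perm i) ≅ P (g.perm i) := fun i =>
    { hom := (b : HomAlg P) (f.perm i) (g.perm i)
      inv := (↑b⁻¹ : HomAlg P) (g.perm i) (f.perm i)
      hom_inv_id := by
        rw [← hmon.mul_right_apply, Units.inv_mul, HomAlg.one_apply_self]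
      inv_hom_id := by
        rw [← hmon'.mul_right_apply, Units.mul_inv, HomAlg.one_apply_self] }
  have hc : ∀ i, (c i).hom ∈ karoubiDeg k _ _ (g.ℓ i - f.ℓ i) := by
    intro i
    have h1 := hb' i (f.perm i) (g.perm i)
    rw [f.map_idem, g.map_idem, HomAlg.idem_mul_mul_idem_apply, if_pos ⟨rfl, rfl⟩] at h1
    exact h1
  have hc' : ∀ i, (c i).inv ∈ karoubiDeg k _ _ (f.ℓ i - g.ℓ i) := fun i =>
    karoubiDeg_of_eq (inv_mem_karoubiDeg (hP.idem_mem _) (hP.idem_mem _) (hc i)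
      (c i).hom_inv_id (c i).inv_hom_id) (by ring)
  refine GradedEndo.isIso_of_base hfin hP F G (fun i => hF.θ i ≪≫ c i ≪≫ (hG.θ i).symm)
    (fun i => karoubiDeg_comp_mem (hF.hom_mem i)
      (karoubiDeg_comp_mem (hc i) (hG.inv_mem i) rfl) (by ring))
    (fun i => karoubiDeg_comp_mem (karoubiDeg_comp_mem (hG.hom_mem i) (hc' i) rfl)
      (hF.inv_mem i) (by ring)) fun i j a => ?_
  let x : HomAlg P := Pi.single i (Pi.single j a : ∀ j, P i ⟶ P j)
  have hx : x i j = a := by simp [x]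
  have h1 := congrArg (fun y : HomAlg P => y (f.perm i) (g.perm j)) (hb x)
  simp only [hmon.mul_right_apply, hmon.mul_left_apply, hF.α_apply, hG.α_apply, hx] at h1
  simp only [Iso.trans_hom, Iso.symm_hom, Category.assoc]
  rw [← cancel_mono (hG.θ j).hom, ← cancel_epi (hF.θ i).inv]
  simp only [Category.assoc, Iso.inv_hom_id_assoc, Iso.inv_hom_id, Category.comp_id] at h1 ⊢
  exact h1.symm

end Realizes

end

/-! ### Autoequivalences are realized on the base algebra -/

theorem IsIndecomposable.map {B : Type*} [Category* B] [Preadditive B] [IsIdempotentComplete B]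
    {Q : B} (hQ : IsIndecomposable Q) (Φ : B ⥤ B) [Φ.Additive] [Φ.Full] [Φ.Faithful] :
    IsIndecomposable (Φ.obj Q) := by
  refine isIndecomposable_of_idempotents (fun h => hQ.1 ?_) fun e he => ?_
  · rw [Limits.IsZero.iff_id_eq_zero] at h ⊢
    exact Φ.map_injective (by rw [Φ.map_id, h, Φ.map_zero])
  · obtain ⟨e, rfl⟩ := Φ.map_surjective e
    rcases hQ.eq_zero_or_eq_id e (Φ.map_injective (by rw [Φ.map_comp, he])) with h | h
    · exact Or.inl (by rw [h, Φ.map_zero])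
    · exact Or.inr (by rw [h, Φ.map_id])

section

variable {k : Type w} [Field k] {C : Type u} [Category.{v} C] [Preadditive C] [Linear k C]
  {ι : Type t} {P : ι → Karoubi C}

namespace HomAlg

theorem idem_apply_self (i : ι) : idem P i i i = 𝟙 (P i) := by
  classical
  simp [idem]

theorem idem_apply_of_ne {i s t : ι} (h : ¬ (s = i ∧ t = i)) : idem P i s t = 0 := by
  classical
  by_cases hs : s = i
  · subst hs
    simp [idem, Pi.single_eq_of_ne (fun ht => h ⟨rfl, ht⟩)]
  · simp [idem, Pi.single_eq_of_ne hs]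

theorem module_finite [Finite ι] (hfin : ∀ x y : C, Module.Finite k (x ⟶ y)) :
    Module.Finite k (HomAlg P) := by
  have := karoubi_finite hfin
  exact inferInstanceAs (Module.Finite k (∀ i j : ι, P i ⟶ P j))

/-- The algebra map of the base algebra which a fully faithful functor `Φ` induces by means of
isomorphisms `Φ (P i) ≅ P (π i)`; it is inverse to `a ↦ θ⁻¹ Φ(a) θ`. -/
def preimageHom [Fintype ι] (Φ : Karoubi C ⥤ Karoubi C) [Φ.Additive] [Φ.Linear k] [Φ.Full]
    [Φ.Faithful] (π : Equiv.Perm ι) (θ : ∀ i, Φ.obj (P i) ≅ P (π i)) :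
    HomAlg P →ₐ[k] HomAlg P :=
  AlgHom.ofLinearMap
    { toFun := fun a i j => Φ.preimage ((θ i).hom ≫ a (π i) (π j) ≫ (θ j).inv)
      map_add' := fun a b => by
        ext1 i j
        apply Φ.map_injective
        change Φ.map (Φ.preimage ((θ i).hom ≫ (a (π i) (π j) + b (π i) (π j)) ≫ (θ j).inv)) =
          Φ.map (Φ.preimage _ + Φ.preimage _)
        rw [Φ.map_add, Φ.map_preimage, Φ.map_preimage, Φ.map_preimage, Preadditive.add_comp,
          Preadditive.comp_add]
      map_smul' := fun c a => by
        ext1 i j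
        apply Φ.map_injective
        change Φ.map (Φ.preimage ((θ i).hom ≫ (c • a (π i) (π j)) ≫ (θ j).inv)) =
          Φ.map (c • Φ.preimage _)
        rw [Φ.map_smul, Φ.map_preimage, Φ.map_preimage, Linear.smul_comp, Linear.comp_smul] }
    (by
      ext1 i j
      apply Φ.map_injective
      change Φ.map (Φ.preimage _) = _
      rw [Φ.map_preimage]
      by_cases h : i = j
      · subst h
        simp [one_apply_self]
      · classical
        rw [one_apply, one_apply, Pi.single_eq_of_ne (π.injective.ne (Ne.symm h)),
          Pi.single_eq_of_ne (Ne.symm h), Limits.zero_comp, Limits.comp_zero, Φ.map_zero])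
    (fun a b => by
      ext1 i j
      apply Φ.map_injective
      change Φ.map (Φ.preimage _) = Φ.map (∑ l, Φ.preimage _ ≫ Φ.preimage _)
      rw [Φ.map_preimage, Φ.map_sum, mul_apply, ← Equiv.sum_comp π, Preadditive.sum_comp,
        Preadditive.comp_sum]
      refine Finset.sum_congr rfl fun l _ => ?_
      rw [Φ.map_comp, Φ.map_preimage, Φ.map_preimage]
      simp)

theorem map_preimageHom_apply [Fintype ι] (Φ : Karoubi C ⥤ Karoubi C) [Φ.Additive] [Φ.Linear k]
    [Φ.Full] [Φ.Faithful] (π : Equiv.Perm ι) (θ : ∀ i, Φ.obj (P i) ≅ P (π i)) (a : HomAlg P)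
    (i j : ι) : Φ.map (preimageHom (k := k) Φ π θ a i j) =
      (θ i).hom ≫ a (π i) (π j) ≫ (θ j).inv :=
  Φ.map_preimage _

theorem preimageHom_bijective [Fintype ι] (hfin : ∀ x y : C, Module.Finite k (x ⟶ y))
    (Φ : Karoubi C ⥤ Karoubi C) [Φ.Additive] [Φ.Linear k]
    [Φ.Full] [Φ.Faithful] (π : Equiv.Perm ι) (θ : ∀ i, Φ.obj (P i) ≅ P (π i)) :
    Function.Bijective (preimageHom (k := k) Φ π θ) := by
  have := module_finite (P := P) hfin
  have hinj : Function.Injective (preimageHom (k := k) Φ π θ).toLinearMap := by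
    intro a b hab
    ext1 s t
    obtain ⟨i, rfl⟩ := π.surjective s
    obtain ⟨j, rfl⟩ := π.surjective t
    have h : Φ.map (preimageHom (k := k) Φ π θ a i j) = Φ.map (preimageHom (k := k) Φ π θ b i j) :=
      congrArg (fun x : HomAlg P => Φ.map (x i j)) hab
    rw [map_preimageHom_apply, map_preimageHom_apply] at h
    simpa using h
  exact ⟨hinj, LinearMap.injective_iff_surjective.1 hinj⟩

end HomAlg

end

section

variable {k : Type w} [Field k] {C : Type u} [Category.{v} C] [Preadditive C] [Linear k C]
  [HomGraded k C] {ι : Type t} {P : ι → Karoubi C}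

theorem GradedEndo.IsEquiv.isEquivalence {F : GradedEndo k C} (hF : F.IsEquiv) :
    F.H.IsEquivalence := by
  obtain ⟨G, ⟨e, -⟩, ⟨e', -⟩⟩ := hF
  exact (CategoryTheory.Equivalence.mk F.H G.H e.symm e').isEquivalence_functor

variable {F : GradedEndo k C}

theorem GradedEndo.karoubiExt_faithful [F.H.Faithful] : F.karoubiExt.Faithful where
  map_injective h := Karoubi.Hom.ext (F.H.map_injective (congrArg Karoubi.Hom.f h))

theorem GradedEndo.karoubiExt_full [F.H.Full] [F.H.Faithful] : F.karoubiExt.Full where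
  map_surjective {Q R} g := by
    obtain ⟨h, hh⟩ := F.H.map_surjective (X := Q.X) (Y := R.X) g.f
    refine ⟨⟨h, F.H.map_injective ?_⟩, Karoubi.Hom.ext hh⟩
    rw [F.H.map_comp, F.H.map_comp, hh]
    exact g.comm

/-- An indecomposable object of degree `0` is homogeneously isomorphic to one of the `P i`. -/
theorem IsBaseSkeleton.exists_homogeneous_iso (hfin : ∀ x y : C, Module.Finite k (x ⟶ y))
    (hP : IsBaseSkeleton k P) {Q : Karoubi C} (hQ : Q.p ∈ deg k Q.X Q.X 0)
    (hind : IsIndecomposable Q) : ∃ (j : ι) (e : Q ≅ P j) (d : ℤ),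
      e.hom ∈ karoubiDeg k _ _ d ∧ e.inv ∈ karoubiDeg k _ _ (-d) := by
  have := karoubi_finite hfin
  obtain ⟨j, ⟨iso⟩⟩ := hP.complete Q hind
  obtain ⟨d, i, hi, r, hr, hir⟩ := exists_homogeneous_retract (hP.idem_mem j) hQ
    (hP.indecomposable j) iso.inv iso.hom iso.inv_hom_id
  have hri : r ≫ i = 𝟙 Q := by
    refine (hind.eq_zero_or_eq_id (r ≫ i) (by simp [reassoc_of% hir])).resolve_left fun h => ?_
    refine (hP.indecomposable j).1 ((Limits.IsZero.iff_id_eq_zero _).2 ?_)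
    calc 𝟙 (P j) = i ≫ (r ≫ i) ≫ r := by simp [hir]
      _ = 0 := by rw [h]; simp
  exact ⟨j, ⟨r, i, hri, hir⟩, -d, hr, karoubiDeg_of_eq hi (neg_neg d).symm⟩

/-- Every autoequivalence of the hom-graded category realizes a degree-adjusted automorphism of
the base algebra: it permutes the homogeneous isomorphism classes of indecomposable objects. -/
theorem GradedEndo.IsEquiv.exists_realizes [Fintype ι]
    (hfin : ∀ x y : C, Module.Finite k (x ⟶ y)) (hP : IsBaseSkeleton k P) (hF : F.IsEquiv) :
    ∃ f : DegAdjAut k P, Nonempty (Realizes F f) := by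
  have := hF.isEquivalence
  have := F.karoubiExt_faithful
  have := F.karoubiExt_full
  choose π θ d hθ hθ' using fun i => hP.exists_homogeneous_iso hfin
    (F.karoubiExt_obj_p_mem (hP.idem_mem i)) ((hP.indecomposable i).map F.karoubiExt)
  have hinj : Function.Injective π := fun i j hij =>
    hP.irredundant i j ⟨F.karoubiExt.preimageIso (θ i ≪≫ eqToIso (by rw [hij]) ≪≫ (θ j).symm)⟩
  let ρ : Equiv.Perm ι := Equiv.ofBijective π (Finite.injective_iff_bijective.1 hinj)
  let θ' : ∀ i, F.karoubiExt.obj (P i) ≅ P (ρ i) := θ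
  let α : HomAlg P ≃ₐ[k] HomAlg P :=
    (AlgEquiv.ofBijective _ (HomAlg.preimageHom_bijective (k := k) hfin F.karoubiExt ρ θ')).symm
  have hα : ∀ (a : HomAlg P) (i j : ι), α a (ρ i) (ρ j) =
      (θ' i).inv ≫ F.karoubiExt.map (a i j) ≫ (θ' j).hom := by
    intro a i j
    have h1 : HomAlg.preimageHom (k := k) F.karoubiExt ρ θ' (α a) = a :=
      (AlgEquiv.ofBijective _ (HomAlg.preimageHom_bijective (k := k) hfin F.karoubiExt ρ
        θ')).apply_symm_apply a
    have h2 := HomAlg.map_preimageHom_apply (k := k) F.karoubiExt ρ θ' (α a) i j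
    rw [h1] at h2
    rw [h2]
    simp
  refine ⟨⟨α, ρ, fun i => ?_, fun i => d i + F.γ (P i).X, fun {p a} ha c e => ?_⟩,
    ⟨⟨θ', fun i => ?_, fun i => ?_, hα⟩⟩⟩
  · ext1 s t
    obtain ⟨s, rfl⟩ := ρ.surjective s
    obtain ⟨t, rfl⟩ := ρ.surjective t
    rw [hα]
    by_cases h : s = i ∧ t = i
    · obtain ⟨rfl, rfl⟩ := h
      rw [HomAlg.idem_apply_self, HomAlg.idem_apply_self, F.karoubiExt.map_id, Category.id_comp,
        Iso.inv_hom_id]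
    · rw [HomAlg.idem_apply_of_ne h, HomAlg.idem_apply_of_ne
        (fun h' => h ⟨ρ.injective h'.1, ρ.injective h'.2⟩), F.karoubiExt.map_zero,
        Limits.zero_comp, Limits.comp_zero]
  · intro s t
    obtain ⟨s, rfl⟩ := ρ.surjective s
    obtain ⟨t, rfl⟩ := ρ.surjective t
    rw [hα, HomAlg.idem_mul_mul_idem_apply]
    split_ifs with h
    · obtain ⟨rfl, rfl⟩ := h
      exact karoubiDeg_comp_mem (hθ' s)
        (karoubiDeg_comp_mem (F.karoubiExt_map_mem (ha s t)) (hθ t) rfl) (by ring)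
    · rw [F.karoubiExt.map_zero, Limits.zero_comp, Limits.comp_zero]
      exact Submodule.zero_mem _
  · exact karoubiDeg_of_eq (hθ i) (by ring)
  · exact karoubiDeg_of_eq (hθ' i) (by ring)

/-! ### Serre functors and Nakayama automorphisms -/

namespace GradedSerreStructure

variable {χ : AddChar ℤ kˣ} [Fintype ι] (τ : GradedSerreStructure (k := k) C χ)
  {f : DegAdjAut k P}

/-- The extension of `κ` to the idempotent completion. -/
def karoubiκ (Q R : Karoubi C) :
    (Q ⟶ R) →ₗ[k] Module.Dual k (R ⟶ τ.S.karoubiExt.obj Q) :=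
  LinearMap.mk₂ k (fun f u => τ.κ Q.X R.X f.f u.f)
    (fun f f' _ => DFunLike.congr_fun (map_add (τ.κ _ _) f.f f'.f) _)
    (fun c f _ => DFunLike.congr_fun (map_smul (τ.κ _ _) c f.f) _)
    (fun _ u u' => map_add (τ.κ _ _ _) u.f u'.f)
    (fun c _ u => map_smul (τ.κ _ _ _) c u.f)

theorem karoubiκ_left {Q R Z : Karoubi C} {r : ℤ} (g : Q ⟶ R) {h : R ⟶ Z}
    (hh : h ∈ karoubiDeg k R Z r) (u : Z ⟶ τ.S.karoubiExt.obj Q) :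
    τ.karoubiκ Q Z (g ≫ h) u = (χ r : k) * τ.karoubiκ Q R g (h ≫ u) :=
  τ.κ_left g.f h.f u.f hh

theorem karoubiκ_right {Q R Z : Karoubi C} (f : Q ⟶ R) (g : R ⟶ Z)
    (u : Z ⟶ τ.S.karoubiExt.obj Q) :
    τ.karoubiκ Q Z (f ≫ g) u = τ.karoubiκ R Z g (u ≫ τ.S.karoubiExt.map f) :=
  τ.κ_right f.f g.f u.f

theorem karoubiκ_deg {Q R : Karoubi C} {p q : ℤ} {f : Q ⟶ R} {u : R ⟶ τ.S.karoubiExt.obj Q}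
    (hf : f ∈ karoubiDeg k _ _ p) (hu : u ∈ karoubiDeg k _ _ q) (h : q ≠ τ.S.γ Q.X - p) :
    τ.karoubiκ Q R f u = 0 :=
  τ.κ_deg (f := f.f) (u := u.f) hf hu h

/-- `κ` is nondegenerate on the idempotent completion, since `κ(p f q)(u) = κ(f)(q u S(p))` for
maps `p` and `q` of degree `0`. -/
theorem karoubiκ_injective {Q R : Karoubi C} (hR : R.p ∈ deg k R.X R.X 0) {f : Q ⟶ R}
    (h : τ.karoubiκ Q R f = 0) : f = 0 := by
  refine Karoubi.Hom.ext (τ.κ_injective _ _ (LinearMap.ext fun u => ?_))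
  let v : R ⟶ τ.S.karoubiExt.obj Q :=
    ⟨R.p ≫ u ≫ τ.S.H.map Q.p, by
      change R.p ≫ (R.p ≫ u ≫ τ.S.H.map Q.p) ≫ τ.S.H.map Q.p = _
      simp only [Category.assoc, ← Functor.map_comp, Q.idem, reassoc_of% R.idem]
      rfl⟩
  have h1 : τ.κ Q.X R.X f.f v.f = 0 := DFunLike.congr_fun h v
  have h2 := τ.κ_left f.f R.p u hR
  have h3 := τ.κ_right Q.p f.f (R.p ≫ u)
  rw [Karoubi.comp_p, AddChar.map_zero_eq_one, Units.val_one, one_mul] at h2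
  rw [Karoubi.p_comp, Category.assoc] at h3
  exact h2.trans (h3.trans h1)

/-- The form `φ(a)(m) = ∑ κ(a_ij)(m_ij)` on the base algebra, where `m_ij` is the component
`P j ⟶ P (f i) ≅ S (P i)` of `m`. -/
def frobeniusForm (R : Realizes τ.S f) : HomAlg P →ₗ[k] Module.Dual k (HomAlg P) :=
  LinearMap.mk₂ k
    (fun a m => ∑ i, ∑ j, τ.karoubiκ (P i) (P j) (a i j) (m j (f.perm i) ≫ (R.θ i).inv))
    (fun a a' m => by
      simp only [HomAlg.add_apply, map_add, LinearMap.add_apply, Finset.sum_add_distrib])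
    (fun c a m => by
      simp only [HomAlg.smul_apply, map_smul, LinearMap.smul_apply, Finset.smul_sum])
    (fun a m m' => by
      simp only [HomAlg.add_apply, Preadditive.add_comp, map_add, Finset.sum_add_distrib])
    (fun c a m => by
      simp only [HomAlg.smul_apply, Linear.smul_comp, map_smul, Finset.smul_sum])

theorem frobeniusForm_apply (R : Realizes τ.S f) (a m : HomAlg P) : τ.frobeniusForm R a m =
    ∑ i, ∑ j, τ.karoubiκ (P i) (P j) (a i j) (m j (f.perm i) ≫ (R.θ i).inv) := rfl

theorem frobeniusForm_injective (R : Realizes τ.S f)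
    (hP : ∀ i, (P i).p ∈ deg k (P i).X (P i).X 0) :
    Function.Injective (τ.frobeniusForm R) := by
  classical
  rw [injective_iff_map_eq_zero]
  intro a ha
  ext1 i j
  refine τ.karoubiκ_injective (hP j) (LinearMap.ext fun v => ?_)
  let m : HomAlg P := Pi.single j (Pi.single (f.perm i) (v ≫ (R.θ i).hom) : ∀ t, P j ⟶ P t)
  have h1 : τ.frobeniusForm R a m = τ.karoubiκ (P i) (P j) (a i j) v := by
    rw [frobeniusForm_apply, Finset.sum_eq_single i, Finset.sum_eq_single j]
    · have : m j (f.perm i) = v ≫ (R.θ i).hom := by simp [m]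
      rw [this, Category.assoc, Iso.hom_inv_id, Category.comp_id]
    · intro t _ ht
      have : m t = 0 := Pi.single_eq_of_ne ht _
      rw [this, Pi.zero_apply, Limits.zero_comp, map_zero]
    · simp
    · intro s _ hs
      refine Finset.sum_eq_zero fun t _ => ?_
      have : m t (f.perm s) = 0 := by
        by_cases ht : t = j
        · subst ht
          simp [m, Pi.single_eq_of_ne (f.perm.injective.ne hs)]
        · simp [m, Pi.single_eq_of_ne ht]
      rw [this, Limits.zero_comp, map_zero]
    · simp
  rw [← h1, ha]
  rfl

/-- Transported along the isomorphisms `S (P i) ≅ P (f i)`, a graded Serre functor becomes a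
Nakayama automorphism of the base algebra. -/
theorem isNakayama (R : Realizes τ.S f) (hfin : ∀ x y : C, Module.Finite k (x ⟶ y))
    (hP : ∀ i, (P i).p ∈ deg k (P i).X (P i).X 0) : f.IsNakayama χ := by
  have := HomAlg.module_finite (P := P) hfin
  have hφ : ∀ a m : HomAlg P, LinearMap.linearEquivOfInjective (τ.frobeniusForm R)
      (τ.frobeniusForm_injective R hP) Subspace.dual_finrank_eq.symm a m =
        ∑ i, ∑ j, τ.karoubiκ (P i) (P j) (a i j) (m j (f.perm i) ≫ (R.θ i).inv) :=
    fun _ _ => rfl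
  refine ⟨LinearMap.linearEquivOfInjective (τ.frobeniusForm R)
    (τ.frobeniusForm_injective R hP) Subspace.dual_finrank_eq.symm, ?_, ?_, ?_⟩
  · intro p c hc a m
    rw [hφ, hφ, Finset.mul_sum]
    refine Finset.sum_congr rfl fun i _ => ?_
    have h1 : ∀ j, τ.karoubiκ (P i) (P j) ((c * a) i j) (m j (f.perm i) ≫ (R.θ i).inv) =
        ∑ l, τ.karoubiκ (P i) (P j) (a i l ≫ c l j) (m j (f.perm i) ≫ (R.θ i).inv) := by
      intro j
      rw [HomAlg.mul_apply, map_sum, LinearMap.sum_apply]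
    have h2 : ∀ j, (χ p : k) * τ.karoubiκ (P i) (P j) (a i j)
        ((m * c) j (f.perm i) ≫ (R.θ i).inv) = ∑ l, (χ p : k) * τ.karoubiκ (P i) (P j) (a i j)
          ((c j l ≫ m l (f.perm i)) ≫ (R.θ i).inv) := by
      intro j
      rw [HomAlg.mul_apply, Preadditive.sum_comp, map_sum, Finset.mul_sum]
    rw [Finset.mul_sum, Finset.sum_congr rfl fun j _ => h1 j,
      Finset.sum_congr rfl fun j _ => h2 j, Finset.sum_comm]
    refine Finset.sum_congr rfl fun j _ => Finset.sum_congr rfl fun l _ => ?_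
    rw [Category.assoc]
    exact τ.karoubiκ_left (a i j) (hc j l) _
  · intro a c m
    rw [hφ, hφ]
    have h1 : ∀ i j, (f.α c * m) j (f.perm i) ≫ (R.θ i).inv =
        ∑ l, (m j (f.perm l) ≫ (R.θ l).inv) ≫ τ.S.karoubiExt.map (c l i) := by
      intro i j
      rw [HomAlg.mul_apply, ← Equiv.sum_comp f.perm, Preadditive.sum_comp]
      refine Finset.sum_congr rfl fun l _ => ?_
      rw [R.α_apply]
      simp only [Category.assoc, Iso.hom_inv_id, Category.comp_id]
    have h2 : ∀ l j, τ.karoubiκ (P l) (P j) ((a * c) l j) (m j (f.perm l) ≫ (R.θ l).inv) =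
        ∑ i, τ.karoubiκ (P l) (P j) (c l i ≫ a i j) (m j (f.perm l) ≫ (R.θ l).inv) := by
      intro l j
      rw [HomAlg.mul_apply, map_sum, LinearMap.sum_apply]
    have h3 : ∀ i j, τ.karoubiκ (P i) (P j) (a i j)
        ((f.α c * m) j (f.perm i) ≫ (R.θ i).inv) = ∑ l, τ.karoubiκ (P i) (P j) (a i j)
          ((m j (f.perm l) ≫ (R.θ l).inv) ≫ τ.S.karoubiExt.map (c l i)) := by
      intro i j
      rw [h1, map_sum]
    rw [Finset.sum_congr rfl fun l _ => Finset.sum_congr rfl fun j _ => h2 l j,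
      Finset.sum_congr rfl fun i _ => Finset.sum_congr rfl fun j _ => h3 i j,
      Finset.sum_congr rfl fun l _ => Finset.sum_comm, Finset.sum_comm]
    refine Finset.sum_congr rfl fun i _ => ?_
    rw [Finset.sum_comm]
    refine Finset.sum_congr rfl fun j _ => Finset.sum_congr rfl fun l _ => ?_
    exact τ.karoubiκ_right (c l i) (a i j) _
  · intro p q a m i ha hm hq
    classical
    rw [hφ]
    refine Finset.sum_eq_zero fun s _ => Finset.sum_eq_zero fun t _ => ?_
    rw [HomAlg.mul_idem_apply]
    split_ifs with h
    · subst h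
      exact τ.karoubiκ_deg (ha s t) (karoubiDeg_comp_mem (hm t (f.perm s)) (R.inv_mem s) rfl)
        (by omega)
    · rw [map_zero, LinearMap.zero_apply]

end GradedSerreStructure

end

end
end FCY

namespace FCY

/-- If the hom-graded category has a graded Serre functor at all, then it has one whose power is
isomorphic to `(id, N)` if and only if the base algebra has such a Nakayama automorphism. -/
theorem GradedSerreStructure.pow_isIso_iff_nakayama {k : Type w} [Field k] {C : Type u}
    [Category.{v} C] [Preadditive C] [Linear k C] [HomGraded k C] {ι : Type t} [Fintype ι]
    {P : ι → Karoubi C} {χ : AddChar ℤ kˣ} (τ₀ : GradedSerreStructure (k := k) C χ)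
    (hfin : ∀ x y : C, Module.Finite k (x ⟶ y)) (hP : IsBaseSkeleton k P) (l : ℕ) (N : ℤ) :
    (∃ τ : GradedSerreStructure (k := k) C χ, (τ.S.pow l).IsIso (GradedEndo.idShift N)) ↔
      ∃ f : DegAdjAut k P, f.IsNakayama χ ∧ (f.pow l).IsIso (DegAdjAut.idShift N) := by
  obtain ⟨R₀⟩ := Realizes.idShift (k := k) hP.idem_mem N
  constructor
  · rintro ⟨τ, h⟩
    obtain ⟨f, ⟨R⟩⟩ := τ.isEquiv.exists_realizes hfin hP
    obtain ⟨Rl⟩ := R.pow hP.idem_mem l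
    exact ⟨f, τ.isNakayama R hfin hP.idem_mem, Rl.isIso_automorphism hP.idem_mem R₀ h⟩
  · rintro ⟨f, hf, h⟩
    obtain ⟨g, ⟨R⟩⟩ := τ₀.isEquiv.exists_realizes hfin hP
    obtain ⟨Rl⟩ := R.pow hP.idem_mem l
    -- Nakayama automorphisms are unique up to isomorphism, so `g` has the same powers as `f`
    have hgf := (τ₀.isNakayama R hfin hP.idem_mem).isIso hP.idem_mem hf
    exact ⟨τ₀, Rl.isIso_functor hfin hP R₀ ((hgf.pow hP.idem_mem l).trans h)⟩

end FCY

theorem theorem4p13 {k : Type w} [Field k] {D : Type u} [Category.{v} D] [Preadditive D]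
    [Linear k D] [HasShift D ℤ] [∀ n : ℤ, (shiftFunctor D n).Additive]
    [∀ n : ℤ, (shiftFunctor D n).Linear k]
    (χ : AddChar ℤ kˣ) (m N : ℕ) (hN : N ≤ m)
    (σ : FCY.SerreStructure k D)
    (F : D ⥤ D) [F.Additive] [F.Linear k] [F.IsEquivalence]
    (hT : Nonempty (shiftFunctor D (1 : ℤ) ≅ F ⋙ σ.S.inv)) :
    ((∃ (τ : FCY.SerreStructure k D) (s : τ.S.CommShift ℤ), τ.IsEquivariant χ s ∧
        ((τ.equivariant s).pow (m - N)).IsIso ((FCY.generator (k := k) (D := D)).pow N)) ↔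
      ∃ τ : FCY.GradedSerreStructure (k := k) (FCY.Orbit D) χ,
        (τ.S.pow (m - N)).IsIso (FCY.GradedEndo.idShift (N : ℤ))) ∧
    ((∀ x y : FCY.Orbit D, Module.Finite k (x ⟶ y)) →
      FCY.FinitelyManyIndecomposables (FCY.Orbit D) →
      ∀ {ι : Type t} [Fintype ι] (P : ι → Karoubi (FCY.Orbit D)), FCY.IsBaseSkeleton k P →
        ((∃ τ : FCY.GradedSerreStructure (k := k) (FCY.Orbit D) χ,
            (τ.S.pow (m - N)).IsIso (FCY.GradedEndo.idShift (N : ℤ))) ↔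
          ∃ f : FCY.DegAdjAut k P, f.IsNakayama χ ∧
            (f.pow (m - N)).IsIso (FCY.DegAdjAut.idShift (N : ℤ)))) := by
  refine ⟨FCY.equivariant_iff_orbit χ (m - N) N σ, fun hfin _ ι _ P hP => ?_⟩
  exact (FCY.SerreStructure.orbitSerre (σ.twistedCommShift_isEquivariant χ)).pow_isIso_iff_nakayama
    hfin hP (m - N) N
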